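/- **Setting.** Let $d_1,d_2\ge 1$. Let $\boldsymbol u^{(1)},\boldsymbol u^{(2)},\dots$ and $\boldsymbol t^{(1)},\boldsymbol t^{(2)},\dots$ be Sobol' sequences (base two) in dimensions $d_1$ and $d_2$. Let $\boldsymbol x^{(m)}=\boldsymbol t^{(m)}$ be the deterministic inner points, and for each level $\ell$ let $\boldsymbol y^{(\ell,n)}=\boldsymbol\tau^{(\ell)}(\boldsymbol u^{(n)})$ be the outer points, where $\boldsymbol\tau^{(\ell)}$ is an Owen (nested uniform) scrambling. Let $M_\ell=M_02^\ell$ and $h_\ell=h_02^{-\ell}$ with $M_0\in\mathbb N$, $M_0\ge 1$, $h_0>0$, and let $N_\ell\ge1$ be integers. Let $g$ and $g_h$ ($h>0$) be real functions on $[0,1]^{d_1}\times[0,1]^{d_2}$, with $g(\boldsymbol y,\cdot)$ integrable for $\boldsymbol y\in(0,1)^{d_1}$, and put $$\bar g(\boldsymbol y)=\int_{[0,1]^{d_2}}g(\boldsymbol y,\boldsymbol x)\,d\boldsymbol x,\qquad q_\ell(\boldsymbol y)=\frac1{M_\ell}\sum_{m=1}^{M_\ell}g_{h_\ell}(\boldsymbol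 y,\boldsymbol x^{(m)}).$$ Let $f$ be a real function that is twice differentiable on an open interval containing all values $\bar g(\boldsymbol y)$ and $q_\ell(\boldsymbol y)$, $\boldsymbol y\in(0,1)^{d_1}$, $0\le\ell\le L-1$ (for instance on all of $\mathbb R$), with $f''$ integrable on its compact subintervals. The two terms of the $\ell$-th level of the multilevel estimator (with one randomization) are $$I_\ell^{k}=\frac1{N_\ell}\sum_{n=1}^{N_\ell}f\big(q_k(\boldsymbol y^{(\ell,n)})\big),\qquad k\in\{\ell,\ell-1\}.$$ For $b>0$ and $A\in(0,1/2)^{d_1}$, a function $\varphi$ on $(0,1)^{d_1}$ satisfies the *boundary growth condition with constants $(b,A)$* if for all $u\subseteq\{1,\dots,d_1\}$ the mixed partial derivative $\partial^u\varphi$, of order one in each $y_j$, $j\in u$, exists (independently of the order of differentiation) and $$|\partial^u\varphi(\boldsymbol y)|\le b\prod_{i=1}^{d_1}\min(y_i,1-y_i)^{-A_i-\mathbf 1_{\{i\in u\}}}\qquad\text{for all }\boldsymbol y\in(0,1)^{d_1}.$$ Write $A_{\max}=\max_iA_i$, and $$\varphi_\ell^{(I)}=f'(\bar g)(q_\ell-\bar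 g),\qquad \varphi_\ell^{(II)}=(q_\ell-\bar g)^2\int_0^1f''\big(\bar g+s(q_\ell-\bar g)\big)(1-s)\,ds .$$ **Proposition (variance of level $\ell$, $1\le\ell\le L-1$).** There are positive functions $A\mapsto B_A$ on $(0,1/2)^{d_1}$, with $B_A\to\infty$ as $\min_iA_i\to0$, and $(\epsilon,\eta)\mapsto\kappa^{(I)}_{\epsilon,\eta},\kappa^{(II)}_{\epsilon,\eta}$, all depending only on $d_1$, and a function $\epsilon\mapsto C_{\epsilon,d_1}>0$ depending only on the Sobol' sequence $\boldsymbol u$, with $C_{\epsilon,d_1}\to\infty$ as $\epsilon\to0$ and with $$\mathbb E\big[D^*(\boldsymbol y^{(\ell,1)},\dots,\boldsymbol y^{(\ell,N)})\big]\le C_{\epsilon,d_1}N^{-1+\epsilon}\qquad(N\ge1,\ \epsilon>0)$$ for the star discrepancy $D^*$, such that the following holds. Let $\epsilon>0$, let $C_{\epsilon,d_2},\eta_s,C_{\eta_s},\tilde b^{(I)},\tilde b^{(II)}>0$ be arbitrary constants (for example, $C_{\epsilon,d_2}$ may be the constant in the star discrepancy bound $D^*(\boldsymbol x^{(1)},\dots,\boldsymbol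 x^{(M)})\le C_{\epsilon,d_2}M^{-1+\epsilon}$ of the inner points), and let $A^{(I)},A^{(II)}\in(0,1/2)^{d_1}$. Suppose that for every $0\le\ell\le L-1$ the function $\varphi_\ell^{(I)}$ satisfies the boundary growth condition with constants $$\Big(\big(C_{\epsilon,d_2}M_\ell^{-1+\epsilon}+C_{\eta_s}h_\ell^{\eta_s}\big)\tilde b^{(I)},\,A^{(I)}\Big),$$ and $\varphi_\ell^{(II)}$ satisfies it with constants $$\Big(\big(C_{\epsilon,d_2}^2M_\ell^{-2+2\epsilon}+C_{\eta_s}^2h_\ell^{2\eta_s}\big)\tilde b^{(II)},\,A^{(II)}\Big).$$ Put $b^{(I)}=\kappa^{(I)}_{\epsilon,\eta_s}\tilde b^{(I)}$ and $b^{(II)}=\kappa^{(II)}_{\epsilon,\eta_s}\tilde b^{(II)}$. Then for every $1\le\ell\le L-1$ the level difference $I_\ell^\ell-I_\ell^{\ell-1}$ is square integrable and $$\mathbb V\big[I_\ell^{\ell}-I_\ell^{\ell-1}\big]\le\frac{\Big(\frac{C_{\epsilon,d_2}^2}{M_\ell^{2-2\epsilon}}+C_{\eta_s}^2h_\ell^{2\eta_s}\Big)(b^{(I)})^2B_{A^{(I)}}^2C_{\epsilon,d_1}^2}{N_\ell^{2-2\epsilon-2A^{(I)}_{\max}}}+\frac{\Big(\frac{C_{\epsilon,d_2}^4}{M_\ell^{4-4\epsilon}}+C_{\eta_s}^4h_\ell^{4\eta_s}\Big)(b^{(II)})^2B_{A^{(II)}}^2C_{\epsilon,d_1}^2}{N_\ell^{2-2\epsilon-2A^{(II)}_{\max}}}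 .$$ -/

import Mathlib

open MeasureTheory ProbabilityTheory Filter Topology Polynomial

noncomputable section

namespace NestedQMC

/-! ### Sobol' sequences -/

/-- A primitive polynomial over the field with two elements: it is irreducible, and its root
generates the multiplicative group of the residue field (which has `2 ^ deg p - 1` elements). -/
def IsPrimitivePoly (p : (ZMod 2)[X]) : Prop :=
  Irreducible p ∧ orderOf (AdjoinRoot.root p) = 2 ^ p.natDegree - 1

/-- The data of a `d`-dimensional Sobol' sequence. `dir j r k` is the binary digit of weight
`2 ^ (-(k+1))` of the `r`-th direction number `v_r = m_r / 2 ^ (r+1)` (`m_r` odd,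
`m_r < 2 ^ (r+1)`, counted from `r = 0`) of the coordinate `j`.

The first coordinate is the van der Corput sequence. The other coordinates use pairwise distinct
primitive polynomials; for `p = x ^ s + a_1 x ^ (s-1) + ⋯ + a_s` the direction numbers satisfy
`v_r = a_1 v_(r-1) ⊕ ⋯ ⊕ a_s v_(r-s) ⊕ (v_(r-s) / 2 ^ s)` for `r ≥ s`, and the
first `s` of them are free. -/
structure SobolData (d : ℕ) where
  poly : Fin d → (ZMod 2)[X]
  dir : Fin d → ℕ → ℕ → ZMod 2
  dir_diag : ∀ j r, dir j r r = 1
  dir_above : ∀ j r k, r < k → dir j r k = 0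
  dir_first : ∀ j : Fin d, j.val = 0 → ∀ r k, r ≠ k → dir j r k = 0
  poly_primitive : ∀ j : Fin d, j.val ≠ 0 → IsPrimitivePoly (poly j)
  poly_distinct : ∀ i j : Fin d, i.val ≠ 0 → j.val ≠ 0 → poly i = poly j → i = j
  dir_rec : ∀ j : Fin d, j.val ≠ 0 → ∀ r k, (poly j).natDegree ≤ r →
    dir j r k =
      (∑ i ∈ Finset.Icc 1 (poly j).natDegree,
        (poly j).coeff ((poly j).natDegree - i) * dir j (r - i) k) +
      (if (poly j).natDegree ≤ k
        then dir j (r - (poly j).natDegree) (k - (poly j).natDegree) else 0)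

/-- The binary digits of the `n`-th point of the sequence (`n = 0, 1, 2, …`): the exclusive or
of the direction numbers `v_r` over those `r` for which the `r`-th binary digit of `n` is one. -/
def SobolData.digit {d : ℕ} (T : SobolData d) (n : ℕ) (j : Fin d) (k : ℕ) : ZMod 2 :=
  ∑ r ∈ Finset.range n.size, if n.testBit r then T.dir j r k else 0

/-- The real number with binary expansion `0.c₀c₁c₂…`. -/
def ofDigits (c : ℕ → ZMod 2) : ℝ :=
  ∑' k, ((c k).val : ℝ) / 2 ^ (k + 1)

/-- The `n`-th point of the Sobol' sequence, in `[0,1)^d`. -/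
def SobolData.point {d : ℕ} (T : SobolData d) (n : ℕ) : Fin d → ℝ :=
  fun j => ofDigits (T.digit n j)

/-! ### Owen's scrambling -/

/-- Owen's nested scrambling in base two of the point with binary digits `c`: the digit number `k`
of the coordinate `j` is permuted by a permutation of `{0, 1}` that depends on `j` and on the
preceding digits `c j 0, …, c j (k-1)`; that permutation is the swap if `π j [c j 0, …, c j (k-1)]`
is `true`, and the identity otherwise. -/
def scramble {d : ℕ} (π : Fin d → List (ZMod 2) → Bool) (c : Fin d → ℕ → ZMod 2) :
    Fin d → ℝ :=
  fun j => ofDigits fun k =>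
    c j k + if π j ((List.range k).map (c j)) then 1 else 0

/-- `π` is a (uniform) random Owen scrambling: all the permutations that it is made of are
independent, and each of them is uniformly distributed. -/
structure IsOwenScrambling {Ω : Type*} [MeasurableSpace Ω] (μ : Measure Ω) {d : ℕ}
    (π : Ω → Fin d → List (ZMod 2) → Bool) : Prop where
  measurable : ∀ j w, Measurable fun ω => π ω j w
  uniform : ∀ j w, μ {ω | π ω j w = true} = 1 / 2
  indep : iIndepFun (fun (i : Fin d × List (ZMod 2)) ω => π ω i.1 i.2) μ

/-- The star discrepancy of the points `x 0, …, x (N-1)` of `[0,1]^d`. -/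
def starDiscrepancy {d : ℕ} (x : ℕ → Fin d → ℝ) (N : ℕ) : ℝ :=
  ⨆ a : Set.Icc (0 : Fin d → ℝ) 1,
    |(Nat.card {n : Fin N // ∀ j, 0 ≤ x n j ∧ x n j < a.1 j} : ℝ) / N - ∏ j, a.1 j|

/-! ### The boundary growth condition -/

/-- The open unit cube `(0,1)^d`. -/
def openCube (d : ℕ) : Set (Fin d → ℝ) := {y | ∀ i, 0 < y i ∧ y i < 1}

/-- On the open unit cube, `D u` is the mixed partial derivative of `φ` of order one in each of
the variables `y_j`, `j ∈ u` (existing in every order of differentiation). -/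
def IsMixedPartials {d : ℕ} (φ : (Fin d → ℝ) → ℝ)
    (D : Finset (Fin d) → (Fin d → ℝ) → ℝ) : Prop :=
  (∀ y ∈ openCube d, D ∅ y = φ y) ∧
  ∀ (u : Finset (Fin d)) (j : Fin d), j ∉ u → ∀ y ∈ openCube d,
    HasDerivAt (fun t => D u (Function.update y j t)) (D (insert j u) y) (y j)

/-- The boundary growth condition with constant `b` and exponents `A`:
`|∂^u φ(y)| ≤ b ∏ᵢ min(yᵢ, 1 - yᵢ)^(-Aᵢ - 1_{i ∈ u})` on `(0,1)^d` for all `u`. -/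
def BoundaryGrowth {d : ℕ} (φ : (Fin d → ℝ) → ℝ) (b : ℝ) (A : Fin d → ℝ) : Prop :=
  ∃ D : Finset (Fin d) → (Fin d → ℝ) → ℝ, IsMixedPartials φ D ∧
    ∀ u, ∀ y ∈ openCube d,
      |D u y| ≤ b * ∏ i, min (y i) (1 - y i) ^ (-A i - if i ∈ u then (1 : ℝ) else 0)

/-! ### The estimator -/

/-- `ḡ(y) = ∫_{[0,1]^{d₂}} g(y,x) dx`. -/
def innerIntegral {d₁ d₂ : ℕ} (g : (Fin d₁ → ℝ) → (Fin d₂ → ℝ) → ℝ) (y : Fin d₁ → ℝ) : ℝ :=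
  ∫ x in Set.Icc (0 : Fin d₂ → ℝ) 1, g y x

/-- The number of inner points `M_ℓ = M₀ 2^ℓ`. -/
def numInner (M₀ ℓ : ℕ) : ℕ := M₀ * 2 ^ ℓ

/-- The discretization parameter `h_ℓ = h₀ 2^{-ℓ}`. -/
def meshSize (h₀ : ℝ) (ℓ : ℕ) : ℝ := h₀ / 2 ^ ℓ

/-- The inner deterministic QMC average at level `k`,
`(1 / M_k) ∑_{m ≤ M_k} g_{h_k}(y, x^{(m)})`, with the Sobol' points `x^{(m)}`. -/
def innerQMC {d₁ d₂ : ℕ} (gh : ℝ → (Fin d₁ → ℝ) → (Fin d₂ → ℝ) → ℝ) (T : SobolData d₂)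
    (M₀ : ℕ) (h₀ : ℝ) (k : ℕ) (y : Fin d₁ → ℝ) : ℝ :=
  (1 / (numInner M₀ k : ℝ)) *
    ∑ m ∈ Finset.range (numInner M₀ k), gh (meshSize h₀ k) y (T.point m)

/-- The first-order Taylor term `f'(ḡ) (q - ḡ)`. -/
def phiI {d : ℕ} (f : ℝ → ℝ) (gbar q : (Fin d → ℝ) → ℝ) (y : Fin d → ℝ) : ℝ :=
  deriv f (gbar y) * (q y - gbar y)

/-- The second-order Taylor remainder `(q - ḡ)² ∫₀¹ f''(ḡ + s (q - ḡ)) (1 - s) ds`. -/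
def phiII {d : ℕ} (f : ℝ → ℝ) (gbar q : (Fin d → ℝ) → ℝ) (y : Fin d → ℝ) : ℝ :=
  (q y - gbar y) ^ 2 *
    ∫ s in (0 : ℝ)..1, deriv (deriv f) (gbar y + s * (q y - gbar y)) * (1 - s)

/-- The outer average `(1/N) ∑_{n ≤ N} f(q(y^{(n)}))` over the scrambled Sobol' points
`y^{(n)}`, where `π` is one realization of the scrambling. -/
def outerRQMC {d : ℕ} (f : ℝ → ℝ) (q : (Fin d → ℝ) → ℝ) (U : SobolData d) (N : ℕ)
    (π : Fin d → List (ZMod 2) → Bool) : ℝ :=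
  (1 / (N : ℝ)) * ∑ n ∈ Finset.range N, f (q (scramble π (U.digit n)))

/-- The level difference `I_ℓ^ℓ - I_ℓ^{ℓ-1}` of the multilevel estimator (one randomization);
both terms use the same scrambled outer points. -/
def levelDifference {d₁ d₂ : ℕ} (f : ℝ → ℝ) (gh : ℝ → (Fin d₁ → ℝ) → (Fin d₂ → ℝ) → ℝ)
    (U : SobolData d₁) (T : SobolData d₂) (M₀ : ℕ) (h₀ : ℝ) (N ℓ : ℕ)
    (π : Fin d₁ → List (ZMod 2) → Bool) : ℝ :=
  outerRQMC f (innerQMC gh T M₀ h₀ ℓ) U N π - outerRQMC f (innerQMC gh T M₀ h₀ (ℓ - 1)) U N π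

end NestedQMC

end

open NestedQMC

/-! Taylor's formula with integral remainder gives `f (q_k) = f (ḡ) + φ_k^(I) + φ_k^(II)`. In the
difference of two levels `f (ḡ)` cancels, and what remains is a sum of two functions with boundary
growth, since growth constants add. Halving `M` and doubling `h` at the coarser level costs only the
factors `κ`. Everything thus reduces to one estimate: for `φ` with constants `(b, A)`, the scrambled
Sobol' average has root mean square error of order `b N^(-1+ε+A_max)` (`exists_eLpNorm_error_le`).

This estimate is an `L²` argument on Haar levels. Truncate to `K` digits, sample `φ` at midpoints of
dyadic boxes, expand into Haar components of level `k = (k_1, …, k_d)`, and cut the first `N`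
indices into aligned blocks of distinct sizes `2 ^ m`. Two properties of a block matter, with `t`
the quality parameter and `|k| = ∑ k_j`.

If `|k| + t ≤ m`, the component sums to zero over the block (`sum_block_haarComp_eq_zero`). The
cause is algebraic: the digit rows obey recurrences with pairwise coprime characteristic
polynomials, hence are linearly independent, and a translation of the indices can flip a single
digit.

If `|k| + t > m`, scrambling decorrelates any two points that do not share the first `k_j - 1`
digits of every coordinate `j`, and at most `2 ^ (t + d)` points of the block share these. Hence the
second moment is at most `2 ^ m * 2 ^ (t + d)` times the mean square of the component
(`integral_sq_sum_block_le`). A component is odd under flips of its last digits, so it is an average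
of mixed differences. Boundary growth with `A_j < 1/2` then makes its mean square of order `b² ∏
2^(-(1 - 2 A_j) k_j)` (`BoundaryGrowth.mean_sq_haarComp_le`).

The triangle inequality over blocks and levels gives a bound uniform in `K`, which passes to the
limit by Fatou's lemma. The discrepancy bound uses the same blocks and levels for indicators of
boxes, but holds for every realization of the scrambling. -/

open NestedQMC

namespace NestedQMC

section

/-! ### Sobol' sequences are digital sequences of finite quality parameter -/

/-- The shift operator on sequences of binary digits. -/
def digitShift : Module.End (ZMod 2) (ℕ → ZMod 2) :=
  LinearMap.funLeft (ZMod 2) (ZMod 2) Nat.succ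

theorem digitShift_pow_apply (i : ℕ) (c : ℕ → ZMod 2) (r : ℕ) :
    (digitShift ^ i) c r = c (r + i) := by
  induction i generalizing r with
  | zero => simp
  | succ i ih =>
    rw [pow_succ', Module.End.mul_apply]
    change (digitShift ^ i) c (r + 1) = _
    rw [ih]; congr 1; omega

theorem aeval_digitShift_apply (p : (ZMod 2)[X]) (c : ℕ → ZMod 2) (r : ℕ) :
    aeval digitShift p c r = ∑ i ∈ Finset.range (p.natDegree + 1), p.coeff i * c (r + i) := by
  rw [aeval_eq_sum_range]
  simp [LinearMap.sum_apply, digitShift_pow_apply]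

/-- A sequence annihilated by a monic recurrence and starting with sufficiently many zeros
vanishes. -/
theorem eq_zero_of_monic_recurrence {p : (ZMod 2)[X]} (hp : p.Monic) {c : ℕ → ZMod 2}
    (h : aeval digitShift p c = 0) (h0 : ∀ r < p.natDegree, c r = 0) : c = 0 := by
  funext r
  induction r using Nat.strong_induction_on with
  | _ r ih =>
    by_cases hr : r < p.natDegree
    · exact h0 r hr
    · have h1 := congrFun h (r - p.natDegree)
      rw [aeval_digitShift_apply, Finset.sum_range_succ, Finset.sum_eq_zero] at h1
      · rw [hp.coeff_natDegree, Nat.sub_add_cancel (not_lt.1 hr)] at h1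
        simpa using h1
      · intro i hi
        rw [Finset.mem_range] at hi
        rw [ih _ (by omega)]
        simp

theorem monic_of_ne_zero_zmod_two {p : (ZMod 2)[X]} (hp : p ≠ 0) : p.Monic := by
  have h : p.leadingCoeff ≠ 0 := by simpa using hp
  have : ∀ x : ZMod 2, x ≠ 0 → x = 1 := by decide
  exact this _ h

/-- The root of `X` is zero, so it cannot have order `2 ^ 1 - 1 = 1`. This leaves `X` free as the
characteristic polynomial of the van der Corput coordinate, distinct from all the others. -/
theorem IsPrimitivePoly.ne_X {p : (ZMod 2)[X]} (hp : IsPrimitivePoly p) : p ≠ X := by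
  rintro rfl
  have h := hp.2
  have : Fact (Irreducible (X : (ZMod 2)[X])) := ⟨hp.1⟩
  have h0 : AdjoinRoot.root (X : (ZMod 2)[X]) = 0 := by
    rw [← AdjoinRoot.mk_X, AdjoinRoot.mk_self]
  rw [h0, natDegree_X] at h
  have h1 : (0 : AdjoinRoot (X : (ZMod 2)[X])) ^ (2 ^ 1 - 1) = 1 := by
    rw [← h]; exact pow_orderOf_eq_one _
  norm_num at h1

variable {d : ℕ}

/-- The characteristic polynomial of the recurrence of coordinate `j`. -/
noncomputable def SobolData.charPoly (T : SobolData d) (j : Fin d) : (ZMod 2)[X] :=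
  if j.val = 0 then X else T.poly j

theorem SobolData.charPoly_irreducible (T : SobolData d) (j : Fin d) :
    Irreducible (T.charPoly j) := by
  unfold charPoly
  split_ifs with h
  · exact irreducible_X
  · exact (T.poly_primitive j h).1

theorem SobolData.charPoly_monic (T : SobolData d) (j : Fin d) : (T.charPoly j).Monic :=
  monic_of_ne_zero_zmod_two (T.charPoly_irreducible j).ne_zero

theorem SobolData.charPoly_injective (T : SobolData d) : Function.Injective T.charPoly := by
  intro i j h
  unfold charPoly at h
  split_ifs at h with hi hj hj
  · exact Fin.ext (hi.trans hj.symm)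
  · exact absurd h.symm (T.poly_primitive j hj).ne_X
  · exact absurd h (T.poly_primitive i hi).ne_X
  · exact T.poly_distinct i j hi hj h

theorem SobolData.charPoly_isCoprime (T : SobolData d) {i j : Fin d} (h : i ≠ j) :
    IsCoprime (T.charPoly i) (T.charPoly j) := by
  rw [(T.charPoly_irreducible i).coprime_iff_not_dvd]
  intro hd
  exact h (T.charPoly_injective (eq_of_monic_of_associated (T.charPoly_monic i)
    (T.charPoly_monic j) ((T.charPoly_irreducible i).associated_of_dvd
      (T.charPoly_irreducible j) hd)))

theorem SobolData.charPoly_natDegree_pos (T : SobolData d) (j : Fin d) :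
    0 < (T.charPoly j).natDegree :=
  (T.charPoly_irreducible j).natDegree_pos

/-- The sequence (over `r`) of the `k`-th digits of the direction numbers of coordinate `j`. -/
def SobolData.row (T : SobolData d) (j : Fin d) (k : ℕ) : ℕ → ZMod 2 := fun r => T.dir j r k

/-- This is the direction number recurrence read along the rows of the generator matrix. In
characteristic two the sum in the recurrence cancels, and only the term `v_(r-s) / 2 ^ s` survives,
which is the row lying `s` digits higher. For the identity matrix of the first coordinate the
polynomial `X` has the same effect. -/
theorem SobolData.aeval_charPoly_row (T : SobolData d) (j : Fin d) (k : ℕ) :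
    aeval digitShift (T.charPoly j) (T.row j k) =
      if (T.charPoly j).natDegree ≤ k then T.row j (k - (T.charPoly j).natDegree) else 0 := by
  unfold charPoly
  split_ifs with h0 hk hk
  · funext r
    rw [aeval_X]
    change T.dir j (r + 1) k = T.dir j r (k - (X : (ZMod 2)[X]).natDegree)
    rw [natDegree_X] at *
    by_cases h : r + 1 = k
    · subst h
      simp [T.dir_diag]
    · rw [T.dir_first j h0 _ _ h, T.dir_first j h0 _ _ (by omega)]
  · rw [natDegree_X] at hk
    funext r
    rw [aeval_X]
    change T.dir j (r + 1) k = 0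
    exact T.dir_first j h0 _ _ (by omega)
  all_goals
    funext r
    set s := (T.poly j).natDegree with hs
    have hrec := T.dir_rec j h0 (r + s) k (by omega)
    have hm : (T.poly j).Monic := monic_of_ne_zero_zmod_two (T.poly_primitive j h0).1.ne_zero
    rw [aeval_digitShift_apply, Finset.sum_range_succ, ← hs, hs, hm.coeff_natDegree, ← hs,
      one_mul]
    have hsum : ∑ i ∈ Finset.Icc 1 s, (T.poly j).coeff (s - i) * T.dir j (r + s - i) k
        = ∑ i ∈ Finset.range s, (T.poly j).coeff i * T.row j k (r + i) := by
      refine Finset.sum_bij' (fun i _ => s - i) (fun i _ => s - i) ?_ ?_ ?_ ?_ ?_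
      · intro i hi; rw [Finset.mem_Icc] at hi; rw [Finset.mem_range]; omega
      · intro i hi; rw [Finset.mem_range] at hi; rw [Finset.mem_Icc]; omega
      · intro i hi; rw [Finset.mem_Icc] at hi; omega
      · intro i hi; rw [Finset.mem_range] at hi; omega
      · intro i hi
        rw [Finset.mem_Icc] at hi
        change _ = _ * T.dir j (r + (s - i)) k
        rw [← Nat.add_sub_assoc hi.2]
    rw [← hs, hsum] at hrec
    change _ + T.dir j (r + s) k = _
    rw [hrec, ← add_assoc, CharTwo.add_self_eq_zero, zero_add]
  · rw [if_pos hk, Nat.add_sub_cancel]; rfl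
  · rw [if_neg hk]; rfl

/-- Each factor lowers the row index by the degree of the polynomial, and once the index is below
the degree the next factor gives zero. -/
theorem SobolData.aeval_charPoly_pow_row (T : SobolData d) (j : Fin d) (e k : ℕ)
    (h : k < e * (T.charPoly j).natDegree) :
    aeval digitShift (T.charPoly j ^ e) (T.row j k) = 0 := by
  induction e generalizing k with
  | zero => simp at h
  | succ e ih =>
    rw [pow_succ, map_mul, Module.End.mul_apply, T.aeval_charPoly_row]
    split_ifs with hk
    · exact ih _ (by rw [add_mul, one_mul] at h; omega)
    · simp

/-- If sequences annihilated by pairwise coprime polynomials add up to zero, all vanish. -/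
theorem eq_zero_of_sum_eq_zero_of_isCoprime {ι M : Type*} [Fintype ι] [DecidableEq ι]
    [AddCommGroup M] [Module (ZMod 2) M] (E : Module.End (ZMod 2) M) (q : ι → (ZMod 2)[X])
    (hq : ∀ i j, i ≠ j → IsCoprime (q i) (q j)) (w : ι → M)
    (hw : ∀ i, aeval E (q i) (w i) = 0) (hsum : ∑ i, w i = 0) (j : ι) : w j = 0 := by
  have hkill : ∀ i ∈ Finset.univ.erase j,
      aeval E (∏ i ∈ Finset.univ.erase j, q i) (w i) = 0 := by
    intro i hi
    rw [← Finset.prod_erase_mul _ _ hi, map_mul, Module.End.mul_apply, hw, map_zero]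
  have h1 : aeval E (∏ i ∈ Finset.univ.erase j, q i) (w j) = 0 := by
    have h2 : aeval E (∏ i ∈ Finset.univ.erase j, q i) (∑ i, w i) = 0 := by
      rw [hsum, map_zero]
    rw [map_sum, ← Finset.add_sum_erase _ _ (Finset.mem_univ j), Finset.sum_eq_zero hkill,
      add_zero] at h2
    exact h2
  -- Bézout: `w j` is killed by `q j` and by the product of the other polynomials, hence by `1`.
  obtain ⟨a, b, hab⟩ : IsCoprime (q j) (∏ i ∈ Finset.univ.erase j, q i) :=
    IsCoprime.prod_right fun i hi => hq j i (Finset.ne_of_mem_erase hi).symm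
  have h3 : aeval E (a * q j + b * ∏ i ∈ Finset.univ.erase j, q i) (w j) = w j := by
    rw [hab, map_one]; rfl
  rw [← h3, map_add, map_mul, map_mul, LinearMap.add_apply, Module.End.mul_apply,
    Module.End.mul_apply, hw, h1, map_zero, map_zero, add_zero]

/-- The generator matrix is unitriangular: at position `i` the later rows vanish, and the earlier
coefficients are zero by induction. -/
theorem SobolData.row_independent (T : SobolData d) (j : Fin d) (k : ℕ) (l : ℕ → ZMod 2)
    (h : ∀ r, ∑ i ∈ Finset.range k, l i * T.dir j r i = 0) : ∀ i < k, l i = 0 := by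
  intro i
  induction i using Nat.strong_induction_on with
  | _ i ih =>
    intro hi
    have h1 := h i
    rw [Finset.sum_eq_single_of_mem i (Finset.mem_range.2 hi), T.dir_diag, mul_one] at h1
    · exact h1
    · intro b hb hbi
      rcases lt_or_gt_of_ne hbi with h2 | h2
      · rw [ih b h2 (Finset.mem_range.1 hb), zero_mul]
      · rw [T.dir_above j i b h2, mul_zero]

/-- A quality parameter of the Sobol' sequence. -/
noncomputable def SobolData.quality (T : SobolData d) : ℕ := ∑ j, (T.charPoly j).natDegree

/-- The leading digit rows of the generator matrices are linearly independent. -/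
theorem SobolData.rows_independent (T : SobolData d) (k : Fin d → ℕ) (m : ℕ)
    (hm : ∑ j, k j + T.quality ≤ m) (l : Fin d → ℕ → ZMod 2)
    (h : ∀ r < m, ∑ j, ∑ i ∈ Finset.range (k j), l j i * T.dir j r i = 0) :
    ∀ j, ∀ i < k j, l j i = 0 := by
  classical
  -- This exponent satisfies `k j < e j * deg ≤ k j + deg`. The lower bound annihilates the first `k
  -- j` rows; the upper bound keeps the total degree at most `∑ k j + quality ≤ m`.
  set e : Fin d → ℕ := fun j => k j / (T.charPoly j).natDegree + 1
  set q : Fin d → (ZMod 2)[X] := fun j => T.charPoly j ^ e j with hq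
  set w : Fin d → ℕ → ZMod 2 := fun j => ∑ i ∈ Finset.range (k j), l j i • T.row j i with hw
  have hwapply : ∀ j r, w j r = ∑ i ∈ Finset.range (k j), l j i * T.dir j r i := by
    intro j r
    simp [hw, Finset.sum_apply, SobolData.row]
  have hker : ∀ j, aeval digitShift (q j) (w j) = 0 := by
    intro j
    rw [hw, map_sum]
    refine Finset.sum_eq_zero fun i hi => ?_
    rw [map_smul, T.aeval_charPoly_pow_row, smul_zero]
    rw [Finset.mem_range] at hi
    exact hi.trans_le (by
      have := Nat.lt_div_mul_add (a := k j) (T.charPoly_natDegree_pos j)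
      simp only [e]; rw [add_mul, one_mul]; exact this.le)
  have hmonic : (∏ j, q j).Monic := monic_prod_of_monic _ _ fun j _ => (T.charPoly_monic j).pow _
  have hdeg : (∏ j, q j).natDegree ≤ m := by
    rw [natDegree_prod_of_monic _ _ fun j _ => (T.charPoly_monic j).pow _]
    refine le_trans ?_ hm
    rw [SobolData.quality, ← Finset.sum_add_distrib]
    refine Finset.sum_le_sum fun j _ => ?_
    rw [(T.charPoly_monic j).natDegree_pow]
    simp only [e]; rw [add_mul, one_mul]
    have := Nat.div_mul_le_self (k j) (T.charPoly j).natDegree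
    omega
  -- The sum obeys a monic recurrence of order at most `m` and starts with `m` zeros, so it vanishes
  -- identically. Coprimality then separates the coordinates.
  have hsum : ∑ j, w j = 0 := by
    refine eq_zero_of_monic_recurrence hmonic ?_ ?_
    · rw [map_sum]
      refine Finset.sum_eq_zero fun j hj => ?_
      rw [← Finset.prod_erase_mul _ _ hj, map_mul, Module.End.mul_apply, hker, map_zero]
    · intro r hr
      rw [Finset.sum_apply]
      simp_rw [hwapply]
      exact h r (by omega)
  intro j
  refine T.row_independent j (k j) (l j) fun r => ?_
  rw [← hwapply, eq_zero_of_sum_eq_zero_of_isCoprime digitShift q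
    (fun i j hij => (T.charPoly_isCoprime hij).pow) w hker hsum j]
  rfl

/-- Duality: a nonzero functional vanishing on the range of the digit map would be a linear relation
between the leading rows, so their independence makes the map surjective. -/
theorem SobolData.exists_bits (T : SobolData d) (k : Fin d → ℕ) (m : ℕ)
    (hm : ∑ j, k j + T.quality ≤ m) (b : Fin d → ℕ → ZMod 2) :
    ∃ x : Fin m → ZMod 2, ∀ j, ∀ i < k j, ∑ r : Fin m, x r * T.dir j r i = b j i := by
  classical
  let L : (Fin m → ZMod 2) →ₗ[ZMod 2] ((Σ j, Fin (k j)) → ZMod 2) :=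
    { toFun := fun x p => ∑ r : Fin m, x r * T.dir p.1 r p.2
      map_add' := by intro x y; funext p; simp [add_mul, Finset.sum_add_distrib]
      map_smul' := by intro c x; funext p; simp [mul_assoc, Finset.mul_sum] }
  have hL : Function.Surjective L := by
    rw [← LinearMap.range_eq_top]
    by_contra hne
    obtain ⟨f, hf0, hf⟩ := Submodule.exists_le_ker_of_lt_top _ (lt_top_iff_ne_top.2 hne)
    apply hf0
    set l : Fin d → ℕ → ZMod 2 := fun j i =>
      if h : i < k j then f (Pi.single ⟨j, ⟨i, h⟩⟩ 1) else 0 with hl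
    have hfx : ∀ x, f x = ∑ j, ∑ i : Fin (k j), l j i * x ⟨j, i⟩ := by
      intro x
      rw [← Fintype.sum_sigma' (f := fun j (i : Fin (k j)) => l j i * x ⟨j, i⟩)]
      conv_lhs => rw [← Finset.univ_sum_single x]
      rw [map_sum]
      refine Finset.sum_congr rfl fun p _ => ?_
      have : (Pi.single p (x p) : (Σ j, Fin (k j)) → ZMod 2) = x p • Pi.single p 1 := by
        rw [← Pi.single_smul]; simp
      rw [this, map_smul, smul_eq_mul, mul_comm]
      simp [hl]
    have hl0 := T.rows_independent k m hm l fun r hr => by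
      have h1 : f (L (Pi.single ⟨r, hr⟩ 1)) = 0 := hf ⟨_, rfl⟩
      rw [hfx] at h1
      simp_rw [Finset.sum_range]
      rw [← h1]
      refine Finset.sum_congr rfl fun j _ => Finset.sum_congr rfl fun i _ => ?_
      congr 1
      change _ = ∑ r' : Fin m, _
      rw [Finset.sum_eq_single_of_mem ⟨r, hr⟩ (Finset.mem_univ _)]
      · simp
      · intro r' _ hr'
        simp [Pi.single_eq_of_ne hr']
    ext p
    simp only [LinearMap.comp_apply, LinearMap.zero_apply]
    rw [hfx]
    exact Finset.sum_eq_zero fun j _ => Finset.sum_eq_zero fun i _ => by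
      rw [hl0 j i i.2, zero_mul]
  obtain ⟨x, hx⟩ := hL fun p => b p.1 p.2
  exact ⟨x, fun j i hi => congrFun hx ⟨j, ⟨i, hi⟩⟩⟩

theorem SobolData.digit_eq_sum (T : SobolData d) (n : ℕ) (j : Fin d) (k R : ℕ) (hR : n < 2 ^ R) :
    T.digit n j k = ∑ r ∈ Finset.range R, if n.testBit r then T.dir j r k else 0 := by
  unfold SobolData.digit
  refine Finset.sum_subset (Finset.range_mono (Nat.size_le.2 hR)) fun r _ hr => ?_
  rw [Finset.mem_range, not_lt] at hr
  rw [if_neg]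
  rw [Nat.testBit_lt_two_pow (lt_of_lt_of_le (Nat.lt_size_self n)
    (Nat.pow_le_pow_right (by norm_num) hr))]
  simp

/-- Digits are linear over the two-element field in the bits of the index, and exclusive or is the
addition of bits. -/
theorem SobolData.digit_xor (T : SobolData d) (n n' : ℕ) (j : Fin d) (k : ℕ) :
    T.digit (n ^^^ n') j k = T.digit n j k + T.digit n' j k := by
  obtain ⟨R, h1, h2⟩ : ∃ R, n < 2 ^ R ∧ n' < 2 ^ R :=
    ⟨max n n', (le_max_left _ _).trans_lt Nat.lt_two_pow_self,
      (le_max_right _ _).trans_lt Nat.lt_two_pow_self⟩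
  rw [T.digit_eq_sum _ j k R h1, T.digit_eq_sum _ j k R h2,
    T.digit_eq_sum _ j k R (Nat.xor_lt_two_pow h1 h2), ← Finset.sum_add_distrib]
  refine Finset.sum_congr rfl fun r _ => ?_
  rw [Nat.testBit_xor]
  cases n.testBit r <;> cases n'.testBit r <;> simp [CharTwo.add_self_eq_zero]

/-- Every choice of leading digits is attained by a point of index below `2 ^ m`. -/
theorem SobolData.exists_digit_eq (T : SobolData d) (k : Fin d → ℕ) (m : ℕ)
    (hm : ∑ j, k j + T.quality ≤ m) (b : Fin d → ℕ → ZMod 2) :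
    ∃ δ < 2 ^ m, ∀ j, ∀ i < k j, T.digit δ j i = b j i := by
  obtain ⟨x, hx⟩ := T.exists_bits k m hm b
  refine ⟨Nat.ofBits fun r => decide (x r = 1), Nat.ofBits_lt_two_pow _, fun j i hi => ?_⟩
  rw [T.digit_eq_sum _ j i m (Nat.ofBits_lt_two_pow _), ← hx j i hi, Finset.sum_range]
  refine Finset.sum_congr rfl fun r _ => ?_
  rw [Nat.testBit_ofBits_lt _ _ r.2]
  have : ∀ y : ZMod 2, y = 0 ∨ y = 1 := by decide
  rcases this (x r) with h | h <;> simp [h]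

/-- Only the lowest `m` bits are affected by `δ < 2 ^ m`. Hence exclusive or with `δ` permutes every
aligned block of `2 ^ m` indices. -/
theorem two_pow_mul_add_xor (m a i δ : ℕ) (hi : i < 2 ^ m) (hδ : δ < 2 ^ m) :
    2 ^ m * a + (i ^^^ δ) = (2 ^ m * a + i) ^^^ δ := by
  refine Nat.eq_of_testBit_eq fun r => ?_
  rw [Nat.testBit_xor, Nat.testBit_two_pow_mul_add a (Nat.xor_lt_two_pow hi hδ),
    Nat.testBit_two_pow_mul_add a hi]
  split_ifs with h
  · rw [Nat.testBit_xor]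
  · rw [Nat.testBit_lt_two_pow (hδ.trans_le (Nat.pow_le_pow_right (by norm_num) (not_lt.1 h)))]
    simp

/-- A dyadic block of `2 ^ m` points has at most `2 ^ (m - ∑ k)` points with prescribed
leading digits. -/
theorem SobolData.card_block_le (T : SobolData d) (k : Fin d → ℕ) (m a : ℕ)
    (hm : ∑ j, k j + T.quality ≤ m) (v : Fin d → ℕ → ZMod 2) :
    ((Finset.range (2 ^ m)).filter fun i =>
      ∀ j, ∀ l < k j, T.digit (2 ^ m * a + i) j l = v j l).card * 2 ^ (∑ j, k j) ≤ 2 ^ m := by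
  classical
  let ext : (∀ j, Fin (k j) → ZMod 2) → Fin d → ℕ → ZMod 2 :=
    fun b j i => if h : i < k j then b j ⟨i, h⟩ else 0
  choose δ hδ hδ' using fun b : ∀ j, Fin (k j) → ZMod 2 => T.exists_digit_eq k m hm (ext b)
  have hcard : (Finset.univ : Finset (∀ j, Fin (k j) → ZMod 2)).card = 2 ^ (∑ j, k j) := by
    rw [Finset.card_univ, Fintype.card_pi, ← Finset.prod_pow_eq_pow_sum]
    simp
  rw [← hcard, ← Finset.card_product]
  conv_rhs => rw [← Finset.card_range (2 ^ m)]
  -- For each digit pattern `b` the matching indices are translated by `δ b`. The leading digits of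
  -- the image are `v + b`, so they recover `b` and then `i`: the `2 ^ ∑ k` translates are disjoint
  -- within the block.
  refine Finset.card_le_card_of_injOn (fun p => p.1 ^^^ δ p.2) ?_ ?_
  · rintro ⟨i, b⟩ hib
    simp only [Finset.coe_product, Set.mem_prod, Finset.mem_coe, Finset.mem_filter,
      Finset.mem_range] at hib ⊢
    exact Nat.xor_lt_two_pow hib.1.1 (hδ b)
  · rintro ⟨i, b⟩ hib ⟨i', b'⟩ hib' heq
    simp only [Finset.coe_product, Set.mem_prod, Finset.mem_coe, Finset.mem_filter,
      Finset.mem_range] at hib hib' heq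
    have hdig : ∀ j, ∀ l < k j, ext b j l = ext b' j l := by
      intro j l hl
      have h1 := T.digit_xor (2 ^ m * a + i) (δ b) j l
      have h2 := T.digit_xor (2 ^ m * a + i') (δ b') j l
      rw [← two_pow_mul_add_xor m a _ _ hib.1.1 (hδ b), hib.1.2 j l hl, hδ' b j l hl] at h1
      rw [← two_pow_mul_add_xor m a _ _ hib'.1.1 (hδ b'), hib'.1.2 j l hl, hδ' b' j l hl] at h2
      rw [heq, h2] at h1
      exact (add_left_cancel h1).symm
    have hb : b = b' := by
      funext j l
      simpa [ext] using hdig j l l.2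
    subst hb
    have : i = i' := by
      have := congrArg (· ^^^ δ b) heq
      simpa [Nat.xor_assoc] using this
    rw [this]

end

/-! ### Points of a block sharing digits at high levels -/

section

/-- The leading digits of a point can be shortened to any smaller total number. -/
theorem exists_le_sum_eq {ι : Type*} [Fintype ι] [DecidableEq ι] (k : ι → ℕ) (s : ℕ)
    (hs : s ≤ ∑ j, k j) : ∃ k' : ι → ℕ, (∀ j, k' j ≤ k j) ∧ ∑ j, k' j = s := by
  induction hs using Nat.decreasingInduction with
  | self => exact ⟨k, fun _ => le_rfl, rfl⟩
  | of_succ s _ ih =>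
    obtain ⟨k', hk', hsum⟩ := ih
    obtain ⟨j, -, hj⟩ : ∃ j ∈ Finset.univ, k' j ≠ 0 := Finset.exists_ne_zero_of_sum_ne_zero
      (by rw [hsum]; omega)
    refine ⟨Function.update k' j (k' j - 1), fun i => ?_, ?_⟩
    · by_cases h : i = j
      · subst h; simpa using (Nat.sub_le _ _).trans (hk' i)
      · simpa [h] using hk' i
    · rw [Finset.sum_update_of_mem (Finset.mem_univ j)]
      have := Finset.add_sum_erase Finset.univ k' (Finset.mem_univ j)
      rw [Finset.erase_eq] at this
      omega

variable {d : ℕ}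

/-- In a dyadic block of `2 ^ m` points, few points share the digits before the last ones of
a multi-index of high level. -/
theorem SobolData.card_block_le_of_lt (T : SobolData d) (k : Fin d → ℕ) (m a : ℕ)
    (hm : m < ∑ j, k j + T.quality) (v : Fin d → ℕ → ZMod 2) :
    ((Finset.range (2 ^ m)).filter fun i =>
      ∀ j, ∀ l < k j - 1, T.digit (2 ^ m * a + i) j l = v j l).card ≤ 2 ^ (T.quality + d) := by
  by_cases hmt : m < T.quality
  · calc _ ≤ (Finset.range (2 ^ m)).card := Finset.card_filter_le _ _
      _ = 2 ^ m := Finset.card_range _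
      _ ≤ _ := Nat.pow_le_pow_right (by norm_num) (by omega)
  -- The prefix lengths `k j - 1` are shortened until the exact counting bound applies. Since `∑ k j
  -- ≤ ∑ (k j - 1) + d` and `∑ k j > m - quality`, at most a factor `2 ^ (quality + d)` remains.
  · obtain ⟨k', hk', hsum⟩ := exists_le_sum_eq (fun j => k j - 1)
      (min (∑ j, (k j - 1)) (m - T.quality)) (min_le_left _ _)
    have hle : ∑ j, k j ≤ ∑ j, (k j - 1) + d := by
      calc ∑ j, k j ≤ ∑ j, ((k j - 1) + 1) := Finset.sum_le_sum fun j _ => by omega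
        _ = _ := by simp [Finset.sum_add_distrib]
    have h1 := T.card_block_le k' m a (by omega) v
    have h2 : 2 ^ m ≤ 2 ^ (T.quality + d) * 2 ^ (∑ j, k' j) := by
      rw [← pow_add]; exact Nat.pow_le_pow_right (by norm_num) (by omega)
    refine (Finset.card_le_card ?_).trans (Nat.le_of_mul_le_mul_right (h1.trans h2) (by positivity))
    exact Finset.monotone_filter_right _ fun i _ h j l hl => h j l (hl.trans_le (hk' j))

/-! ### The Haar decomposition on finite binary digit strings -/

/-- The digit string of length `K` with a single one, at the place `l`. -/
def unitDigit (K l : ℕ) : Fin K → ZMod 2 := fun i => if i.val = l then 1 else 0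

/-- The kernel of the averaging operator over all strings with the same first `k` digits. -/
noncomputable def prefixKernel (K k : ℕ) (g : Fin K → ZMod 2) : ℝ :=
  if ∀ i : Fin K, i.val < k → g i = 0 then 2 ^ k / 2 ^ K else 0

/-- The kernel of the projection on the Haar functions of level `k`. -/
noncomputable def haarKernel (K : ℕ) : ℕ → (Fin K → ZMod 2) → ℝ
  | 0, g => prefixKernel K 0 g
  | k + 1, g => prefixKernel K (k + 1) g - prefixKernel K k g

theorem prefixKernel_nonneg (K k : ℕ) (g : Fin K → ZMod 2) : 0 ≤ prefixKernel K k g := by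
  unfold prefixKernel; split_ifs <;> positivity

/-- The levels telescope to averaging over the strings with the same `K` digits, which is the
identity. -/
theorem sum_haarKernel (K : ℕ) (g : Fin K → ZMod 2) :
    ∑ k ∈ Finset.range (K + 1), haarKernel K k g = if g = 0 then 1 else 0 := by
  rw [Finset.sum_range_succ']
  simp only [haarKernel]
  rw [Finset.sum_range_sub (fun k => prefixKernel K k g), sub_add_cancel]
  unfold prefixKernel
  have : (∀ i : Fin K, i.val < K → g i = 0) ↔ g = 0 := by
    simp [funext_iff]
  rw [if_congr this rfl rfl, div_self (by positivity)]

theorem prefixKernel_add (K k : ℕ) (g s : Fin K → ZMod 2) (h : ∀ i : Fin K, i.val < k → s i = 0) :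
    prefixKernel K k (g + s) = prefixKernel K k g := by
  unfold prefixKernel
  refine if_congr (forall_congr' fun i => imp_congr_right fun hi => ?_) rfl rfl
  rw [Pi.add_apply, h i hi, add_zero]

theorem haarKernel_add (K k : ℕ) (g s : Fin K → ZMod 2) (h : ∀ i : Fin K, i.val < k → s i = 0) :
    haarKernel K k (g + s) = haarKernel K k g := by
  cases k with
  | zero => exact prefixKernel_add K 0 g s h
  | succ k =>
    simp only [haarKernel]
    rw [prefixKernel_add K _ g s h, prefixKernel_add K k g s fun i hi => h i (by omega)]

theorem prefixKernel_succ (K k : ℕ) (hk : k < K) (g : Fin K → ZMod 2) :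
    prefixKernel K (k + 1) g = if g ⟨k, hk⟩ = 0 then 2 * prefixKernel K k g else 0 := by
  unfold prefixKernel
  have : (∀ i : Fin K, i.val < k + 1 → g i = 0) ↔
      (g ⟨k, hk⟩ = 0 ∧ ∀ i : Fin K, i.val < k → g i = 0) := by
    constructor
    · exact fun h => ⟨h _ (Nat.lt_succ_self k), fun i hi => h i (by omega)⟩
    · rintro ⟨h1, h2⟩ i hi
      rcases Nat.lt_succ_iff_lt_or_eq.1 hi with h | h
      · exact h2 i h
      · have : i = ⟨k, hk⟩ := Fin.ext h
        rw [this]; exact h1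
  simp only [this]
  by_cases h1 : g ⟨k, hk⟩ = 0 <;> by_cases h2 : ∀ i : Fin K, i.val < k → g i = 0
  · rw [if_pos ⟨h1, h2⟩, if_pos h1, if_pos h2]; ring
  · rw [if_neg fun h => h2 h.2, if_pos h1, if_neg h2]; ring
  · rw [if_neg fun h => h1 h.1, if_neg h1]
  · rw [if_neg fun h => h1 h.1, if_neg h1]

/-- Refining a prefix by one digit either doubles the averaging kernel or kills it. The level `k +
1` kernel is therefore plus or minus the kernel of the prefix of length `k`, with the sign given by
the digit number `k`. -/
theorem haarKernel_add_unitDigit (K k : ℕ) (hk : k < K) (g : Fin K → ZMod 2) :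
    haarKernel K (k + 1) (g + unitDigit K k) = -haarKernel K (k + 1) g := by
  simp only [haarKernel]
  rw [prefixKernel_succ K k hk, prefixKernel_succ K k hk, prefixKernel_add K k g (unitDigit K k)
    fun i hi => if_neg hi.ne]
  have : ∀ y : ZMod 2, (y = 0 ∧ y + 1 ≠ 0) ∨ (y ≠ 0 ∧ y + 1 = 0) := by decide
  have h1 : (g + unitDigit K k) ⟨k, hk⟩ = g ⟨k, hk⟩ + 1 := by simp [unitDigit]
  rw [h1]
  rcases this (g ⟨k, hk⟩) with h | h
  · rw [if_pos h.1, if_neg h.2]; ring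
  · rw [if_neg h.1, if_pos h.2]; ring

/-- Up to sign, a Haar kernel is the averaging kernel one level below, a probability weight. The
truncated `k - 1` covers `k = 0`, where the kernel is already an average. -/
theorem abs_haarKernel (K k : ℕ) (hk : k ≤ K) (g : Fin K → ZMod 2) :
    |haarKernel K k g| = prefixKernel K (k - 1) g := by
  cases k with
  | zero => exact abs_of_nonneg (prefixKernel_nonneg _ _ _)
  | succ k =>
    simp only [haarKernel, Nat.add_sub_cancel]
    rw [prefixKernel_succ K k (by omega)]
    have := prefixKernel_nonneg K k g
    split_ifs
    · rw [two_mul, add_sub_cancel_right, abs_of_nonneg this]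
    · rw [zero_sub, abs_neg, abs_of_nonneg this]

theorem sum_haarKernel_succ_eq_zero (K k : ℕ) (hk : k < K) :
    ∑ g, haarKernel K (k + 1) g = 0 := by
  have h := Equiv.sum_comp (Equiv.addRight (unitDigit K k)) (haarKernel K (k + 1))
  simp only [Equiv.coe_addRight, haarKernel_add_unitDigit K k hk, Finset.sum_neg_distrib] at h
  linarith

theorem sum_prefixKernel (K k : ℕ) (hk : k ≤ K) : ∑ g, prefixKernel K k g = 1 := by
  induction k with
  | zero => simp [prefixKernel]
  | succ k ih =>
    have h := sum_haarKernel_succ_eq_zero K k hk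
    simp only [haarKernel, Finset.sum_sub_distrib] at h
    rw [ih (by omega)] at h
    linarith

theorem sum_abs_haarKernel (K k : ℕ) (hk : k ≤ K) : ∑ g, |haarKernel K k g| = 1 := by
  simp_rw [abs_haarKernel K k hk]
  exact sum_prefixKernel K (k - 1) (by omega)

/-- The Haar component of level `k` of a function of `d` strings of `K` digits. -/
noncomputable def haarComp {K : ℕ} (F : (Fin d → Fin K → ZMod 2) → ℝ) (k : Fin d → ℕ)
    (c : Fin d → Fin K → ZMod 2) : ℝ :=
  ∑ g : Fin d → Fin K → ZMod 2, (∏ j, haarKernel K (k j) (g j)) * F (c + g)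

variable {K : ℕ} (F : (Fin d → Fin K → ZMod 2) → ℝ)

theorem sum_haarComp (c : Fin d → Fin K → ZMod 2) :
    ∑ k ∈ Fintype.piFinset (fun _ : Fin d => Finset.range (K + 1)), haarComp F k c = F c := by
  unfold haarComp
  rw [Finset.sum_comm]
  have h : ∀ g : Fin d → Fin K → ZMod 2,
      ∑ k ∈ Fintype.piFinset (fun _ : Fin d => Finset.range (K + 1)),
        (∏ j, haarKernel K (k j) (g j)) * F (c + g) =
      (∏ j, if g j = 0 then (1 : ℝ) else 0) * F (c + g) := fun g => by
    rw [← Finset.sum_mul, ← Finset.prod_univ_sum (fun _ => Finset.range (K + 1))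
      (fun j k => haarKernel K k (g j))]
    simp_rw [sum_haarKernel]
  simp_rw [h]
  rw [Finset.sum_eq_single_of_mem 0 (Finset.mem_univ _)]
  · simp
  · intro g _ hg
    obtain ⟨j, hj⟩ := Function.ne_iff.1 hg
    rw [Finset.prod_eq_zero (Finset.mem_univ j), zero_mul]
    exact if_neg hj

/-- The substitution `g ↦ g + s` moves a translation from the argument to the kernel. The case `χ =
1` gives the dependence on leading digits only, and `χ = -1` the sign change under flips. -/
theorem haarComp_add (k : Fin d → ℕ) (s : Fin d → Fin K → ZMod 2) (χ : ℝ)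
    (h : ∀ g : Fin d → Fin K → ZMod 2,
      ∏ j, haarKernel K (k j) (g j) = χ * ∏ j, haarKernel K (k j) (g j + s j))
    (c : Fin d → Fin K → ZMod 2) : haarComp F k (c + s) = χ * haarComp F k c := by
  unfold haarComp
  rw [← Equiv.sum_comp (Equiv.addRight s) (fun g => (∏ j, haarKernel K (k j) (g j)) * F (c + g)),
    Finset.mul_sum]
  refine Finset.sum_congr rfl fun g _ => ?_
  rw [h g, mul_assoc]
  simp [add_assoc, add_comm g s]

/-- A Haar component of level `k` depends on the first `k j` digits of each coordinate `j`. -/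
theorem haarComp_congr (k : Fin d → ℕ) (c c' : Fin d → Fin K → ZMod 2)
    (h : ∀ j (i : Fin K), i.val < k j → c j i = c' j i) : haarComp F k c' = haarComp F k c := by
  have h1 := haarComp_add F k (c' - c) 1 (fun g => by
    rw [one_mul]
    refine Finset.prod_congr rfl fun j _ => (haarKernel_add K (k j) _ _ fun i hi => ?_).symm
    simp [h j i hi]) c
  simpa using h1

/-- A Haar component of level `k` changes its sign if the last relevant digit is flipped. -/
theorem haarComp_flip (k : Fin d → ℕ) (j : Fin d) (l : ℕ) (hl : k j = l + 1) (hK : l < K)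
    (c : Fin d → Fin K → ZMod 2) :
    haarComp F k (c + Pi.single j (unitDigit K l)) = -haarComp F k c := by
  rw [haarComp_add F k _ (-1), neg_one_mul]
  intro g
  rw [← Finset.mul_prod_erase _ _ (Finset.mem_univ j),
    ← Finset.mul_prod_erase _ (fun i => haarKernel K (k i) (g i + _)) (Finset.mem_univ j),
    Pi.single_eq_same, hl, haarKernel_add_unitDigit K l hK]
  rw [Finset.prod_congr rfl (g := fun i => haarKernel K (k i) (g i + (Pi.single j (unitDigit K l) : Fin d → Fin K → ZMod 2) i))]
  · ring
  · intro i hi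
    rw [Pi.single_eq_of_ne (Finset.ne_of_mem_erase hi), add_zero]

theorem haarComp_zero (c : Fin d → Fin K → ZMod 2) :
    haarComp F 0 c = (∑ g, F g) / (2 ^ K) ^ d := by
  unfold haarComp
  rw [← Equiv.sum_comp (Equiv.addLeft c) F, Finset.sum_div]
  refine Finset.sum_congr rfl fun g _ => ?_
  simp [haarKernel, prefixKernel, div_eq_inv_mul]

end

section

variable {d K : ℕ}

/-! ### Haar components and mixed differences -/

/-- The flips of the last relevant digits at level `k` in the coordinates of `v`. -/
def lastFlips (K : ℕ) (k : Fin d → ℕ) (v : Finset (Fin d)) : Fin d → Fin K → ZMod 2 :=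
  fun j => if j ∈ v then unitDigit K (k j - 1) else 0

theorem haarComp_lastFlips (F : (Fin d → Fin K → ZMod 2) → ℝ) (k : Fin d → ℕ)
    (hk : ∀ j, k j ≤ K) (v : Finset (Fin d)) (hv : ∀ j ∈ v, k j ≠ 0)
    (c : Fin d → Fin K → ZMod 2) :
    haarComp F k (c + lastFlips K k v) = (-1) ^ v.card * haarComp F k c := by
  induction v using Finset.induction_on generalizing c with
  | empty =>
    have : lastFlips K k ∅ = 0 := by funext j; simp [lastFlips]
    simp [this]
  | insert j v hj ih =>
    have h1 : lastFlips K k (insert j v) = lastFlips K k v + Pi.single j (unitDigit K (k j - 1)) := by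
      funext i
      by_cases hi : i = j
      · subst hi; simp [lastFlips, hj]
      · simp [lastFlips, hi]
    have hj0 := hv j (Finset.mem_insert_self _ _)
    have := hk j
    rw [h1, ← add_assoc, haarComp_flip F k j (k j - 1) (by omega) (by omega),
      ih fun i hi => hv i (Finset.mem_insert_of_mem hi), Finset.card_insert_of_notMem hj]
    ring

/-- By oddness, all `2 ^ u.card` signed flips of the last digits give the same component. Adding
them up replaces `F` by its mixed difference, and this is where mixed derivatives enter. -/
theorem haarComp_eq_mixedDifference (F : (Fin d → Fin K → ZMod 2) → ℝ) (k : Fin d → ℕ)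
    (hk : ∀ j, k j ≤ K) (u : Finset (Fin d)) (hu : ∀ j ∈ u, k j ≠ 0)
    (c : Fin d → Fin K → ZMod 2) :
    2 ^ u.card * haarComp F k c = ∑ g : Fin d → Fin K → ZMod 2, (∏ j, haarKernel K (k j) (g j)) *
      ∑ v ∈ u.powerset, (-1) ^ v.card * F (c + g + lastFlips K k v) := by
  simp_rw [Finset.mul_sum]
  rw [Finset.sum_comm]
  have h : ∀ v ∈ u.powerset, ∑ g : Fin d → Fin K → ZMod 2, (∏ j, haarKernel K (k j) (g j)) *
      ((-1) ^ v.card * F (c + g + lastFlips K k v)) = haarComp F k c := by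
    intro v hv
    have h1 := haarComp_lastFlips F k hk v (fun j hj => hu j (Finset.mem_powerset.1 hv hj)) c
    have h2 : ((-1 : ℝ) ^ v.card) * (-1) ^ v.card = 1 := by
      rw [← mul_pow]; norm_num
    have h3 : haarComp F k c = (-1) ^ v.card * haarComp F k (c + lastFlips K k v) := by
      rw [h1, ← mul_assoc, h2, one_mul]
    rw [h3, haarComp, Finset.mul_sum]
    refine Finset.sum_congr rfl fun g _ => ?_
    rw [add_right_comm c g]; ring
  rw [Finset.sum_congr rfl h, Finset.sum_const, Finset.card_powerset, nsmul_eq_mul]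
  push_cast; rfl

theorem abs_haarComp_le (F : (Fin d → Fin K → ZMod 2) → ℝ) (k : Fin d → ℕ)
    (hk : ∀ j, k j ≤ K) (b : ℝ) (ρ : Fin d → (Fin K → ZMod 2) → ℝ) (u : Finset (Fin d))
    (hu : ∀ j ∈ u, k j ≠ 0)
    (hF : ∀ c, |∑ v ∈ u.powerset, (-1) ^ v.card * F (c + lastFlips K k v)| ≤
      2 ^ u.card * (b * ∏ j, ρ j (c j))) (c : Fin d → Fin K → ZMod 2) :
    |haarComp F k c| ≤ b * ∏ j, ∑ g, |haarKernel K (k j) g| * ρ j (c j + g) := by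
  have h1 : 2 ^ u.card * |haarComp F k c| ≤
      2 ^ u.card * (b * ∏ j, ∑ g, |haarKernel K (k j) g| * ρ j (c j + g)) := by
    have h2 : 2 ^ u.card * |haarComp F k c| = |2 ^ u.card * haarComp F k c| := by
      rw [abs_mul, abs_of_nonneg (by positivity : (0 : ℝ) ≤ 2 ^ u.card)]
    rw [h2, haarComp_eq_mixedDifference F k hk u hu c]
    refine (Finset.abs_sum_le_sum_abs _ _).trans ?_
    rw [Finset.prod_univ_sum, Fintype.piFinset_univ, Finset.mul_sum, Finset.mul_sum]
    refine Finset.sum_le_sum fun g _ => ?_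
    rw [abs_mul, Finset.abs_prod, Finset.prod_mul_distrib]
    refine (mul_le_mul_of_nonneg_left (hF (c + g))
      (Finset.prod_nonneg fun j _ => abs_nonneg _)).trans (le_of_eq ?_)
    simp only [Pi.add_apply]
    ring
  exact le_of_mul_le_mul_left h1 (by positivity)

/-- Jensen's inequality for the probability weights `|haarKernel K k g|`, then translation
invariance of the sum over all strings. -/
theorem sum_sq_average_le (k : ℕ) (hk : k ≤ K) (ρ : (Fin K → ZMod 2) → ℝ) :
    ∑ x, (∑ g, |haarKernel K k g| * ρ (x + g)) ^ 2 ≤ ∑ x, ρ x ^ 2 := by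
  calc ∑ x, (∑ g, |haarKernel K k g| * ρ (x + g)) ^ 2
      ≤ ∑ x, ∑ g, |haarKernel K k g| * ρ (x + g) ^ 2 := Finset.sum_le_sum fun x _ => by
        have := (even_two.convexOn_pow (𝕜 := ℝ)).map_sum_le (t := Finset.univ)
          (w := fun g => |haarKernel K k g|) (p := fun g => ρ (x + g))
          (fun _ _ => abs_nonneg _) (sum_abs_haarKernel K k hk) (fun _ _ => Set.mem_univ _)
        simpa using this
    _ = ∑ g, |haarKernel K k g| * ∑ x, ρ x ^ 2 := by
        rw [Finset.sum_comm]
        refine Finset.sum_congr rfl fun g _ => ?_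
        rw [← Finset.mul_sum]
        congr 1
        exact Equiv.sum_comp (Equiv.addRight g) (fun x => ρ x ^ 2)
    _ = _ := by rw [← Finset.sum_mul, sum_abs_haarKernel K k hk, one_mul]

/-- The mean square of a Haar component is bounded through a product bound on the mixed
differences. -/
theorem mean_sq_haarComp_le (F : (Fin d → Fin K → ZMod 2) → ℝ) (k : Fin d → ℕ)
    (hk : ∀ j, k j ≤ K) (b : ℝ) (ρ : Fin d → (Fin K → ZMod 2) → ℝ) (u : Finset (Fin d))
    (hu : ∀ j ∈ u, k j ≠ 0)
    (hF : ∀ c, |∑ v ∈ u.powerset, (-1) ^ v.card * F (c + lastFlips K k v)| ≤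
      2 ^ u.card * (b * ∏ j, ρ j (c j))) :
    (∑ c, haarComp F k c ^ 2) / (2 ^ K) ^ d ≤ b ^ 2 * ∏ j, (∑ x, ρ j x ^ 2) / 2 ^ K := by
  have h1 : ∑ c, haarComp F k c ^ 2 ≤ b ^ 2 * ∏ j, ∑ x, ρ j x ^ 2 := by
    calc ∑ c, haarComp F k c ^ 2
        ≤ ∑ c : Fin d → Fin K → ZMod 2,
          b ^ 2 * ∏ j, (∑ g, |haarKernel K (k j) g| * ρ j (c j + g)) ^ 2 := by
          refine Finset.sum_le_sum fun c _ => ?_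
          rw [Finset.prod_pow, ← mul_pow, ← sq_abs]
          exact pow_le_pow_left₀ (abs_nonneg _) (abs_haarComp_le F k hk b ρ u hu hF c) 2
      _ = b ^ 2 * ∏ j, ∑ x, (∑ g, |haarKernel K (k j) g| * ρ j (x + g)) ^ 2 := by
          rw [← Finset.mul_sum, Finset.prod_univ_sum, Fintype.piFinset_univ]
      _ ≤ _ := by
          refine mul_le_mul_of_nonneg_left ?_ (sq_nonneg _)
          exact Finset.prod_le_prod
            (fun j _ => Finset.sum_nonneg fun x _ => sq_nonneg _)
            (fun j _ => sum_sq_average_le (k j) (hk j) (ρ j))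
  have h2 : ((2 : ℝ) ^ K) ^ d = ∏ _j : Fin d, (2 : ℝ) ^ K := by simp
  rw [h2, Finset.prod_div_distrib, ← mul_div_assoc]
  exact div_le_div_of_nonneg_right h1 (by positivity)

/-! ### The boundary weights -/

/-- A weight dominating `min y (1 - y) ^ (-a)`. -/
noncomputable def boundaryWeight (a y : ℝ) : ℝ := y ^ (-a) + (1 - y) ^ (-a)

/-- An antiderivative of `boundaryWeight (a + 1)`. -/
noncomputable def boundaryPotential (a y : ℝ) : ℝ := ((1 - y) ^ (-a) - y ^ (-a)) / a

theorem min_rpow_le_boundaryWeight {a y : ℝ} (h0 : 0 < y) (h1 : y < 1) :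
    min y (1 - y) ^ (-a) ≤ boundaryWeight a y := by
  have e0 := Real.rpow_nonneg h0.le (-a)
  have e1 := Real.rpow_nonneg (sub_pos.2 h1).le (-a)
  unfold boundaryWeight
  rcases min_choice y (1 - y) with h | h <;> rw [h] <;> linarith

theorem hasDerivAt_boundaryPotential {a y : ℝ} (ha : a ≠ 0) (h0 : 0 < y) (h1 : y < 1) :
    HasDerivAt (boundaryPotential a) (boundaryWeight (a + 1) y) y := by
  have d0 := (hasDerivAt_id y).rpow_const (p := -a) (Or.inl h0.ne')
  have d1 := ((hasDerivAt_id y).const_sub 1).rpow_const (p := -a) (Or.inl (sub_pos.2 h1).ne')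
  refine ((d1.sub d0).div_const a).congr_deriv ?_
  simp only [id, boundaryWeight]
  rw [show -(a + 1) = -a - 1 by ring]
  field_simp
  ring

/-- Both `g + h` and `g - h` are monotone. Comparing with `g` in this way replaces the integration
of `h'`, which is neither known to be continuous nor to be integrable. -/
theorem abs_sub_le_of_abs_deriv_le {h h' g g' : ℝ → ℝ}
    (hh : ∀ t, 0 < t → t < 1 → HasDerivAt h (h' t) t)
    (hg : ∀ t, 0 < t → t < 1 → HasDerivAt g (g' t) t)
    (hb : ∀ t, 0 < t → t < 1 → |h' t| ≤ g' t) {x y : ℝ} (hx0 : 0 < x) (hx1 : x < 1)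
    (hy0 : 0 < y) (hy1 : y < 1) : |h x - h y| ≤ |g x - g y| := by
  have mono : ∀ f f' : ℝ → ℝ, (∀ t, 0 < t → t < 1 → HasDerivAt f (f' t) t) →
      (∀ t, 0 < t → t < 1 → 0 ≤ f' t) → MonotoneOn f (Set.Ioo 0 1) := by
    intro f f' hf hf0
    refine monotoneOn_of_deriv_nonneg (convex_Ioo 0 1)
      (fun t ht => (hf t ht.1 ht.2).continuousAt.continuousWithinAt) ?_ ?_
    · rw [interior_Ioo]
      exact fun t ht => (hf t ht.1 ht.2).differentiableAt.differentiableWithinAt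
    · rw [interior_Ioo]
      intro t ht
      rw [(hf t ht.1 ht.2).deriv]; exact hf0 t ht.1 ht.2
  have m1 := mono (fun t => g t + h t) _ (fun t h0 h1 => (hg t h0 h1).add (hh t h0 h1))
    fun t h0 h1 => by linarith [neg_le_of_abs_le (hb t h0 h1)]
  have m2 := mono (fun t => g t - h t) _ (fun t h0 h1 => (hg t h0 h1).sub (hh t h0 h1))
    fun t h0 h1 => by linarith [le_of_abs_le (hb t h0 h1)]
  rcases le_total x y with hxy | hxy
  · have e1 := m1 ⟨hx0, hx1⟩ ⟨hy0, hy1⟩ hxy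
    have e2 := m2 ⟨hx0, hx1⟩ ⟨hy0, hy1⟩ hxy
    simp only at e1 e2
    rw [abs_sub_comm, abs_sub_comm (g x)]
    exact (abs_le.2 ⟨by linarith, by linarith⟩ : |h y - h x| ≤ g y - g x).trans (le_abs_self _)
  · have e1 := m1 ⟨hy0, hy1⟩ ⟨hx0, hx1⟩ hxy
    have e2 := m2 ⟨hy0, hy1⟩ ⟨hx0, hx1⟩ hxy
    simp only at e1 e2
    exact (abs_le.2 ⟨by linarith, by linarith⟩ : |h x - h y| ≤ g x - g y).trans (le_abs_self _)

theorem update_mem_openCube {z : Fin d → ℝ} (hz : z ∈ openCube d) (i : Fin d) {t : ℝ}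
    (h0 : 0 < t) (h1 : t < 1) : Function.update z i t ∈ openCube d := by
  intro j
  by_cases h : j = i
  · subst h; simp [h0, h1]
  · simpa [h] using hz j

theorem piecewise_mem_openCube {z z' : Fin d → ℝ} (hz : z ∈ openCube d) (hz' : z' ∈ openCube d)
    (v : Finset (Fin d)) : v.piecewise z' z ∈ openCube d := by
  intro j
  by_cases h : j ∈ v
  · simpa [h] using hz' j
  · simpa [h] using hz j

/-- Mixed differences of a function whose mixed partial derivatives grow at most like the
boundary weights. -/
theorem abs_mixedDifference_le {φ : (Fin d → ℝ) → ℝ}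
    {D : Finset (Fin d) → (Fin d → ℝ) → ℝ} (hD : IsMixedPartials φ D) {b : ℝ} {A : Fin d → ℝ}
    (hA : ∀ i, 0 < A i)
    (hb : ∀ u, ∀ y ∈ openCube d, |D u y| ≤ b * ∏ i,
      if i ∈ u then boundaryWeight (A i + 1) (y i) else boundaryWeight (A i) (y i))
    (u w : Finset (Fin d)) (huw : Disjoint u w) {z z' : Fin d → ℝ} (hz : z ∈ openCube d)
    (hz' : z' ∈ openCube d) :
    |∑ v ∈ u.powerset, (-1) ^ v.card * D w (v.piecewise z' z)| ≤ b * ∏ i,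
      if i ∈ u then |boundaryPotential (A i) (z' i) - boundaryPotential (A i) (z i)|
      else if i ∈ w then boundaryWeight (A i + 1) (z i) else boundaryWeight (A i) (z i) := by
  induction u using Finset.induction_on generalizing w z with
  | empty => simpa using hb w z hz
  | insert i u hi ih =>
    have hiw : i ∉ w := Finset.disjoint_left.1 huw (Finset.mem_insert_self _ _)
    have huw' : Disjoint u (insert i w) := by
      rw [Finset.disjoint_insert_right]
      exact ⟨hi, huw.mono_left (Finset.subset_insert _ _)⟩
    have hpw : ∀ v ∈ u.powerset, ∀ t, v.piecewise z' (Function.update z i t) =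
        Function.update (v.piecewise z' z) i t := by
      intro v hv t
      have hiv : i ∉ v := fun h => hi (Finset.mem_powerset.1 hv h)
      exact (Finset.update_piecewise_of_notMem v z' z hiv t).symm
    -- The mixed difference over `u` is regarded as a function of the `i`-th coordinate of `z`. Its
    -- derivative is the mixed difference of the next partial derivative, which the induction
    -- hypothesis bounds by a constant times `boundaryWeight (A i + 1)`.
    set h : ℝ → ℝ := fun t =>
      ∑ v ∈ u.powerset, (-1) ^ v.card * D w (v.piecewise z' (Function.update z i t)) with hh
    set h' : ℝ → ℝ := fun t =>
      ∑ v ∈ u.powerset, (-1) ^ v.card * D (insert i w) (v.piecewise z' (Function.update z i t))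
      with hh'
    set R : Fin d → ℝ := fun j =>
      if j ∈ u then |boundaryPotential (A j) (z' j) - boundaryPotential (A j) (z j)|
      else if j ∈ w then boundaryWeight (A j + 1) (z j) else boundaryWeight (A j) (z j) with hR
    set C := b * ∏ j ∈ Finset.univ.erase i, R j with hC
    have hderiv : ∀ t, 0 < t → t < 1 → HasDerivAt h (h' t) t := by
      intro t h0 h1
      refine HasDerivAt.fun_sum fun v hv => HasDerivAt.const_mul _ ?_
      have h2 := hD.2 w i hiw (v.piecewise z' (Function.update z i t))
        (piecewise_mem_openCube (update_mem_openCube hz i h0 h1) hz' v)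
      rw [hpw v hv t] at h2 ⊢
      simp only [Function.update_idem, Function.update_self] at h2
      rw [show (fun t => D w (v.piecewise z' (Function.update z i t))) =
        fun t => D w (Function.update (v.piecewise z' z) i t) from
        funext fun s => by rw [hpw v hv s]]
      exact h2
    have hbound : ∀ t, 0 < t → t < 1 → |h' t| ≤ C * boundaryWeight (A i + 1) t := by
      intro t h0 h1
      refine (ih (insert i w) huw' (update_mem_openCube hz i h0 h1)).trans (le_of_eq ?_)
      rw [← Finset.mul_prod_erase _ _ (Finset.mem_univ i), if_neg hi,
        if_pos (Finset.mem_insert_self _ _), Function.update_self, hC]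
      rw [Finset.prod_congr rfl (g := R)]
      · ring
      · intro j hj
        have hji := Finset.ne_of_mem_erase hj
        simp [hR, hji]
    have key := abs_sub_le_of_abs_deriv_le hderiv
      (g := fun t => C * boundaryPotential (A i) t)
      (fun t h0 h1 => (hasDerivAt_boundaryPotential (hA i).ne' h0 h1).const_mul C) hbound
      (hz' i).1 (hz' i).2 (hz i).1 (hz i).2
    -- The sign of `C` is read off from the bound itself at one point, as `b` carries no sign
    -- condition here.
    have hC0 : 0 ≤ C := by
      have h2 := (abs_nonneg _).trans (hbound (1 / 2) (by norm_num) (by norm_num))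
      refine nonneg_of_mul_nonneg_left h2 ?_
      exact add_pos (Real.rpow_pos_of_pos (by norm_num) _) (Real.rpow_pos_of_pos (by norm_num) _)
    have hlhs : ∑ v ∈ (insert i u).powerset, (-1) ^ v.card * D w (v.piecewise z' z) =
        h (z i) - h (z' i) := by
      rw [Finset.sum_powerset_insert hi, hh]
      simp only [Function.update_eq_self, sub_eq_add_neg]
      congr 1
      rw [← Finset.sum_neg_distrib]
      refine Finset.sum_congr rfl fun v hv => ?_
      have hiv : i ∉ v := fun h => hi (Finset.mem_powerset.1 hv h)
      rw [Finset.card_insert_of_notMem hiv, hpw v hv, Finset.piecewise_insert]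
      ring
    rw [hlhs, abs_sub_comm]
    refine key.trans (le_of_eq ?_)
    rw [← mul_sub, abs_mul, abs_of_nonneg hC0, ← Finset.mul_prod_erase _ _ (Finset.mem_univ i),
      if_pos (Finset.mem_insert_self _ _), Finset.prod_congr rfl (g := R), hC]
    · ring
    · intro j hj
      have hji := Finset.ne_of_mem_erase hj
      simp [hR, hji]

theorem BoundaryGrowth.exists_weight_bound {φ : (Fin d → ℝ) → ℝ} {b : ℝ} {A : Fin d → ℝ}
    (hb : 0 ≤ b) (h : BoundaryGrowth φ b A) :
    ∃ D : Finset (Fin d) → (Fin d → ℝ) → ℝ, IsMixedPartials φ D ∧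
      ∀ u, ∀ y ∈ openCube d, |D u y| ≤ b * ∏ i,
        if i ∈ u then boundaryWeight (A i + 1) (y i) else boundaryWeight (A i) (y i) := by
  obtain ⟨D, hD, hbound⟩ := h
  refine ⟨D, hD, fun u y hy => (hbound u y hy).trans (mul_le_mul_of_nonneg_left ?_ hb)⟩
  refine Finset.prod_le_prod (fun i _ => Real.rpow_nonneg
    (le_min (hy i).1.le (sub_pos.2 (hy i).2).le) _) fun i _ => ?_
  split_ifs
  · rw [show -A i - 1 = -(A i + 1) by ring]
    exact min_rpow_le_boundaryWeight (hy i).1 (hy i).2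
  · rw [sub_zero]
    exact min_rpow_le_boundaryWeight (hy i).1 (hy i).2

/-- The mixed difference bound for a function satisfying the boundary growth condition. -/
theorem BoundaryGrowth.abs_mixedDifference_le {φ : (Fin d → ℝ) → ℝ} {b : ℝ} {A : Fin d → ℝ}
    (hb : 0 ≤ b) (hA : ∀ i, 0 < A i) (h : BoundaryGrowth φ b A) (u : Finset (Fin d))
    {z z' : Fin d → ℝ} (hz : z ∈ openCube d) (hz' : z' ∈ openCube d) :
    |∑ v ∈ u.powerset, (-1) ^ v.card * φ (v.piecewise z' z)| ≤ b * ∏ i,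
      if i ∈ u then |boundaryPotential (A i) (z' i) - boundaryPotential (A i) (z i)|
      else boundaryWeight (A i) (z i) := by
  obtain ⟨D, hD, hbound⟩ := h.exists_weight_bound hb
  have h1 := NestedQMC.abs_mixedDifference_le hD hA hbound u ∅ (Finset.disjoint_empty_right _)
    hz hz'
  simp only [Finset.notMem_empty, if_false] at h1
  rwa [Finset.sum_congr rfl fun v _ => by
    rw [hD.1 _ (piecewise_mem_openCube hz hz' v)]] at h1

end

section

variable {d K : ℕ}

/-! ### Midpoints of dyadic intervals -/

/-- The midpoint of the dyadic interval of the numbers whose expansion starts with `x`. -/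
noncomputable def midpointOf (x : Fin K → ZMod 2) : ℝ :=
  ∑ i, ((x i).val : ℝ) / 2 ^ (i.val + 1) + 1 / 2 ^ (K + 1)

theorem midpointOf_cons (b : ZMod 2) (x : Fin K → ZMod 2) :
    midpointOf (Fin.cons b x : Fin (K + 1) → ZMod 2) = ((b.val : ℝ) + midpointOf x) / 2 := by
  unfold midpointOf
  rw [Fin.sum_univ_succ]
  simp only [Fin.cons_zero, Fin.cons_succ, Fin.val_zero, Fin.val_succ]
  have : ∀ i : Fin K, ((x i).val : ℝ) / 2 ^ (i.val + 1 + 1) =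
      ((x i).val : ℝ) / 2 ^ (i.val + 1) / 2 := fun i => by rw [pow_succ _ (i.val + 1)]; field_simp
  simp_rw [this, ← Finset.sum_div]
  field_simp
  ring

theorem zmod_two_val_eq (b : ZMod 2) : b.val = 0 ∨ b.val = 1 := by
  revert b; decide

theorem midpointOf_mem (x : Fin K → ZMod 2) : 0 < midpointOf x ∧ midpointOf x < 1 := by
  induction K with
  | zero => norm_num [midpointOf]
  | succ K ih =>
    rw [← Fin.cons_self_tail x, midpointOf_cons]
    obtain ⟨h1, h2⟩ := ih (Fin.tail x)
    rcases zmod_two_val_eq (x 0) with h | h <;> rw [h] <;> constructor <;> push_cast <;> linarith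

/-- Induction on the first digit: the strings starting with 0 and with 1 fill the lower and the
upper half of the grid of points `(i + 1/2) / 2 ^ K`. -/
theorem sum_midpointOf (K : ℕ) (h : ℝ → ℝ) :
    ∑ x : Fin K → ZMod 2, h (midpointOf x) =
      ∑ i ∈ Finset.range (2 ^ K), h ((i + 1 / 2) / 2 ^ K) := by
  induction K generalizing h with
  | zero => norm_num [midpointOf]
  | succ K ih =>
    rw [← (Fin.consEquiv fun _ : Fin (K + 1) => ZMod 2).sum_comp, Fintype.sum_prod_type]
    have h1 : ∀ p : ZMod 2 × (Fin K → ZMod 2),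
        midpointOf ((Fin.consEquiv fun _ : Fin (K + 1) => ZMod 2) p) =
          ((p.1.val : ℝ) + midpointOf p.2) / 2 := fun p => midpointOf_cons p.1 p.2
    simp only [h1]
    have h2 : ∀ f : ZMod 2 → ℝ, ∑ b, f b = f 0 + f 1 := fun f => Fin.sum_univ_two f
    rw [h2, ih (fun y => h ((((0 : ZMod 2).val : ℝ) + y) / 2)),
      ih (fun y => h ((((1 : ZMod 2).val : ℝ) + y) / 2)), pow_succ 2 K, mul_two,
      Finset.sum_range_add]
    congr 1
    · refine Finset.sum_congr rfl fun i _ => ?_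
      congr 1
      rw [show (0 : ZMod 2).val = 0 from rfl, pow_succ]
      push_cast; field_simp; ring
    · refine Finset.sum_congr rfl fun i _ => ?_
      congr 1
      rw [show (1 : ZMod 2).val = 1 from rfl, pow_succ]
      push_cast; field_simp; ring

theorem midpointOf_add_unitDigit (x : Fin K → ZMod 2) (k : ℕ) (hk : k < K) :
    midpointOf (x + unitDigit K k) = midpointOf x + 1 / 2 ^ (k + 1) ∨
      midpointOf (x + unitDigit K k) = midpointOf x - 1 / 2 ^ (k + 1) := by
  have h1 : ∀ b : ZMod 2, (((b + 1).val : ℝ) = b.val + 1) ∨ (((b + 1).val : ℝ) = b.val - 1) := by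
    have : ∀ b : ZMod 2, b = 0 ∨ b = 1 := by decide
    intro b
    rcases this b with rfl | rfl
    · left; norm_num [ZMod.val_one]
    · right
      rw [show (1 + 1 : ZMod 2) = 0 from rfl]; norm_num [ZMod.val_one]
  have h2 : midpointOf (x + unitDigit K k) - midpointOf x =
      (((x ⟨k, hk⟩ + 1).val : ℝ) - (x ⟨k, hk⟩).val) / 2 ^ (k + 1) := by
    unfold midpointOf
    rw [add_sub_add_right_eq_sub, ← Finset.sum_sub_distrib,
      Finset.sum_eq_single_of_mem ⟨k, hk⟩ (Finset.mem_univ _)]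
    · simp [unitDigit, sub_div]
    · intro i _ hi
      have : i.val ≠ k := fun h => hi (Fin.ext h)
      simp [unitDigit, this]
  rcases h1 (x ⟨k, hk⟩) with h | h
  · left; rw [h] at h2; rw [← sub_eq_iff_eq_add', h2]; ring
  · right; rw [h] at h2; linear_combination h2

/-! ### Sums of powers at midpoints -/

/-- The sum is compared with the increments of `q ^ (1 - a)`. Bernoulli's inequality for the base `1
- 1/(q+1)` bounds such an increment below by `(1 - a) (q+1) ^ (-a)`, and passing from `q + 1/2` to
`q + 1` loses at most a factor 2. -/
theorem sum_rpow_neg_le {a : ℝ} (h0 : 0 < a) (h1 : a < 1) (q : ℕ) :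
    ∑ i ∈ Finset.range q, ((i : ℝ) + 1 / 2) ^ (-a) ≤ 2 / (1 - a) * (q : ℝ) ^ (1 - a) := by
  have ha : 0 < 1 - a := by linarith
  induction q with
  | zero => simp [Real.zero_rpow ha.ne']
  | succ q ih =>
    rw [Finset.sum_range_succ]
    have hq : (0 : ℝ) ≤ q := q.cast_nonneg
    have hq1 : (0 : ℝ) < q + 1 := by positivity
    have hb : (q : ℝ) ^ (1 - a) ≤ (q + 1 : ℝ) ^ (1 - a) - (1 - a) * (q + 1 : ℝ) ^ (-a) := by
      have hs : (-1 : ℝ) ≤ -(1 / (q + 1)) := by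
        rw [neg_le_neg_iff, div_le_one hq1]; linarith
      have e1 := rpow_one_add_le_one_add_mul_self hs ha.le (by linarith)
      have e2 : (q : ℝ) = (q + 1) * (1 + -(1 / (q + 1))) := by field_simp; ring
      have e3 : (0 : ℝ) ≤ 1 + -(1 / (q + 1)) := by linarith
      have e4 : (q + 1 : ℝ) ^ (-a) = (q + 1 : ℝ) ^ (1 - a) / (q + 1) := by
        rw [← Real.rpow_sub_one hq1.ne']; congr 1; ring
      calc (q : ℝ) ^ (1 - a) = (q + 1 : ℝ) ^ (1 - a) * (1 + -(1 / (q + 1))) ^ (1 - a) := by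
            rw [← Real.mul_rpow hq1.le e3, ← e2]
        _ ≤ (q + 1 : ℝ) ^ (1 - a) * (1 + (1 - a) * -(1 / (q + 1))) :=
            mul_le_mul_of_nonneg_left e1 (Real.rpow_nonneg hq1.le _)
        _ = _ := by rw [e4]; ring
    have hc : ((q : ℝ) + 1 / 2) ^ (-a) ≤ 2 * (q + 1 : ℝ) ^ (-a) := by
      have e1 : ((q : ℝ) + 1 / 2) ^ (-a) ≤ ((q + 1 : ℝ) / 2) ^ (-a) :=
        Real.rpow_le_rpow_of_nonpos (by positivity) (by linarith) (by linarith)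
      have e2 : (2 : ℝ) ^ a ≤ 2 := by
        simpa using Real.rpow_le_rpow_of_exponent_le (x := 2) (by norm_num) h1.le
      rw [Real.div_rpow hq1.le (by norm_num), Real.rpow_neg (by norm_num : (0 : ℝ) ≤ 2), div_inv_eq_mul]
        at e1
      refine e1.trans ?_
      rw [mul_comm]
      exact mul_le_mul_of_nonneg_right e2 (Real.rpow_nonneg hq1.le _)
    push_cast
    have hd : 2 / (1 - a) * (q : ℝ) ^ (1 - a) ≤
        2 / (1 - a) * (q + 1 : ℝ) ^ (1 - a) - 2 * (q + 1 : ℝ) ^ (-a) := by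
      refine (mul_le_mul_of_nonneg_left hb (by positivity)).trans (le_of_eq ?_)
      field_simp
    linarith

/-- One factor is at most `q ^ (-a)`; the other, `(i + 1/2) ^ (-2)`, is at most `1/i - 1/(i+1)`,
which telescopes. -/
theorem sum_Ico_rpow_neg_le {a : ℝ} (h0 : 0 < a) {q Q : ℕ} (hq : 1 ≤ q) (hQ : q ≤ Q) :
    ∑ i ∈ Finset.Ico q Q, ((i : ℝ) + 1 / 2) ^ (-a - 2) ≤ (q : ℝ) ^ (-a - 1) := by
  have hq0 : (0 : ℝ) < q := by exact_mod_cast hq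
  have h1 : ∑ i ∈ Finset.Ico q Q, ((i : ℝ) + 1 / 2) ^ (-a - 2) ≤
      ∑ i ∈ Finset.Ico q Q, (q : ℝ) ^ (-a) * (1 / (i : ℝ) - 1 / (((i : ℕ) + 1 : ℕ) : ℝ)) := by
    refine Finset.sum_le_sum fun i hi => ?_
    rw [Finset.mem_Ico] at hi
    have hqi : (q : ℝ) ≤ i := by exact_mod_cast hi.1
    have hi0 : (0 : ℝ) < i := hq0.trans_le hqi
    rw [sub_eq_add_neg (-a), Real.rpow_add (by positivity), Real.rpow_neg (by positivity) 2]
    refine mul_le_mul (Real.rpow_le_rpow_of_nonpos hq0 (by linarith) (by linarith)) ?_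
      (by positivity) (by positivity)
    push_cast
    rw [div_sub_div _ _ hi0.ne' (by positivity), Real.rpow_two, inv_eq_one_div]
    rw [div_le_div_iff₀ (by positivity) (by positivity)]
    nlinarith
  refine h1.trans ?_
  rw [← Finset.mul_sum]
  have h2 := Finset.sum_Ico_sub (fun i : ℕ => -(1 / (i : ℝ))) hQ
  have h3 : ∑ i ∈ Finset.Ico q Q, (1 / (i : ℝ) - 1 / (((i : ℕ) + 1 : ℕ) : ℝ)) ≤ 1 / q := by
    rw [Finset.sum_congr rfl (g := fun i : ℕ => -(1 / ((i + 1 : ℕ) : ℝ)) - -(1 / (i : ℝ)))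
      fun i _ => by ring, h2]
    have : (0 : ℝ) ≤ 1 / Q := by positivity
    linarith
  rw [Real.rpow_sub_one hq0.ne', div_eq_mul_one_div]
  exact mul_le_mul_of_nonneg_left h3 (by positivity)

/-- A bound of the squared increments of `y ^ (-a)` over a distance `h`. -/
noncomputable def incrementBound (a h z : ℝ) : ℝ := min (z ^ (-(2 * a))) (h ^ 2 * z ^ (-(2 * a) - 2))

theorem incrementBound_nonneg {a h z : ℝ} (hz : 0 ≤ z) : 0 ≤ incrementBound a h z :=
  le_min (Real.rpow_nonneg hz _) (mul_nonneg (sq_nonneg _) (Real.rpow_nonneg hz _))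

/-- The first bound, used for `z` below `h`, drops the smaller power. The second comes from
Bernoulli's inequality: `(1 + h/z) ^ a ≤ 1 + h/z`, so the decrement is at most `z ^ (-a) * (h/z)`.
-/
theorem sq_rpow_sub_rpow_le {a h z : ℝ} (ha0 : 0 < a) (ha1 : a ≤ 1) (hz : 0 < z) (hh : 0 ≤ h) :
    ((z + h) ^ (-a) - z ^ (-a)) ^ 2 ≤ incrementBound a h z := by
  have hzp := Real.rpow_pos_of_pos hz (-a)
  have hzh : (z + h) ^ (-a) ≤ z ^ (-a) :=
    Real.rpow_le_rpow_of_nonpos hz (by linarith) (by linarith)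
  have hzh0 : 0 ≤ (z + h) ^ (-a) := Real.rpow_nonneg (by linarith) _
  have hsq : (z ^ (-a)) ^ 2 = z ^ (-(2 * a)) := by
    rw [← Real.rpow_natCast, ← Real.rpow_mul hz.le]; congr 1; push_cast; ring
  rw [show ((z + h) ^ (-a) - z ^ (-a)) ^ 2 = (z ^ (-a) - (z + h) ^ (-a)) ^ 2 by ring]
  refine le_min ?_ ?_
  · rw [← hsq]
    exact pow_le_pow_left₀ (by linarith) (by linarith) 2
  · have hs : 0 ≤ h / z := by positivity
    have e1 := rpow_one_add_le_one_add_mul_self (by linarith : -1 ≤ h / z) ha0.le ha1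
    have e2 : z ^ (-a) * (1 - h / z) ≤ (z + h) ^ (-a) := by
      rw [show z + h = z * (1 + h / z) by field_simp, Real.mul_rpow hz.le (by positivity)]
      refine mul_le_mul_of_nonneg_left ?_ hzp.le
      rw [Real.rpow_neg (by positivity)]
      have e3 : (1 + h / z) ^ a ≤ 1 + h / z := e1.trans (by nlinarith)
      have e4 : (0 : ℝ) < (1 + h / z) ^ a := by positivity
      refine le_trans ?_ (inv_anti₀ e4 e3)
      rw [inv_eq_one_div, le_div_iff₀ (by positivity)]
      nlinarith [sq_nonneg (h / z)]
    have e5 : z ^ (-a) - (z + h) ^ (-a) ≤ z ^ (-a) * (h / z) := by linarith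
    refine (pow_le_pow_left₀ (by linarith) e5 2).trans (le_of_eq ?_)
    rw [mul_pow, hsq, sub_eq_add_neg (-(2 * a)), Real.rpow_add hz, Real.rpow_neg hz.le 2,
      Real.rpow_two]
    field_simp

/-- The sum is split at `i = q`, that is near `z = h = q/Q`. Below, `z ^ (-2a)` is summable up to
the singularity because `2a < 1`; above, `h² z ^ (-2a-2)` is dominated by its lower end. Both parts
are of order `h ^ (1 - 2a)`. -/
theorem sum_incrementBound_le {a : ℝ} (h0 : 0 < a) (h1 : a < 1 / 2) {q Q : ℕ} (hq : 1 ≤ q)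
    (hQ : q ≤ Q) :
    (∑ i ∈ Finset.range Q, incrementBound a (q / Q) ((i + 1 / 2) / Q)) / Q ≤
      (2 / (1 - 2 * a) + 1) * ((q : ℝ) / Q) ^ (1 - 2 * a) := by
  have hq0 : (0 : ℝ) < q := by exact_mod_cast hq
  have hQ0 : (0 : ℝ) < Q := by exact_mod_cast hq.trans hQ
  have hsplit := Finset.sum_range_add_sum_Ico
    (fun i : ℕ => incrementBound a (q / Q) (((i : ℝ) + 1 / 2) / Q)) hQ
  have e1 : ∑ i ∈ Finset.range q, incrementBound a (q / Q) (((i : ℝ) + 1 / 2) / Q) ≤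
      (Q : ℝ) ^ (2 * a) * (2 / (1 - 2 * a) * (q : ℝ) ^ (1 - 2 * a)) := by
    refine le_trans ?_ (mul_le_mul_of_nonneg_left
      (sum_rpow_neg_le (a := 2 * a) (by linarith) (by linarith) q) (by positivity))
    rw [Finset.mul_sum]
    refine Finset.sum_le_sum fun i _ => (min_le_left _ _).trans (le_of_eq ?_)
    rw [Real.div_rpow (by positivity) hQ0.le, Real.rpow_neg hQ0.le, div_inv_eq_mul, mul_comm]
  have e2 : ∑ i ∈ Finset.Ico q Q, incrementBound a (q / Q) (((i : ℝ) + 1 / 2) / Q) ≤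
      ((q : ℝ) / Q) ^ 2 * (Q : ℝ) ^ (2 * a + 2) * (q : ℝ) ^ (-(2 * a) - 1) := by
    refine le_trans ?_ (mul_le_mul_of_nonneg_left
      (sum_Ico_rpow_neg_le (a := 2 * a) (by linarith) hq hQ) (by positivity))
    rw [Finset.mul_sum]
    refine Finset.sum_le_sum fun i _ => (min_le_right _ _).trans (le_of_eq ?_)
    rw [Real.div_rpow (by positivity) hQ0.le, show -(2 * a) - 2 = -(2 * a + 2) by ring,
      Real.rpow_neg hQ0.le, div_inv_eq_mul]
    ring
  have hQ1 : (Q : ℝ) ^ (2 * a) = Q * (Q : ℝ) ^ (-(1 - 2 * a)) := by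
    rw [show -(1 - 2 * a) = 2 * a - 1 by ring, Real.rpow_sub_one hQ0.ne']; field_simp
  have hQ2 : (Q : ℝ) ^ (2 * a + 2) = Q ^ 3 * (Q : ℝ) ^ (-(1 - 2 * a)) := by
    rw [show 2 * a + 2 = ((3 : ℕ) : ℝ) + -(1 - 2 * a) by push_cast; ring, Real.rpow_add hQ0,
      Real.rpow_natCast]
  have hq2 : (q : ℝ) ^ (-(2 * a) - 1) = (q : ℝ) ^ (1 - 2 * a) / q ^ 2 := by
    rw [show -(2 * a) - 1 = (1 - 2 * a) - ((2 : ℕ) : ℝ) by push_cast; ring,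
      Real.rpow_sub hq0, Real.rpow_natCast]
  rw [hQ1] at e1
  rw [hQ2, hq2] at e2
  rw [div_le_iff₀ hQ0, ← hsplit]
  refine (add_le_add e1 e2).trans (le_of_eq ?_)
  rw [Real.div_rpow hq0.le hQ0.le, Real.rpow_neg hQ0.le]
  have : (0 : ℝ) < (Q : ℝ) ^ (1 - 2 * a) := by positivity
  field_simp

/-- The size of the Haar differences of level `k` of the boundary potential. -/
noncomputable def boundaryDiff (a : ℝ) (K k : ℕ) (x : Fin K → ZMod 2) : ℝ :=
  if k = 0 then boundaryWeight a (midpointOf x)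
  else |boundaryPotential a (midpointOf (x + unitDigit K (k - 1))) -
    boundaryPotential a (midpointOf x)| / 2

/-- The constant in the mean square bound of `boundaryDiff`. -/
noncomputable def boundaryConst (a : ℝ) : ℝ := 8 * (2 / (1 - 2 * a) + 1) / a ^ 2

theorem boundaryConst_pos {a : ℝ} (h0 : 0 < a) (h1 : a < 1 / 2) : 0 < boundaryConst a := by
  have : 0 < 1 - 2 * a := by linarith
  unfold boundaryConst; positivity

theorem sum_range_midpoint_reflect (Q : ℕ) (h : ℝ → ℝ) :
    ∑ i ∈ Finset.range Q, h (1 - (i + 1 / 2) / Q) =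
      ∑ i ∈ Finset.range Q, h ((i + 1 / 2) / Q) := by
  rw [← Finset.sum_range_reflect]
  refine Finset.sum_congr rfl fun i hi => ?_
  rw [Finset.mem_range] at hi
  have hQ : (Q : ℝ) ≠ 0 := by
    have : 0 < Q := by omega
    positivity
  congr 1
  rw [Nat.sub_sub, Nat.cast_sub (by omega)]
  push_cast
  field_simp
  ring

/-- The singularities at 0 and at 1 are treated separately, the latter by reflection. Listing the
terms of both points makes the bound symmetric, so `z' = z + h` may be assumed. -/
theorem sq_boundaryPotential_sub_le {a h z z' : ℝ} (ha0 : 0 < a) (ha1 : a < 1 / 2) (hh : 0 ≤ h)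
    (hz0 : 0 < z) (hz1 : z < 1) (hz0' : 0 < z') (hz1' : z' < 1) (hzz : z' = z + h ∨ z' = z - h) :
    (boundaryPotential a z' - boundaryPotential a z) ^ 2 ≤ 2 / a ^ 2 *
      (incrementBound a h z + incrementBound a h z' + incrementBound a h (1 - z) +
        incrementBound a h (1 - z')) := by
  wlog hle : z' = z + h generalizing z z'
  · have := this hz0' hz1' hz0 hz1 (Or.inl (by rcases hzz with h | h; exacts [absurd h hle, by rw [h]; ring]))
      (by rcases hzz with h | h; exacts [absurd h hle, by rw [h]; ring])
    rw [show (boundaryPotential a z' - boundaryPotential a z) ^ 2 =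
      (boundaryPotential a z - boundaryPotential a z') ^ 2 by ring]
    linarith
  have e1 := sq_rpow_sub_rpow_le (a := a) (h := h) ha0 (by linarith) hz0 hh
  have e2 := sq_rpow_sub_rpow_le (a := a) (h := h) (z := 1 - z') ha0 (by linarith) (by linarith) hh
  rw [← hle] at e1
  rw [show 1 - z' + h = 1 - z by rw [hle]; ring] at e2
  have n1 := incrementBound_nonneg (a := a) (h := h) hz0'.le
  have n2 := incrementBound_nonneg (a := a) (h := h) (sub_pos.2 hz1).le
  have e3 : (boundaryPotential a z' - boundaryPotential a z) ^ 2 =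
      (((1 - z') ^ (-a) - (1 - z) ^ (-a)) - (z' ^ (-a) - z ^ (-a))) ^ 2 / a ^ 2 := by
    unfold boundaryPotential; field_simp; ring
  rw [e3, div_eq_inv_mul, show 2 / a ^ 2 = (a ^ 2)⁻¹ * 2 by ring, mul_assoc]
  refine mul_le_mul_of_nonneg_left ?_ (by positivity)
  nlinarith [sq_nonneg (((1 - z') ^ (-a) - (1 - z) ^ (-a)) + (z' ^ (-a) - z ^ (-a)))]

theorem mean_incrementBound_le {a : ℝ} (h0 : 0 < a) (h1 : a < 1 / 2) {k : ℕ} (hk : k < K) :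
    (∑ x : Fin K → ZMod 2, incrementBound a (1 / 2 ^ (k + 1)) (midpointOf x)) / 2 ^ K ≤
      (2 / (1 - 2 * a) + 1) * ((1 : ℝ) / 2 ^ (k + 1)) ^ (1 - 2 * a) := by
  rw [sum_midpointOf]
  have h := sum_incrementBound_le h0 h1 (q := 2 ^ (K - (k + 1))) (Q := 2 ^ K)
    Nat.one_le_two_pow (Nat.pow_le_pow_right (by norm_num) (by omega))
  have e : (((2 ^ (K - (k + 1)) : ℕ) : ℝ) / ((2 ^ K : ℕ) : ℝ)) = 1 / 2 ^ (k + 1) := by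
    push_cast
    rw [div_eq_div_iff (by positivity) (by positivity), ← pow_add, one_mul]
    congr 1; omega
  rw [e] at h
  push_cast at h
  exact h

/-- This is the decay in one coordinate. For `k > 0` the flip and the reflection `y ↦ 1 - y` permute
the midpoints, so the four increment terms have the same mean, of order `2 ^ (-(1 - 2a) k)`. For `k
= 0` the mean of `y ^ (-2a)` stays bounded because `2a < 1`. -/
theorem mean_sq_boundaryDiff_le {a : ℝ} (h0 : 0 < a) (h1 : a < 1 / 2) {k : ℕ} (hk : k ≤ K) :
    (∑ x, boundaryDiff a K k x ^ 2) / 2 ^ K ≤ boundaryConst a * (2 : ℝ) ^ (-((1 - 2 * a) * k)) := by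
  have ha : 0 < 1 - 2 * a := by linarith
  have hK : (0 : ℝ) < 2 ^ K := by positivity
  cases k with
  | zero =>
    have e1 : ∀ x : Fin K → ZMod 2, boundaryDiff a K 0 x ^ 2 ≤
        2 * ((midpointOf x) ^ (-(2 * a)) + (1 - midpointOf x) ^ (-(2 * a))) := by
      intro x
      obtain ⟨m0, m1⟩ := midpointOf_mem x
      have s1 : ∀ y : ℝ, 0 < y → y ^ (-(2 * a)) = (y ^ (-a)) ^ 2 := fun y hy => by
        rw [← Real.rpow_natCast, ← Real.rpow_mul hy.le]; congr 1; push_cast; ring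
      rw [s1 _ m0, s1 _ (sub_pos.2 m1), boundaryDiff, if_pos rfl, boundaryWeight]
      nlinarith [sq_nonneg ((midpointOf x) ^ (-a) - (1 - midpointOf x) ^ (-a))]
    have e2 : ∑ i ∈ Finset.range (2 ^ K), (((i : ℝ) + 1 / 2) / 2 ^ K) ^ (-(2 * a)) ≤
        2 / (1 - 2 * a) * 2 ^ K := by
      have := mul_le_mul_of_nonneg_left (sum_rpow_neg_le (a := 2 * a) (by linarith) (by linarith)
        (2 ^ K)) (by positivity : (0 : ℝ) ≤ ((2 : ℝ) ^ K) ^ (2 * a))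
      rw [Finset.mul_sum] at this
      refine le_trans (Finset.sum_le_sum fun i _ => le_of_eq ?_) (this.trans (le_of_eq ?_))
      · rw [Real.div_rpow (by positivity) hK.le, Real.rpow_neg hK.le, div_inv_eq_mul, mul_comm]
      · push_cast
        rw [mul_left_comm, ← Real.rpow_add hK]
        simp
    have e3 : ∑ x : Fin K → ZMod 2, boundaryDiff a K 0 x ^ 2 ≤ 2 * (2 * (2 / (1 - 2 * a) * 2 ^ K)) := by
      refine (Finset.sum_le_sum fun x _ => e1 x).trans ?_
      rw [← Finset.mul_sum, Finset.sum_add_distrib, sum_midpointOf K (fun y => y ^ (-(2 * a))),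
        sum_midpointOf K (fun y => (1 - y) ^ (-(2 * a)))]
      have r := sum_range_midpoint_reflect (2 ^ K) (fun y => y ^ (-(2 * a)))
      push_cast at r
      rw [r]
      linarith
    rw [div_le_iff₀ hK]
    refine e3.trans ?_
    rw [Nat.cast_zero, mul_zero, neg_zero, Real.rpow_zero, mul_one]
    have hc : 2 * (2 * (2 / (1 - 2 * a))) ≤ boundaryConst a := by
      unfold boundaryConst
      rw [le_div_iff₀ (by positivity)]
      have : 0 < 2 / (1 - 2 * a) := by positivity
      have h3 : a ^ 2 ≤ 1 := by nlinarith
      nlinarith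
    nlinarith
  | succ k =>
    set h : ℝ := 1 / 2 ^ (k + 1) with hh
    have hpos : 0 < h := by positivity
    have e1 : ∀ x : Fin K → ZMod 2, boundaryDiff a K (k + 1) x ^ 2 ≤ 1 / (2 * a ^ 2) *
        (incrementBound a h (midpointOf x) + incrementBound a h (midpointOf (x + unitDigit K k)) +
          incrementBound a h (1 - midpointOf x) +
          incrementBound a h (1 - midpointOf (x + unitDigit K k))) := by
      intro x
      obtain ⟨m0, m1⟩ := midpointOf_mem x
      obtain ⟨n0, n1⟩ := midpointOf_mem (x + unitDigit K k)
      have := sq_boundaryPotential_sub_le h0 h1 hpos.le m0 m1 n0 n1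
        (midpointOf_add_unitDigit x k hk)
      rw [boundaryDiff, if_neg (Nat.succ_ne_zero k), Nat.add_sub_cancel, div_pow, sq_abs,
        div_le_iff₀ (by norm_num)]
      refine this.trans (le_of_eq ?_)
      field_simp
    have t1 : ∑ x, incrementBound a h (midpointOf (x + unitDigit K k)) =
        ∑ x : Fin K → ZMod 2, incrementBound a h (midpointOf x) :=
      Equiv.sum_comp (Equiv.addRight (unitDigit K k)) fun x => incrementBound a h (midpointOf x)
    have t2 : ∑ x, incrementBound a h (1 - midpointOf (x + unitDigit K k)) =
        ∑ x : Fin K → ZMod 2, incrementBound a h (1 - midpointOf x) :=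
      Equiv.sum_comp (Equiv.addRight (unitDigit K k)) fun x => incrementBound a h (1 - midpointOf x)
    have t3 : ∑ x : Fin K → ZMod 2, incrementBound a h (1 - midpointOf x) =
        ∑ x : Fin K → ZMod 2, incrementBound a h (midpointOf x) := by
      rw [sum_midpointOf K fun y => incrementBound a h (1 - y), sum_midpointOf K]
      have r := sum_range_midpoint_reflect (2 ^ K) (incrementBound a h)
      push_cast at r
      exact r
    have e2 := mean_incrementBound_le h0 h1 (K := K) hk
    rw [← hh] at e2
    have e3 : (∑ x, boundaryDiff a K (k + 1) x ^ 2) / 2 ^ K ≤ 1 / (2 * a ^ 2) * (4 *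
        ((∑ x : Fin K → ZMod 2, incrementBound a h (midpointOf x)) / 2 ^ K)) := by
      rw [div_le_iff₀ hK]
      refine (Finset.sum_le_sum fun x _ => e1 x).trans (le_of_eq ?_)
      rw [← Finset.mul_sum, Finset.sum_add_distrib, Finset.sum_add_distrib,
        Finset.sum_add_distrib, t1, t2, t3]
      field_simp; ring
    have e4 : h ^ (1 - 2 * a) = (2 : ℝ) ^ (-((1 - 2 * a) * ((k + 1 : ℕ) : ℝ))) := by
      rw [hh, one_div, ← Real.rpow_natCast, ← Real.rpow_neg (by norm_num), ← Real.rpow_mul (by norm_num)]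
      congr 1; ring
    rw [← e4]
    refine e3.trans ((mul_le_mul_of_nonneg_left (mul_le_mul_of_nonneg_left e2 (by norm_num))
      (by positivity)).trans ?_)
    have hp : 0 < (2 / (1 - 2 * a) + 1) * h ^ (1 - 2 * a) := by positivity
    unfold boundaryConst
    rw [show 8 * (2 / (1 - 2 * a) + 1) / a ^ 2 * h ^ (1 - 2 * a) =
      8 / a ^ 2 * ((2 / (1 - 2 * a) + 1) * h ^ (1 - 2 * a)) by ring, ← mul_assoc]
    refine mul_le_mul_of_nonneg_right ?_ hp.le
    rw [div_mul_eq_mul_div, div_le_div_iff₀ (by positivity) (by positivity)]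
    nlinarith [sq_nonneg a]

/-- The mean square of the Haar components of a function satisfying the boundary growth
condition, sampled at the midpoints of dyadic boxes. -/
theorem BoundaryGrowth.mean_sq_haarComp_le {φ : (Fin d → ℝ) → ℝ} {b : ℝ} {A : Fin d → ℝ}
    (hb : 0 ≤ b) (hA : ∀ i, 0 < A i ∧ A i < 1 / 2) (h : BoundaryGrowth φ b A) (k : Fin d → ℕ)
    (hk : ∀ j, k j ≤ K) :
    (∑ c : Fin d → Fin K → ZMod 2, haarComp (fun c => φ fun j => midpointOf (c j)) k c ^ 2) /
      (2 ^ K) ^ d ≤ b ^ 2 * ∏ j, boundaryConst (A j) * (2 : ℝ) ^ (-((1 - 2 * A j) * k j)) := by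
  -- Differences are taken exactly in the coordinates of positive level. The division by 2 in
  -- `boundaryDiff` matches the factor `2 ^ u.card`.
  refine (NestedQMC.mean_sq_haarComp_le _ k hk b (fun j => boundaryDiff (A j) K (k j))
    (Finset.univ.filter fun j => k j ≠ 0) (fun j hj => (Finset.mem_filter.1 hj).2) ?_).trans ?_
  · intro c
    have h1 := h.abs_mixedDifference_le hb (fun i => (hA i).1)
      (Finset.univ.filter fun j => k j ≠ 0)
      (z := fun j => midpointOf (c j)) (z' := fun j => midpointOf (c j + unitDigit K (k j - 1)))
      (fun j => midpointOf_mem _) (fun j => midpointOf_mem _)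
    rw [Finset.sum_congr rfl (g := fun v => (-1) ^ v.card *
      φ fun j => midpointOf ((c + lastFlips K k v) j))] at h1
    · refine h1.trans (le_of_eq ?_)
      rw [mul_left_comm]
      congr 1
      have h2 : (2 : ℝ) ^ (Finset.univ.filter fun j => k j ≠ 0).card =
          ∏ j, if k j ≠ 0 then 2 else 1 := by
        rw [Finset.prod_ite]; simp
      rw [h2, ← Finset.prod_mul_distrib]
      refine Finset.prod_congr rfl fun j _ => ?_
      by_cases hj : k j = 0
      · simp [hj, boundaryDiff]
      · simp [hj, boundaryDiff]; ring
    · intro v hv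
      congr 2
      funext j
      by_cases hj : j ∈ v <;> simp [hj, lastFlips]
  · refine mul_le_mul_of_nonneg_left ?_ (sq_nonneg _)
    exact Finset.prod_le_prod
      (fun j _ => div_nonneg (Finset.sum_nonneg fun x _ => sq_nonneg _) (by positivity))
      fun j _ => mean_sq_boundaryDiff_le (hA j).1 (hA j).2 (hk j)

end

section

variable {d K : ℕ}

/-! ### Scrambled digits -/

/-- The digit number `k` of the coordinate `j` after the scrambling `π`. -/
def scrambledDigit (π : Fin d → List (ZMod 2) → Bool) (c : Fin d → ℕ → ZMod 2) (j : Fin d)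
    (k : ℕ) : ZMod 2 :=
  c j k + if π j ((List.range k).map (c j)) then 1 else 0

/-- The first `K` digits of all coordinates after the scrambling `π`. -/
def scrambledPrefix (K : ℕ) (π : Fin d → List (ZMod 2) → Bool) (c : Fin d → ℕ → ZMod 2) :
    Fin d → Fin K → ZMod 2 :=
  fun j i => scrambledDigit π c j i

theorem map_range_eq_iff (c c' : ℕ → ZMod 2) (k : ℕ) :
    (List.range k).map c = (List.range k).map c' ↔ ∀ i < k, c i = c' i := by
  rw [List.map_inj_left]
  simp

/-- The permutation of the digit number `l` is determined by the preceding digits, so two points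
that agree before `l` undergo the same shift there. -/
theorem scrambledDigit_eq_add (π : Fin d → List (ZMod 2) → Bool) {c c' : Fin d → ℕ → ZMod 2}
    {j : Fin d} {l : ℕ} (h : ∀ i < l, c j i = c' j i) :
    scrambledDigit π c' j l = scrambledDigit π c j l + (c' j l - c j l) := by
  unfold scrambledDigit
  rw [(map_range_eq_iff _ _ _).2 h]
  ring

/-- Scrambling is injective on leading digits. -/
theorem eq_of_scrambledDigit_eq (π : Fin d → List (ZMod 2) → Bool) {c c' : Fin d → ℕ → ZMod 2}
    {j : Fin d} {k : ℕ} (h : ∀ i < k, scrambledDigit π c j i = scrambledDigit π c' j i) :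
    ∀ i < k, c j i = c' j i := by
  intro i
  induction i using Nat.strong_induction_on with
  | _ i ih =>
    intro hi
    have h1 := h i hi
    rw [scrambledDigit_eq_add π fun l hl => ih l hl (hl.trans hi)] at h1
    exact (sub_eq_zero.1 (left_eq_add.1 h1)).symm

/-- The composition of all the permutations of `π` with the swaps marked by `s`. -/
def flipScrambling (s π : Fin d → List (ZMod 2) → Bool) : Fin d → List (ZMod 2) → Bool :=
  fun j w => xor (π j w) (s j w)

theorem scrambledDigit_flip (s π : Fin d → List (ZMod 2) → Bool) (c : Fin d → ℕ → ZMod 2)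
    (j : Fin d) (k : ℕ) :
    scrambledDigit (flipScrambling s π) c j k =
      scrambledDigit π c j k + if s j ((List.range k).map (c j)) then 1 else 0 := by
  unfold scrambledDigit flipScrambling
  have h : (1 + 1 : ZMod 2) = 0 := rfl
  cases π j ((List.range k).map (c j)) <;> cases s j ((List.range k).map (c j)) <;>
    simp [add_assoc, h]

section Sobol

variable (T : SobolData d) (F : (Fin d → Fin K → ZMod 2) → ℝ)

/-- The points of a dyadic block integrate the Haar components of low level exactly. -/
theorem sum_block_haarComp_eq_zero (k : Fin d → ℕ) (hk : ∀ j, k j ≤ K) (hk0 : k ≠ 0) (m a : ℕ)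
    (hm : ∑ j, k j + T.quality ≤ m) (π : Fin d → List (ZMod 2) → Bool) :
    ∑ i ∈ Finset.range (2 ^ m),
      haarComp F k (scrambledPrefix K π (T.digit (2 ^ m * a + i))) = 0 := by
  obtain ⟨j, hj⟩ := Function.ne_iff.1 hk0
  obtain ⟨l, hl⟩ : ∃ l, k j = l + 1 := Nat.exists_eq_succ_of_ne_zero hj
  -- Among the relevant digits, translation by `δ` flips only the last one of coordinate `j`, and
  -- scrambling preserves this. The component changes sign while the block is merely permuted, so
  -- the sum equals its own negative.
  obtain ⟨δ, hδ, hdig⟩ := T.exists_digit_eq k m hm fun j' i => if j' = j ∧ i = l then 1 else 0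
  have hflip : ∀ i ∈ Finset.range (2 ^ m),
      haarComp F k (scrambledPrefix K π (T.digit (2 ^ m * a + (i ^^^ δ)))) =
        -haarComp F k (scrambledPrefix K π (T.digit (2 ^ m * a + i))) := by
    intro i hi
    rw [Finset.mem_range] at hi
    have hlK : l < K := by have := hk j; omega
    rw [← haarComp_flip F k j l hl hlK]
    refine haarComp_congr F k _ _ fun j' i' hi' => ?_
    have hd : ∀ i'' < k j', T.digit (2 ^ m * a + (i ^^^ δ)) j' i'' =
        T.digit (2 ^ m * a + i) j' i'' + if j' = j ∧ i'' = l then 1 else 0 := by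
      intro i'' hi''
      rw [two_pow_mul_add_xor m a i δ hi hδ, T.digit_xor, hdig j' i'' hi'']
    simp only [scrambledPrefix, Pi.add_apply]
    rw [scrambledDigit_eq_add π (c := T.digit (2 ^ m * a + i)) (l := i'.val)
      (c' := T.digit (2 ^ m * a + (i ^^^ δ)))]
    · rw [hd i' hi']
      by_cases hjj : j' = j
      · subst hjj
        simp [unitDigit]
      · simp [hjj]
    · intro i'' hi''
      rw [hd i'' (hi''.trans hi'), if_neg, add_zero]
      rintro ⟨rfl, rfl⟩
      omega
  have h2 : ∑ i ∈ Finset.range (2 ^ m),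
      haarComp F k (scrambledPrefix K π (T.digit (2 ^ m * a + (i ^^^ δ)))) =
      ∑ i ∈ Finset.range (2 ^ m),
        haarComp F k (scrambledPrefix K π (T.digit (2 ^ m * a + i))) := by
    refine Finset.sum_bij' (fun i _ => i ^^^ δ) (fun i _ => i ^^^ δ) ?_ ?_ ?_ ?_ ?_
    · exact fun i hi => Finset.mem_range.2 (Nat.xor_lt_two_pow (Finset.mem_range.1 hi) hδ)
    · exact fun i hi => Finset.mem_range.2 (Nat.xor_lt_two_pow (Finset.mem_range.1 hi) hδ)
    · intro i _; simp
    · intro i _; simp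
    · intro i _; rfl
  rw [Finset.sum_congr rfl hflip, Finset.sum_neg_distrib] at h2
  linarith

end Sobol

/-! ### Random scramblings -/

theorem measurable_scrambledPrefix {β : Type*} [MeasurableSpace β] (c : Fin d → ℕ → ZMod 2)
    (G : (Fin d → Fin K → ZMod 2) → β) :
    Measurable fun σ : Fin d × List (ZMod 2) → Bool =>
      G (scrambledPrefix K (fun j w => σ (j, w)) c) := by
  have : DiscreteMeasurableSpace (ZMod 2) := ⟨fun _ => trivial⟩
  refine (measurable_of_countable G).comp ?_
  refine measurable_pi_iff.2 fun j => measurable_pi_iff.2 fun i => ?_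
  exact (measurable_of_countable fun b : Bool => c j i + if b then 1 else 0).comp
    (measurable_pi_apply (j, (List.range i).map (c j)))

variable {Ω : Type*} [MeasurableSpace Ω] {μ : Measure Ω}
  {π : Ω → Fin d → List (ZMod 2) → Bool}

theorem IsOwenScrambling.measurable_uncurry (hπ : IsOwenScrambling μ π) :
    Measurable fun ω (p : Fin d × List (ZMod 2)) => π ω p.1 p.2 :=
  measurable_pi_iff.2 fun p => hπ.measurable p.1 p.2

theorem IsOwenScrambling.measurable_comp (hπ : IsOwenScrambling μ π) {β : Type*}
    [MeasurableSpace β] (c : Fin d → ℕ → ZMod 2) (G : (Fin d → Fin K → ZMod 2) → β) :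
    Measurable fun ω => G (scrambledPrefix K (π ω) c) :=
  (measurable_scrambledPrefix c G).comp hπ.measurable_uncurry

variable [IsProbabilityMeasure μ]

theorem measure_bool_ext {ν ν' : Measure Bool} [IsProbabilityMeasure ν] [IsProbabilityMeasure ν']
    (h : ν {true} = ν' {true}) : ν = ν' := by
  have hf : ∀ ρ : Measure Bool, IsProbabilityMeasure ρ → ρ {false} = 1 - ρ {true} := by
    intro ρ _
    rw [← prob_compl_eq_one_sub (measurableSet_singleton _)]
    congr 1; ext b; cases b <;> simp
  refine Measure.ext_of_singleton fun b => ?_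
  cases b
  · rw [hf ν inferInstance, hf ν' inferInstance, h]
  · exact h

/-- The law of a uniform scrambling is invariant under flips of permutations. -/
theorem IsOwenScrambling.map_flip_eq (hπ : IsOwenScrambling μ π)
    (s : Fin d → List (ZMod 2) → Bool) :
    μ.map (fun ω (p : Fin d × List (ZMod 2)) => flipScrambling s (π ω) p.1 p.2) =
      μ.map fun ω (p : Fin d × List (ZMod 2)) => π ω p.1 p.2 := by
  have hm : ∀ p : Fin d × List (ZMod 2), Measurable fun ω => π ω p.1 p.2 :=
    fun p => hπ.measurable p.1 p.2
  have hx : ∀ b : Bool, Measurable fun a : Bool => xor a b := fun b => measurable_of_countable _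
  have hind : iIndepFun (fun (p : Fin d × List (ZMod 2)) ω => flipScrambling s (π ω) p.1 p.2) μ :=
    hπ.indep.comp (fun p a => xor a (s p.1 p.2)) fun p => hx _
  have hm' : ∀ p : Fin d × List (ZMod 2), Measurable fun ω => flipScrambling s (π ω) p.1 p.2 :=
    fun p => (hx _).comp (hm p)
  rw [(iIndepFun_iff_map_fun_eq_infinitePi_map hm').1 hind,
    (iIndepFun_iff_map_fun_eq_infinitePi_map hm).1 hπ.indep]
  congr 1
  funext p
  have := Measure.isProbabilityMeasure_map (μ := μ) (hm p).aemeasurable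
  have := Measure.isProbabilityMeasure_map (μ := μ) (hm' p).aemeasurable
  refine measure_bool_ext ?_
  rw [Measure.map_apply (hm' p) (measurableSet_singleton _),
    Measure.map_apply (hm p) (measurableSet_singleton _)]
  have hu := hπ.uniform p.1 p.2
  have e1 : (fun ω => π ω p.1 p.2) ⁻¹' {true} = {ω | π ω p.1 p.2 = true} := rfl
  rw [e1, hu]
  cases hs : s p.1 p.2
  · rw [← hu]; congr 1; ext ω; simp [flipScrambling, hs]
  · have e2 : (fun ω => flipScrambling s (π ω) p.1 p.2) ⁻¹' {true} =
        {ω | π ω p.1 p.2 = true}ᶜ := by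
      ext ω; simp [flipScrambling, hs]
    rw [e2, ← e1, prob_compl_eq_one_sub ((hm p) (measurableSet_singleton true)), e1, hu]
    simp

theorem IsOwenScrambling.integral_flip (hπ : IsOwenScrambling μ π)
    (s : Fin d → List (ZMod 2) → Bool) (H : (Fin d → List (ZMod 2) → Bool) → ℝ)
    (hH : Measurable fun σ : Fin d × List (ZMod 2) → Bool => H fun j w => σ (j, w)) :
    ∫ ω, H (flipScrambling s (π ω)) ∂μ = ∫ ω, H (π ω) ∂μ := by
  have hx : ∀ b : Bool, Measurable fun a : Bool => xor a b := fun b => measurable_of_countable _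
  have hm' : Measurable fun ω (p : Fin d × List (ZMod 2)) => flipScrambling s (π ω) p.1 p.2 :=
    measurable_pi_iff.2 fun p => (hx _).comp (hπ.measurable p.1 p.2)
  have h1 := integral_map (μ := μ) hm'.aemeasurable
    (f := fun σ : Fin d × List (ZMod 2) → Bool => H fun j w => σ (j, w)) hH.aestronglyMeasurable
  have h2 := integral_map (μ := μ) hπ.measurable_uncurry.aemeasurable
    (f := fun σ : Fin d × List (ZMod 2) → Bool => H fun j w => σ (j, w)) hH.aestronglyMeasurable
  rw [hπ.map_flip_eq s] at h1
  exact h1.symm.trans h2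

theorem IsOwenScrambling.memLp_comp (hπ : IsOwenScrambling μ π) (c : Fin d → ℕ → ZMod 2)
    (G : (Fin d → Fin K → ZMod 2) → ℝ) (p : ENNReal) :
    MemLp (fun ω => G (scrambledPrefix K (π ω) c)) p μ := by
  refine MemLp.of_bound (hπ.measurable_comp c G).aestronglyMeasurable (∑ x, |G x|)
    (ae_of_all _ fun ω => ?_)
  exact Finset.single_le_sum (f := fun x => |G x|) (fun _ _ => abs_nonneg _) (Finset.mem_univ _)

/-- The leading digits of a scrambled point are uniformly distributed. -/
theorem IsOwenScrambling.integral_comp (hπ : IsOwenScrambling μ π) (c : Fin d → ℕ → ZMod 2)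
    (G : (Fin d → Fin K → ZMod 2) → ℝ) :
    ∫ ω, G (scrambledPrefix K (π ω) c) ∂μ = (∑ x, G x) / (2 ^ K) ^ d := by
  have h1 : ∀ g : Fin d → Fin K → ZMod 2,
      ∫ ω, G (scrambledPrefix K (π ω) c + g) ∂μ = ∫ ω, G (scrambledPrefix K (π ω) c) ∂μ := by
    intro g
    -- Flipping every permutation at depth `i` according to `g j i` adds `g` to the scrambled
    -- prefix, whatever the preceding digits are.
    rw [← hπ.integral_flip (fun j w => if h : w.length < K then g j ⟨w.length, h⟩ = 1 else false)
      (fun π => G (scrambledPrefix K π c)) (measurable_scrambledPrefix c G)]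
    refine integral_congr_ae (ae_of_all _ fun ω => ?_)
    simp only
    congr 1
    funext j i
    simp only [scrambledPrefix, scrambledDigit_flip, Pi.add_apply]
    congr 1
    have : ∀ b : ZMod 2, b = 0 ∨ b = 1 := by decide
    rcases this (g j i) with h | h <;> simp [h]
  have h2 : ∑ g : Fin d → Fin K → ZMod 2, ∫ ω, G (scrambledPrefix K (π ω) c + g) ∂μ =
      ∑ x, G x := by
    rw [← integral_finsetSum _ fun g _ =>
      (hπ.memLp_comp c (fun x => G (x + g)) 1).integrable le_rfl]
    have : ∀ x : Fin d → Fin K → ZMod 2, ∑ g, G (x + g) = ∑ x, G x :=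
      fun x => Equiv.sum_comp (Equiv.addLeft x) G
    simp [this]
  rw [← h2, Finset.sum_congr rfl fun g _ => h1 g]
  simp

/-- Haar components at two scrambled points are uncorrelated if the points differ before the
last relevant digit of some coordinate. -/
theorem IsOwenScrambling.integral_haarComp_mul_eq_zero (hπ : IsOwenScrambling μ π)
    (F : (Fin d → Fin K → ZMod 2) → ℝ) (k : Fin d → ℕ) (hk : ∀ j, k j ≤ K)
    (c c' : Fin d → ℕ → ZMod 2) (j : Fin d) (i : ℕ) (hi : i < k j - 1) (hc : c j i ≠ c' j i) :
    ∫ ω, haarComp F k (scrambledPrefix K (π ω) c) * haarComp F k (scrambledPrefix K (π ω) c') ∂μ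
      = 0 := by
  have hkj := hk j
  -- The permutation at the node `w` acts on the last relevant digit of `c'`. The point `c` has left
  -- this branch earlier, so flipping the permutation negates the second factor and leaves the first
  -- unchanged.
  set w := (List.range (k j - 1)).map (c' j) with hw
  have h1 := hπ.integral_flip (fun j' w' => decide (j' = j ∧ w' = w))
    (fun π => haarComp F k (scrambledPrefix K π c) * haarComp F k (scrambledPrefix K π c'))
    ((measurable_scrambledPrefix c (haarComp F k)).mul
      (measurable_scrambledPrefix c' (haarComp F k)))
  have h2 : ∀ π : Fin d → List (ZMod 2) → Bool,
      scrambledPrefix K (flipScrambling (fun j' w' => decide (j' = j ∧ w' = w)) π) c =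
        scrambledPrefix K π c := by
    intro π
    funext j' i'
    simp only [scrambledPrefix, scrambledDigit_flip]
    rw [if_neg, add_zero]
    rw [decide_eq_true_iff]
    rintro ⟨rfl, hww⟩
    have hlen : i'.val = k j' - 1 := by simpa [hw] using congrArg List.length hww
    rw [hw, hlen, map_range_eq_iff] at hww
    exact hc (hww i hi)
  have h3 : ∀ π : Fin d → List (ZMod 2) → Bool,
      scrambledPrefix K (flipScrambling (fun j' w' => decide (j' = j ∧ w' = w)) π) c' =
        scrambledPrefix K π c' + Pi.single j (unitDigit K (k j - 1)) := by
    intro π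
    funext j' i'
    simp only [scrambledPrefix, scrambledDigit_flip, Pi.add_apply]
    congr 1
    by_cases hj : j' = j
    · subst hj
      rw [Pi.single_eq_same, unitDigit]
      refine if_congr ?_ rfl rfl
      rw [decide_eq_true_iff]
      constructor
      · rintro ⟨-, hww⟩; simpa [hw] using congrArg List.length hww
      · intro h; exact ⟨rfl, by rw [h]⟩
    · simp [hj]
  simp only [h2, h3, haarComp_flip F k j (k j - 1) (by omega) (by omega), mul_neg,
    integral_neg] at h1
  linarith

/-- The second moment of the sum of a Haar component over a dyadic block. -/
theorem IsOwenScrambling.integral_sq_sum_block_le (hπ : IsOwenScrambling μ π) (T : SobolData d)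
    (F : (Fin d → Fin K → ZMod 2) → ℝ) (k : Fin d → ℕ) (hk : ∀ j, k j ≤ K) (m a : ℕ)
    (hm : m < ∑ j, k j + T.quality) :
    ∫ ω, (∑ i ∈ Finset.range (2 ^ m),
      haarComp F k (scrambledPrefix K (π ω) (T.digit (2 ^ m * a + i)))) ^ 2 ∂μ ≤
      2 ^ m * 2 ^ (T.quality + d) * ((∑ c, haarComp F k c ^ 2) / (2 ^ K) ^ d) := by
  set X : ℕ → Ω → ℝ := fun i ω =>
    haarComp F k (scrambledPrefix K (π ω) (T.digit (2 ^ m * a + i))) with hX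
  set σ := (∑ c, haarComp F k c ^ 2) / (2 ^ K) ^ d with hσ
  have hσ0 : 0 ≤ σ := div_nonneg (Finset.sum_nonneg fun _ _ => sq_nonneg _) (by positivity)
  have hL : ∀ i, MemLp (X i) 2 μ := fun i => hπ.memLp_comp _ _ 2
  have hint : ∀ i i', Integrable (fun ω => X i ω * X i' ω) μ := fun i i' =>
    (hL i).integrable_mul (hL i')
  have hsq : ∀ i, ∫ ω, X i ω ^ 2 ∂μ = σ := fun i =>
    hπ.integral_comp _ (fun c => haarComp F k c ^ 2)
  have hcov : ∀ i i', ∫ ω, X i ω * X i' ω ∂μ ≤ σ := by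
    intro i i'
    have h1 : ∫ ω, X i ω * X i' ω ∂μ ≤ ∫ ω, (X i ω ^ 2 + X i' ω ^ 2) / 2 ∂μ := by
      refine integral_mono (hint i i') (((hL i).integrable_sq.add (hL i').integrable_sq).div_const 2)
        fun ω => ?_
      simp only
      nlinarith [sq_nonneg (X i ω - X i' ω)]
    rw [integral_div, integral_add (hL i).integrable_sq (hL i').integrable_sq, hsq, hsq] at h1
    linarith
  calc ∫ ω, (∑ i ∈ Finset.range (2 ^ m), X i ω) ^ 2 ∂μ
      = ∑ i ∈ Finset.range (2 ^ m), ∑ i' ∈ Finset.range (2 ^ m), ∫ ω, X i ω * X i' ω ∂μ := by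
        simp_rw [sq, Finset.sum_mul_sum]
        rw [integral_finsetSum _ fun i _ => integrable_finsetSum _ fun i' _ => hint i i']
        exact Finset.sum_congr rfl fun i _ => integral_finsetSum _ fun i' _ => hint i i'
    -- For fixed `i` only the partners sharing the first `k j - 1` digits of each coordinate
    -- contribute. They number at most `2 ^ (quality + d)`, and each product has expectation at most
    -- `σ`.
    _ ≤ ∑ i ∈ Finset.range (2 ^ m), 2 ^ (T.quality + d) * σ := by
        refine Finset.sum_le_sum fun i _ => ?_
        rw [← Finset.sum_filter_add_sum_filter_not _ (fun i' => ∀ j, ∀ l < k j - 1,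
          T.digit (2 ^ m * a + i') j l = T.digit (2 ^ m * a + i) j l)]
        rw [Finset.sum_eq_zero (s := Finset.filter (fun i' => ¬ _) _), add_zero]
        · refine (Finset.sum_le_card_nsmul _ _ σ fun i' _ => hcov i i').trans ?_
          rw [nsmul_eq_mul]
          refine mul_le_mul_of_nonneg_right ?_ hσ0
          exact_mod_cast T.card_block_le_of_lt k m a hm (T.digit (2 ^ m * a + i))
        · intro i' hi'
          have h := (Finset.mem_filter.1 hi').2
          push Not at h
          obtain ⟨j, l, hl, hne⟩ := h
          exact hπ.integral_haarComp_mul_eq_zero F k hk _ _ j l hl hne.symm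
    _ = _ := by
        rw [Finset.sum_const, Finset.card_range, nsmul_eq_mul]; push_cast; ring

end

section

variable {d K : ℕ}

/-! ### Decomposition of an initial segment into dyadic blocks -/

/-- This follows the binary expansion of `N`. If the bit of weight `2 ^ s` is set, a full block is
split off and the rest starts at the block `2 * c + 1`; otherwise it stays in the half `2 * c`. Each
size occurs at most once, and all starts are aligned, as the digital structure requires. -/
theorem exists_dyadic_blocks_of_lt (s N c : ℕ) (hN : N < 2 ^ s) :
    ∃ S ⊆ Finset.range s, ∃ a : ℕ → ℕ, ∀ F : ℕ → ℝ,
      ∑ n ∈ Finset.range N, F (2 ^ s * c + n) =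
        ∑ m ∈ S, ∑ i ∈ Finset.range (2 ^ m), F (2 ^ m * a m + i) := by
  induction s generalizing N c with
  | zero => exact ⟨∅, by simp, 0, fun F => by simp [show N = 0 by simpa using hN]⟩
  | succ s ih =>
    by_cases h : N < 2 ^ s
    · obtain ⟨S, hS, a, ha⟩ := ih N (2 * c) h
      refine ⟨S, hS.trans (Finset.range_mono (Nat.le_succ s)), a, fun F => ?_⟩
      rw [← ha, pow_succ, mul_assoc]
    · rw [not_lt] at h
      obtain ⟨N', rfl⟩ := Nat.exists_eq_add_of_le h
      obtain ⟨S, hS, a, ha⟩ := ih N' (2 * c + 1) (by rw [pow_succ] at hN; omega)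
      have hs : s ∉ S := fun h => by simpa using hS h
      refine ⟨insert s S, ?_, Function.update a s (2 * c), fun F => ?_⟩
      · rw [Finset.insert_subset_iff]
        exact ⟨by simp, hS.trans (Finset.range_mono (Nat.le_succ s))⟩
      · rw [Finset.sum_insert hs, Finset.sum_range_add, Function.update_self]
        congr 1
        · rw [pow_succ, mul_assoc]
        · rw [Finset.sum_congr rfl (s₁ := S)
            (g := fun m => ∑ i ∈ Finset.range (2 ^ m), F (2 ^ m * a m + i)), ← ha]
          swap
          · intro m hm
            have hms : m ≠ s := by rintro rfl; exact hs hm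
            rw [Function.update_of_ne hms]
          refine Finset.sum_congr rfl fun n _ => ?_
          congr 1
          ring

theorem exists_dyadic_blocks (N : ℕ) :
    ∃ S ⊆ Finset.range N.size, ∃ a : ℕ → ℕ, ∀ F : ℕ → ℝ,
      ∑ n ∈ Finset.range N, F n =
        ∑ m ∈ S, ∑ i ∈ Finset.range (2 ^ m), F (2 ^ m * a m + i) := by
  obtain ⟨S, hS, a, ha⟩ := exists_dyadic_blocks_of_lt N.size N 0 (Nat.lt_size_self N)
  exact ⟨S, hS, a, fun F => by simpa using ha F⟩

/-- The factor in the bound of the number of binary digits by a power. -/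
noncomputable def sizeConst (θ : ℝ) : ℝ := 1 + 1 / ((2 : ℝ) ^ θ - 1)

theorem one_lt_two_rpow {θ : ℝ} (hθ : 0 < θ) : 1 < (2 : ℝ) ^ θ :=
  Real.one_lt_rpow (by norm_num) hθ

theorem sizeConst_pos {θ : ℝ} (hθ : 0 < θ) : 0 < sizeConst θ := by
  have := sub_pos.2 (one_lt_two_rpow hθ)
  unfold sizeConst; positivity

/-- Bernoulli's inequality bounds `(2 ^ θ) ^ s` below linearly in `s`, while `2 ^ s ≤ N`. The
logarithmic number of blocks thus costs only a small power of `N`. -/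
theorem size_le_sizeConst_mul {θ : ℝ} (hθ : 0 < θ) {N : ℕ} (hN : 1 ≤ N) :
    (N.size : ℝ) ≤ sizeConst θ * (N : ℝ) ^ θ := by
  have h2 := one_lt_two_rpow hθ
  have hs : 0 < N.size := Nat.size_pos.2 hN
  obtain ⟨s, hs⟩ : ∃ s, N.size = s + 1 := Nat.exists_eq_succ_of_ne_zero hs.ne'
  have hle : 2 ^ s ≤ N := Nat.lt_size.1 (by omega)
  have e1 : ((2 : ℝ) ^ θ) ^ s ≤ (N : ℝ) ^ θ := by
    rw [← Real.rpow_natCast, ← Real.rpow_mul (by norm_num), mul_comm, Real.rpow_mul (by norm_num),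
      Real.rpow_natCast]
    exact Real.rpow_le_rpow (by positivity) (by exact_mod_cast hle) hθ.le
  have e2 := one_add_mul_le_pow (a := (2 : ℝ) ^ θ - 1) (by linarith) s
  rw [add_sub_cancel] at e2
  have e3 : (1 : ℝ) ≤ (N : ℝ) ^ θ := Real.one_le_rpow (by exact_mod_cast hN) hθ.le
  have e4 : (s : ℝ) ≤ (N : ℝ) ^ θ / ((2 : ℝ) ^ θ - 1) := by
    rw [le_div_iff₀ (by linarith)]; linarith
  rw [hs]; push_cast
  unfold sizeConst
  rw [add_mul, one_mul, one_div, inv_mul_eq_div]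
  linarith

/-! ### Square norms -/

section L2

variable {Ω : Type*} [MeasurableSpace Ω] {μ : Measure Ω}

theorem eLpNorm_two_sq_eq {X : Ω → ℝ} (hX : MemLp X 2 μ) :
    eLpNorm X 2 μ = ENNReal.ofReal (√(∫ ω, X ω ^ 2 ∂μ)) := by
  rw [hX.eLpNorm_eq_integral_rpow_norm (by norm_num) (by norm_num), Real.sqrt_eq_rpow]
  simp

theorem eLpNorm_two_le {X : Ω → ℝ} (hX : MemLp X 2 μ) {r : ℝ} (hr : 0 ≤ r)
    (h : ∫ ω, X ω ^ 2 ∂μ ≤ r ^ 2) : eLpNorm X 2 μ ≤ ENNReal.ofReal r := by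
  rw [eLpNorm_two_sq_eq hX]
  exact ENNReal.ofReal_le_ofReal ((Real.sqrt_le_left hr).2 h)

theorem integral_sq_le_of_eLpNorm_le {X : Ω → ℝ} (hX : MemLp X 2 μ) {r : ℝ} (hr : 0 ≤ r)
    (h : eLpNorm X 2 μ ≤ ENNReal.ofReal r) : ∫ ω, X ω ^ 2 ∂μ ≤ r ^ 2 := by
  rw [eLpNorm_two_sq_eq hX, ENNReal.ofReal_le_ofReal_iff hr] at h
  exact (Real.sqrt_le_left hr).1 h

end L2

/-! ### The mean square error for functions of finitely many digits -/

/-- The sum over an initial segment of the points minus its mean, in terms of Haar components. -/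
theorem sum_sub_mean_eq (F : (Fin d → Fin K → ZMod 2) → ℝ) {N : ℕ} {S : Finset ℕ} {a : ℕ → ℕ}
    (ha : ∀ F : ℕ → ℝ, ∑ n ∈ Finset.range N, F n =
      ∑ m ∈ S, ∑ i ∈ Finset.range (2 ^ m), F (2 ^ m * a m + i))
    (C : ℕ → Fin d → Fin K → ZMod 2) :
    ∑ n ∈ Finset.range N, F (C n) - N * ((∑ g, F g) / (2 ^ K) ^ d) =
      ∑ m ∈ S, ∑ k ∈ (Fintype.piFinset fun _ : Fin d => Finset.range (K + 1)).erase 0,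
        ∑ i ∈ Finset.range (2 ^ m), haarComp F k (C (2 ^ m * a m + i)) := by
  have h0 : (0 : Fin d → ℕ) ∈ Fintype.piFinset fun _ : Fin d => Finset.range (K + 1) := by
    simp [Fintype.mem_piFinset]
  have h1 : ∀ c, F c - (∑ g, F g) / (2 ^ K) ^ d =
      ∑ k ∈ (Fintype.piFinset fun _ : Fin d => Finset.range (K + 1)).erase 0, haarComp F k c := by
    intro c
    rw [← haarComp_zero F c, sub_eq_iff_eq_add',
      Finset.add_sum_erase _ (fun k => haarComp F k c) h0, sum_haarComp]
  calc ∑ n ∈ Finset.range N, F (C n) - N * ((∑ g, F g) / (2 ^ K) ^ d)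
      = ∑ n ∈ Finset.range N, (F (C n) - (∑ g, F g) / (2 ^ K) ^ d) := by
        rw [Finset.sum_sub_distrib]; simp
    _ = _ := by
        rw [ha]
        refine Finset.sum_congr rfl fun m _ => ?_
        simp_rw [h1]
        rw [Finset.sum_comm]

theorem sum_prod_rpow_neg_le {δ : ℝ} (hδ : 0 < δ) :
    ∑ k ∈ Fintype.piFinset fun _ : Fin d => Finset.range (K + 1),
      ∏ j, (2 : ℝ) ^ (-(δ * k j)) ≤ ((1 - (2 : ℝ) ^ (-δ))⁻¹) ^ d := by
  rw [← Finset.prod_univ_sum (fun _ => Finset.range (K + 1))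
    (fun (_ : Fin d) (k : ℕ) => (2 : ℝ) ^ (-(δ * k)))]
  rw [Finset.prod_const, Finset.card_univ, Fintype.card_fin]
  refine pow_le_pow_left₀ (Finset.sum_nonneg fun _ _ => by positivity) ?_ d
  have h1 : (2 : ℝ) ^ (-δ) < 1 := Real.rpow_lt_one_of_one_lt_of_neg (by norm_num) (by linarith)
  rw [← tsum_geometric_of_lt_one (by positivity) h1]
  have h2 : ∀ k : ℕ, (2 : ℝ) ^ (-(δ * k)) = ((2 : ℝ) ^ (-δ)) ^ k := fun k => by
    rw [← Real.rpow_natCast, ← Real.rpow_mul (by norm_num)]; congr 1; ring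
  simp_rw [h2]
  exact (summable_geometric_of_lt_one (by positivity) h1).sum_le_tsum _ fun _ _ => by positivity

/-- The factor `(1 - 2 ^ (-δ))⁻¹ ^ d` summing up the Haar levels. -/
noncomputable def levelConst (d : ℕ) (δ : ℝ) : ℝ := ((1 - (2 : ℝ) ^ (-δ))⁻¹) ^ d

theorem one_le_levelConst {δ : ℝ} (hδ : 0 < δ) : 1 ≤ levelConst d δ := by
  have h1 : (2 : ℝ) ^ (-δ) < 1 := Real.rpow_lt_one_of_one_lt_of_neg (by norm_num) (by linarith)
  have h2 : 0 < (2 : ℝ) ^ (-δ) := by positivity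
  exact one_le_pow₀ ((one_le_inv₀ (by linarith)).2 (by linarith))

/-- This separates the variables: the cost of summing the levels becomes a factor depending on the
exponents, which goes into `growthConst`, times one depending on `ε`, which goes into
`sequenceConst`. -/
theorem levelConst_min_le {δ δ' : ℝ} (hδ : 0 < δ) (hδ' : 0 < δ') :
    levelConst d (min δ δ') ≤ levelConst d δ * levelConst d δ' := by
  have h1 := one_le_levelConst (d := d) hδ
  have h2 := one_le_levelConst (d := d) hδ'
  rcases min_choice δ δ' with h | h <;> rw [h] <;> nlinarith

/-- The part of the error constant that depends on the exponents of the boundary growth. -/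
noncomputable def growthConst (A : Fin d → ℝ) : ℝ :=
  (∏ j, √(boundaryConst (A j))) * levelConst d (1 / 2 - ⨆ i, A i)

/-- The part of the error constant that depends on the quality of the sequence. -/
noncomputable def sequenceConst (d t : ℕ) (ε : ℝ) : ℝ :=
  2 ^ (2 * t + d) * sizeConst (ε / 2) * levelConst d (ε / 2)

theorem sequenceConst_pos {t : ℕ} {ε : ℝ} (hε : 0 < ε) : 0 < sequenceConst d t ε := by
  have := sizeConst_pos (half_pos hε)
  have := zero_lt_one.trans_le (one_le_levelConst (d := d) (half_pos hε))
  unfold sequenceConst; positivity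

theorem iSup_lt_half (hd : 0 < d) {A : Fin d → ℝ} (hA : ∀ i, 0 < A i ∧ A i < 1 / 2) :
    (⨆ i, A i) < 1 / 2 ∧ 0 < ⨆ i, A i := by
  have : Nonempty (Fin d) := ⟨⟨0, hd⟩⟩
  obtain ⟨i, hi⟩ := exists_eq_ciSup_of_finite (f := A)
  rw [← hi]
  exact ⟨(hA i).2, (hA i).1⟩

theorem growthConst_pos (hd : 0 < d) {A : Fin d → ℝ} (hA : ∀ i, 0 < A i ∧ A i < 1 / 2) :
    0 < growthConst A := by
  have h1 := iSup_lt_half hd hA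
  have := zero_lt_one.trans_le (one_le_levelConst (d := d) (sub_pos.2 h1.1))
  have h2 : 0 < ∏ j, √(boundaryConst (A j)) :=
    Finset.prod_pos fun j _ => Real.sqrt_pos.2 (boundaryConst_pos (hA j).1 (hA j).2)
  unfold growthConst; positivity

section Error

variable {Ω : Type*} [MeasurableSpace Ω] {μ : Measure Ω} [IsProbabilityMeasure μ]
  {π : Ω → Fin d → List (ZMod 2) → Bool}

/-- Low levels contribute nothing. At the others `m < |k| + t`, so part of the decay in `|k|` can be
traded against `2 ^ m`: this leaves growth `2 ^ (m (A_max + δ))` and keeps a factor `2 ^ (-δ |k|)`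
for the sum over the levels. -/
theorem IsOwenScrambling.eLpNorm_block_le (hπ : IsOwenScrambling μ π) (hd : 0 < d)
    (T : SobolData d) {φ : (Fin d → ℝ) → ℝ} {b : ℝ} {A : Fin d → ℝ} (hb : 0 ≤ b)
    (hA : ∀ i, 0 < A i ∧ A i < 1 / 2) (h : BoundaryGrowth φ b A) {δ : ℝ} (hδ0 : 0 < δ)
    (hδ : δ ≤ 1 / 2 - ⨆ i, A i) (k : Fin d → ℕ) (hk : ∀ j, k j ≤ K) (hk0 : k ≠ 0) (m a : ℕ) :
    eLpNorm (fun ω => ∑ i ∈ Finset.range (2 ^ m),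
      haarComp (fun c : Fin d → Fin K → ZMod 2 => φ fun j => midpointOf (c j)) k
        (scrambledPrefix K (π ω) (T.digit (2 ^ m * a + i)))) 2 μ ≤
      ENNReal.ofReal (b * 2 ^ (2 * T.quality + d) * (∏ j, √(boundaryConst (A j))) *
        (2 : ℝ) ^ (m * ((⨆ i, A i) + δ)) * ∏ j, (2 : ℝ) ^ (-(δ * k j))) := by
  set F : (Fin d → Fin K → ZMod 2) → ℝ := fun c => φ fun j => midpointOf (c j) with hF
  set t := T.quality
  set a0 := ⨆ i, A i with ha0
  have hL : MemLp (fun ω => ∑ i ∈ Finset.range (2 ^ m), haarComp F k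
      (scrambledPrefix K (π ω) (T.digit (2 ^ m * a + i)))) 2 μ :=
    memLp_finsetSum _ fun i _ => hπ.memLp_comp _ _ 2
  have hprod : 0 ≤ ∏ j, √(boundaryConst (A j)) := Finset.prod_nonneg fun _ _ => Real.sqrt_nonneg _
  by_cases hm : ∑ j, k j + t ≤ m
  · simp_rw [sum_block_haarComp_eq_zero T F k hk hk0 m a hm]
    simp
  · rw [not_le] at hm
    refine eLpNorm_two_le hL (by positivity) ?_
    refine (hπ.integral_sq_sum_block_le T F k hk m a (by omega)).trans ?_
    have h1 := h.mean_sq_haarComp_le hb hA k hk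
    refine (mul_le_mul_of_nonneg_left h1 (by positivity)).trans ?_
    rw [Finset.prod_mul_distrib]
    have e1 : ∏ j, boundaryConst (A j) = (∏ j, √(boundaryConst (A j))) ^ 2 := by
      rw [← Finset.prod_pow]
      exact Finset.prod_congr rfl fun j _ =>
        (Real.sq_sqrt (boundaryConst_pos (hA j).1 (hA j).2).le).symm
    have hs : ∀ c : ℝ, ∏ j, (2 : ℝ) ^ (-(c * k j)) = (2 : ℝ) ^ (-(c * (∑ j, k j : ℕ))) := by
      intro c
      rw [← Real.rpow_sum_of_pos (by norm_num)]
      congr 1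
      push_cast
      rw [Finset.mul_sum, Finset.sum_neg_distrib]
    have e2 : ∏ j, (2 : ℝ) ^ (-((1 - 2 * A j) * k j)) ≤
        (2 : ℝ) ^ (-((1 - 2 * a0) * (∑ j, k j : ℕ))) := by
      rw [← hs]
      refine Finset.prod_le_prod (fun _ _ => by positivity) fun j _ => ?_
      refine Real.rpow_le_rpow_of_exponent_le (by norm_num) ?_
      have : A j ≤ a0 := le_ciSup (Set.finite_range A).bddAbove j
      have : (0 : ℝ) ≤ k j := Nat.cast_nonneg _
      nlinarith
    rw [hs, e1]
    set s : ℝ := ((∑ j, k j : ℕ) : ℝ) with hsdef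
    have hms : (m : ℝ) ≤ s + t := by rw [hsdef]; exact_mod_cast hm.le
    have e3 : (2 : ℝ) ^ (m : ℝ) * (2 : ℝ) ^ ((t : ℝ) + d) * (2 : ℝ) ^ (-((1 - 2 * a0) * s)) ≤
        ((2 : ℝ) ^ (2 * (t : ℝ) + d) * (2 : ℝ) ^ (m * (a0 + δ)) * (2 : ℝ) ^ (-(δ * s))) ^ 2 := by
      rw [← Real.rpow_add (by norm_num), ← Real.rpow_add (by norm_num), ← Real.rpow_add (by norm_num),
        ← Real.rpow_add (by norm_num), ← Real.rpow_natCast, ← Real.rpow_mul (by norm_num)]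
      refine Real.rpow_le_rpow_of_exponent_le (by norm_num) ?_
      push_cast
      have ht0 : (0 : ℝ) ≤ t := Nat.cast_nonneg _
      have hd0 : (0 : ℝ) ≤ d := Nat.cast_nonneg _
      have hpos := (iSup_lt_half hd hA).2
      have h3 : (1 / 2 - a0 - δ) * m ≤ (1 / 2 - a0 - δ) * (s + t) :=
        mul_le_mul_of_nonneg_left hms (by linarith)
      have h4 : (1 / 2 - a0 - δ) * t ≤ 1 * t := mul_le_mul_of_nonneg_right (by linarith) ht0
      linarith
    simp only [Real.rpow_natCast] at e3
    rw [show (2 : ℝ) ^ ((t : ℝ) + d) = 2 ^ (t + d) by exact_mod_cast Real.rpow_natCast 2 (t + d),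
      show (2 : ℝ) ^ (2 * (t : ℝ) + d) = 2 ^ (2 * t + d) by
        exact_mod_cast Real.rpow_natCast 2 (2 * t + d)] at e3
    calc 2 ^ m * 2 ^ (t + d) * (b ^ 2 * ((∏ j, √(boundaryConst (A j))) ^ 2 *
          ∏ j, (2 : ℝ) ^ (-((1 - 2 * A j) * k j))))
        ≤ 2 ^ m * 2 ^ (t + d) * (b ^ 2 * ((∏ j, √(boundaryConst (A j))) ^ 2 *
          (2 : ℝ) ^ (-((1 - 2 * a0) * s)))) := by gcongr
      _ = (b * ∏ j, √(boundaryConst (A j))) ^ 2 *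
          (2 ^ m * 2 ^ (t + d) * (2 : ℝ) ^ (-((1 - 2 * a0) * s))) := by ring
      _ ≤ (b * ∏ j, √(boundaryConst (A j))) ^ 2 * (2 ^ (2 * t + d) * (2 : ℝ) ^ (m * (a0 + δ)) *
          (2 : ℝ) ^ (-(δ * s))) ^ 2 := mul_le_mul_of_nonneg_left e3 (sq_nonneg _)
      _ = _ := by ring

/-- The triangle inequality in `L²` over blocks and nonzero levels. The geometric series over the
levels makes the bound independent of `K`. -/
theorem IsOwenScrambling.eLpNorm_midpoint_error_le (hπ : IsOwenScrambling μ π) (hd : 0 < d)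
    (T : SobolData d) {φ : (Fin d → ℝ) → ℝ} {b : ℝ} {A : Fin d → ℝ} (hb : 0 ≤ b)
    (hA : ∀ i, 0 < A i ∧ A i < 1 / 2) (h : BoundaryGrowth φ b A) {ε : ℝ} (hε : 0 < ε) {N : ℕ}
    (hN : 1 ≤ N) (K : ℕ) :
    eLpNorm (fun ω => ∑ n ∈ Finset.range N,
      φ (fun j => midpointOf (scrambledPrefix K (π ω) (T.digit n) j)) -
        N * ((∑ g : Fin d → Fin K → ZMod 2, φ fun j => midpointOf (g j)) / (2 ^ K) ^ d)) 2 μ ≤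
      ENNReal.ofReal (b * growthConst A * sequenceConst d T.quality ε *
        (N : ℝ) ^ (ε + ⨆ i, A i)) := by
  obtain ⟨S, hS, a, ha⟩ := exists_dyadic_blocks N
  set F : (Fin d → Fin K → ZMod 2) → ℝ := fun c => φ fun j => midpointOf (c j) with hF
  set a0 := ⨆ i, A i with ha0
  obtain ⟨ha1, ha2⟩ := iSup_lt_half hd hA
  set α := 1 / 2 - a0 with hα
  have hα0 : 0 < α := sub_pos.2 ha1
  -- One half of `ε` pays for summing the levels and the other for the number of blocks; `δ ≤ α` is
  -- required by the block estimate.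
  set δ := min (ε / 2) α with hδ
  have hδ0 : 0 < δ := lt_min (half_pos hε) hα0
  have hN1 : (1 : ℝ) ≤ N := by exact_mod_cast hN
  set P := ∏ j, √(boundaryConst (A j)) with hP
  have hP0 : 0 ≤ P := Finset.prod_nonneg fun _ _ => Real.sqrt_nonneg _
  set W := b * 2 ^ (2 * T.quality + d) * P with hW
  have hW0 : 0 ≤ W := by positivity
  have e1 : (fun ω => ∑ n ∈ Finset.range N,
      φ (fun j => midpointOf (scrambledPrefix K (π ω) (T.digit n) j)) -
        N * ((∑ g : Fin d → Fin K → ZMod 2, φ fun j => midpointOf (g j)) / (2 ^ K) ^ d)) =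
      ∑ m ∈ S, ∑ k ∈ (Fintype.piFinset fun _ : Fin d => Finset.range (K + 1)).erase 0,
        fun ω => ∑ i ∈ Finset.range (2 ^ m),
          haarComp F k (scrambledPrefix K (π ω) (T.digit (2 ^ m * a m + i))) := by
    funext ω
    rw [Finset.sum_apply]
    simp_rw [Finset.sum_apply]
    exact sum_sub_mean_eq F ha fun n => scrambledPrefix K (π ω) (T.digit n)
  have hmeas : ∀ m k, AEStronglyMeasurable (fun ω => ∑ i ∈ Finset.range (2 ^ m),
      haarComp F k (scrambledPrefix K (π ω) (T.digit (2 ^ m * a m + i)))) μ := fun m k =>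
    (memLp_finsetSum (p := 2) _ fun i _ => hπ.memLp_comp _ _ 2).aestronglyMeasurable
  have e2 : ∀ m ∈ S, ∀ k ∈ (Fintype.piFinset fun _ : Fin d => Finset.range (K + 1)).erase 0,
      eLpNorm (fun ω => ∑ i ∈ Finset.range (2 ^ m),
        haarComp F k (scrambledPrefix K (π ω) (T.digit (2 ^ m * a m + i)))) 2 μ ≤
      ENNReal.ofReal (W * (N : ℝ) ^ (a0 + ε / 2) * ∏ j, (2 : ℝ) ^ (-(δ * k j))) := by
    intro m hm k hk
    rw [Finset.mem_erase, Fintype.mem_piFinset] at hk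
    refine (hπ.eLpNorm_block_le hd T hb hA h hδ0 (min_le_right _ _) k
      (fun j => Nat.lt_succ_iff.1 (Finset.mem_range.1 (hk.2 j))) hk.1 m (a m)).trans ?_
    refine ENNReal.ofReal_le_ofReal ?_
    have h2 : (2 : ℝ) ^ (m * (a0 + δ)) ≤ (N : ℝ) ^ (a0 + ε / 2) := by
      have h3 : (2 : ℝ) ^ m ≤ N := by
        exact_mod_cast Nat.lt_size.1 (Finset.mem_range.1 (hS hm))
      rw [Real.rpow_mul (by norm_num), Real.rpow_natCast]
      refine (Real.rpow_le_rpow (by positivity) h3 (by linarith)).trans ?_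
      exact Real.rpow_le_rpow_of_exponent_le hN1 (by linarith [min_le_left (ε / 2) α])
    gcongr
  rw [e1]
  refine (eLpNorm_sum_le (fun m _ => Finset.aestronglyMeasurable_sum _ fun k _ => hmeas m k)
    (by norm_num)).trans ?_
  refine (Finset.sum_le_sum fun m hm => (eLpNorm_sum_le (fun k _ => hmeas m k)
    (by norm_num)).trans (Finset.sum_le_sum fun k hk => e2 m hm k hk)).trans ?_
  have e3 : ∑ k ∈ (Fintype.piFinset fun _ : Fin d => Finset.range (K + 1)).erase 0,
      ENNReal.ofReal (W * (N : ℝ) ^ (a0 + ε / 2) * ∏ j, (2 : ℝ) ^ (-(δ * k j))) ≤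
      ENNReal.ofReal (W * (N : ℝ) ^ (a0 + ε / 2) * levelConst d δ) := by
    rw [← ENNReal.ofReal_sum_of_nonneg fun k _ => by positivity]
    refine ENNReal.ofReal_le_ofReal ?_
    rw [← Finset.mul_sum]
    refine mul_le_mul_of_nonneg_left ?_ (by positivity)
    refine (Finset.sum_le_sum_of_subset_of_nonneg (Finset.erase_subset _ _)
      fun _ _ _ => by positivity).trans (sum_prod_rpow_neg_le hδ0)
  have hl0 := zero_le_one.trans (one_le_levelConst (d := d) hδ0)
  calc _ ≤ ∑ m ∈ S, ENNReal.ofReal (W * (N : ℝ) ^ (a0 + ε / 2) * levelConst d δ) :=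
        Finset.sum_le_sum fun m _ => e3
    _ = ENNReal.ofReal (S.card * (W * (N : ℝ) ^ (a0 + ε / 2) * levelConst d δ)) := by
        rw [Finset.sum_const, nsmul_eq_mul, ENNReal.ofReal_mul (p := (S.card : ℝ)) (by positivity),
          ENNReal.ofReal_natCast]
    _ ≤ _ := by
        refine ENNReal.ofReal_le_ofReal ?_
        have h1 : (S.card : ℝ) ≤ sizeConst (ε / 2) * (N : ℝ) ^ (ε / 2) := by
          refine le_trans ?_ (size_le_sizeConst_mul (half_pos hε) hN)
          have := Finset.card_le_card hS
          rw [Finset.card_range] at this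
          exact_mod_cast this
        have h2 := levelConst_min_le (d := d) (half_pos hε) hα0
        have h3 : (N : ℝ) ^ (ε + a0) = (N : ℝ) ^ (ε / 2) * (N : ℝ) ^ (a0 + ε / 2) := by
          rw [← Real.rpow_add (by linarith)]; congr 1; ring
        have h4 := sizeConst_pos (half_pos hε)
        rw [h3]
        calc (S.card : ℝ) * (W * (N : ℝ) ^ (a0 + ε / 2) * levelConst d δ)
            ≤ (sizeConst (ε / 2) * (N : ℝ) ^ (ε / 2)) * (W * (N : ℝ) ^ (a0 + ε / 2) *
              (levelConst d (ε / 2) * levelConst d α)) := by gcongr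
          _ = _ := by rw [growthConst, sequenceConst, hW]; ring

end Error

end

section

variable {d K : ℕ}

/-! ### Binary expansions -/

theorem hasSum_half_pow_succ : HasSum (fun k : ℕ => (1 : ℝ) / 2 ^ (k + 1)) 1 := by
  convert hasSum_geometric_two' (1 : ℝ) using 2 with k
  rw [pow_succ]; field_simp

theorem digit_term_le (c : ℕ → ZMod 2) (k : ℕ) :
    ((c k).val : ℝ) / 2 ^ (k + 1) ≤ 1 / 2 ^ (k + 1) := by
  refine div_le_div_of_nonneg_right ?_ (by positivity)
  rcases zmod_two_val_eq (c k) with h | h <;> rw [h] <;> norm_num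

theorem summable_digits (c : ℕ → ZMod 2) : Summable fun k => ((c k).val : ℝ) / 2 ^ (k + 1) :=
  Summable.of_nonneg_of_le (fun _ => by positivity) (digit_term_le c) hasSum_half_pow_succ.summable

theorem ofDigits_nonneg (c : ℕ → ZMod 2) : 0 ≤ ofDigits c := tsum_nonneg fun _ => by positivity

theorem abs_ofDigits_sub_midpointOf_le (c : ℕ → ZMod 2) (K : ℕ) :
    |ofDigits c - midpointOf (fun i : Fin K => c i)| ≤ 1 / 2 ^ (K + 1) := by
  have h1 : ∑ i ∈ Finset.range K, ((c i).val : ℝ) / 2 ^ (i + 1) +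
      ∑' k, ((c (k + K)).val : ℝ) / 2 ^ (k + K + 1) = ∑' k, ((c k).val : ℝ) / 2 ^ (k + 1) :=
    (summable_digits c).sum_add_tsum_nat_add K
  have h2 : ∑ i ∈ Finset.range K, (1 : ℝ) / 2 ^ (i + 1) + ∑' k, (1 : ℝ) / 2 ^ (k + K + 1) =
      ∑' k, (1 : ℝ) / 2 ^ (k + 1) :=
    hasSum_half_pow_succ.summable.sum_add_tsum_nat_add K
  have h3 : ∑ i ∈ Finset.range K, (1 : ℝ) / 2 ^ (i + 1) = 1 - 1 / 2 ^ K := by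
    clear h1 h2
    induction K with
    | zero => simp
    | succ K ih =>
      rw [Finset.sum_range_succ, ih, pow_succ]
      field_simp; ring
  rw [hasSum_half_pow_succ.tsum_eq, h3] at h2
  have h4 : ∑' k, ((c (k + K)).val : ℝ) / 2 ^ (k + K + 1) ≤ ∑' k, (1 : ℝ) / 2 ^ (k + K + 1) :=
    Summable.tsum_le_tsum (fun k => digit_term_le c (k + K))
      ((summable_nat_add_iff (f := fun k => ((c k).val : ℝ) / 2 ^ (k + 1)) K).2
        (summable_digits c))
      ((summable_nat_add_iff (f := fun k => (1 : ℝ) / 2 ^ (k + 1)) K).2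
        hasSum_half_pow_succ.summable)
  have h5 : 0 ≤ ∑' k, ((c (k + K)).val : ℝ) / 2 ^ (k + K + 1) := tsum_nonneg fun _ => by positivity
  have h6 : (1 : ℝ) / 2 ^ (K + 1) = 1 / 2 ^ K / 2 := by rw [pow_succ]; field_simp
  unfold ofDigits midpointOf
  rw [← h1, Finset.sum_range, abs_le]
  constructor <;> linarith

theorem ofDigits_pos {c : ℕ → ZMod 2} {i : ℕ} (hi : c i ≠ 0) : 0 < ofDigits c := by
  refine (summable_digits c).tsum_pos (fun _ => by positivity) i ?_
  have : (c i).val ≠ 0 := by rwa [Ne, ZMod.val_eq_zero]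
  have : 0 < (c i).val := Nat.pos_of_ne_zero this
  positivity

theorem ofDigits_lt_one {c : ℕ → ZMod 2} {i : ℕ} (hi : c i ≠ 1) : ofDigits c < 1 := by
  rw [← hasSum_half_pow_succ.tsum_eq]
  refine (summable_digits c).tsum_lt_tsum (i := i) (digit_term_le c) ?_
    hasSum_half_pow_succ.summable
  have : (c i).val = 0 := by
    revert hi; generalize c i = b; revert b; decide
  rw [this]
  simp

theorem tendsto_midpointOf (c : ℕ → ZMod 2) :
    Tendsto (fun K : ℕ => midpointOf fun i : Fin K => c i) atTop (𝓝 (ofDigits c)) := by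
  rw [tendsto_iff_dist_tendsto_zero]
  refine squeeze_zero (fun _ => dist_nonneg) (fun K => ?_)
    hasSum_half_pow_succ.summable.tendsto_atTop_zero
  rw [dist_comm, Real.dist_eq]
  exact abs_ofDigits_sub_midpointOf_le c K

/-! ### Continuity under the boundary growth condition -/

/-- Boundary growth provides partial derivatives only. Continuity is obtained by moving one
coordinate at a time, each move being controlled by the mixed difference bound for a single
coordinate. -/
theorem BoundaryGrowth.tendsto_piecewise {φ : (Fin d → ℝ) → ℝ} {b : ℝ} {A : Fin d → ℝ}
    (hb : 0 ≤ b) (hA : ∀ i, 0 < A i) (h : BoundaryGrowth φ b A) {y : Fin d → ℝ}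
    (hy : y ∈ openCube d) {z : ℕ → Fin d → ℝ} (hz : ∀ n, z n ∈ openCube d)
    (hlim : ∀ j, Tendsto (fun n => z n j) atTop (𝓝 (y j))) (s : Finset (Fin d)) :
    Tendsto (fun n => φ (s.piecewise (z n) y)) atTop (𝓝 (φ y)) := by
  induction s using Finset.induction_on with
  | empty => simp
  | insert i s hi ih =>
    set p : ℕ → Fin d → ℝ := fun n => s.piecewise (z n) y with hp
    have hpcube : ∀ n, p n ∈ openCube d := fun n => piecewise_mem_openCube hy (hz n) s
    have hplim : ∀ j, Tendsto (fun n => p n j) atTop (𝓝 (y j)) := by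
      intro j
      by_cases hj : j ∈ s
      · simpa [hp, hj] using hlim j
      · simp [hp, hj]
    have hq : ∀ n, (insert i s).piecewise (z n) y = ({i} : Finset (Fin d)).piecewise (z n) (p n) := by
      intro n; funext j
      by_cases hj : j = i
      · subst hj; simp
      · simp [hj, hp, Finset.piecewise]
    have hbound : ∀ n, |φ ((insert i s).piecewise (z n) y) - φ (p n)| ≤ b * ∏ j,
        if j ∈ ({i} : Finset (Fin d)) then
          |boundaryPotential (A j) (z n j) - boundaryPotential (A j) (p n j)|
        else boundaryWeight (A j) (p n j) := by
      intro n
      have h1 := h.abs_mixedDifference_le hb hA {i} (hpcube n) (hz n)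
      rw [hq, abs_sub_comm]
      refine le_trans (le_of_eq ?_) h1
      congr 1
      rw [← insert_empty_eq, Finset.sum_powerset_insert (Finset.notMem_empty i)]
      simp
      ring
    have hpot : ∀ j (x : ℕ → ℝ), Tendsto x atTop (𝓝 (y j)) →
        Tendsto (fun n => boundaryPotential (A j) (x n)) atTop (𝓝 (boundaryPotential (A j) (y j))) :=
      fun j x hx => ((hasDerivAt_boundaryPotential (hA j).ne' (hy j).1
        (hy j).2).continuousAt.tendsto).comp hx
    have hwei : ∀ j (x : ℕ → ℝ), Tendsto x atTop (𝓝 (y j)) →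
        Tendsto (fun n => boundaryWeight (A j) (x n)) atTop (𝓝 (boundaryWeight (A j) (y j))) :=
      fun j x hx => (hx.rpow_const (Or.inl (hy j).1.ne')).add
        ((hx.const_sub 1).rpow_const (Or.inl (sub_pos.2 (hy j).2).ne'))
    have hzero : Tendsto (fun n => b * ∏ j, if j ∈ ({i} : Finset (Fin d)) then
          |boundaryPotential (A j) (z n j) - boundaryPotential (A j) (p n j)|
        else boundaryWeight (A j) (p n j)) atTop (𝓝 0) := by
      have h2 : Tendsto (fun n => b * ∏ j, if j ∈ ({i} : Finset (Fin d)) then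
          |boundaryPotential (A j) (z n j) - boundaryPotential (A j) (p n j)|
          else boundaryWeight (A j) (p n j)) atTop (𝓝 (b * ∏ j, if j ∈ ({i} : Finset (Fin d)) then
          |boundaryPotential (A j) (y j) - boundaryPotential (A j) (y j)|
          else boundaryWeight (A j) (y j))) := by
        refine (tendsto_finsetProd _ fun j _ => ?_).const_mul b
        split_ifs
        · exact ((hpot j _ (hlim j)).sub (hpot j _ (hplim j))).abs
        · exact hwei j _ (hplim j)
      rwa [Finset.prod_eq_zero (Finset.mem_univ i), mul_zero] at h2
      simp
    have h3 : Tendsto (fun n => φ ((insert i s).piecewise (z n) y) - φ (p n)) atTop (𝓝 0) :=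
      squeeze_zero_norm hbound hzero
    simpa only [hp, zero_add, sub_add_cancel] using h3.add ih

theorem BoundaryGrowth.tendsto {φ : (Fin d → ℝ) → ℝ} {b : ℝ} {A : Fin d → ℝ}
    (hb : 0 ≤ b) (hA : ∀ i, 0 < A i) (h : BoundaryGrowth φ b A) {y : Fin d → ℝ}
    (hy : y ∈ openCube d) {z : ℕ → Fin d → ℝ} (hz : ∀ n, z n ∈ openCube d)
    (hlim : ∀ j, Tendsto (fun n => z n j) atTop (𝓝 (y j))) :
    Tendsto (fun n => φ (z n)) atTop (𝓝 (φ y)) := by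
  simpa using h.tendsto_piecewise hb hA hy hz hlim Finset.univ

/-- The mean is the Haar component of level zero, so this is the case `k = 0` of the mean square
bound, uniform in `K`. -/
theorem BoundaryGrowth.abs_mean_le {φ : (Fin d → ℝ) → ℝ} {b : ℝ} {A : Fin d → ℝ}
    (hb : 0 ≤ b) (hA : ∀ i, 0 < A i ∧ A i < 1 / 2) (h : BoundaryGrowth φ b A) (K : ℕ) :
    |(∑ g : Fin d → Fin K → ZMod 2, φ fun j => midpointOf (g j)) / (2 ^ K) ^ d| ≤
      √(b ^ 2 * ∏ j, boundaryConst (A j)) := by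
  refine Real.abs_le_sqrt ?_
  have h1 := h.mean_sq_haarComp_le (K := K) hb hA 0 fun _ => Nat.zero_le _
  simp_rw [haarComp_zero] at h1
  simpa using h1

/-! ### The mean square error for functions with boundary growth -/

section Error

variable {Ω : Type*} [MeasurableSpace Ω] {μ : Measure Ω} [IsProbabilityMeasure μ]
  {π : Ω → Fin d → List (ZMod 2) → Bool}

theorem sum_coordinate (j : Fin d) (g : (Fin K → ZMod 2) → ℝ) :
    (∑ x : Fin d → Fin K → ZMod 2, g (x j)) / (2 ^ K) ^ d = (∑ y, g y) / 2 ^ K := by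
  have h1 : ∀ x : Fin d → Fin K → ZMod 2, g (x j) = ∏ i, if i = j then g (x i) else 1 := by
    intro x; simp
  simp_rw [h1]
  rw [← Fintype.piFinset_univ, ← Finset.prod_univ_sum (fun _ => Finset.univ)
    (fun i (y : Fin K → ZMod 2) => if i = j then g y else 1)]
  have h2 : ((2 : ℝ) ^ K) ^ d = ∏ _i : Fin d, (2 : ℝ) ^ K := by simp
  rw [h2, ← Finset.prod_div_distrib, Finset.prod_eq_single j]
  · simp
  · intro i _ hi
    simp [hi]
  · simp

/-- Almost surely, the digits of a coordinate of a scrambled point are not all the same. -/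
theorem IsOwenScrambling.ae_exists_digit_ne (hπ : IsOwenScrambling μ π) (c : Fin d → ℕ → ZMod 2)
    (j : Fin d) (b : ZMod 2) : ∀ᵐ ω ∂μ, ∃ i, scrambledDigit (π ω) c j i ≠ b := by
  have h1 : ∀ K : ℕ, μ {ω | ∀ i, scrambledDigit (π ω) c j i = b} ≤
      ENNReal.ofReal ((1 / 2) ^ K) := by
    intro K
    have h2 := hπ.integral_comp (K := K) c fun x => if x j = fun _ => b then 1 else 0
    rw [sum_coordinate j fun y => if y = fun _ => b then 1 else 0] at h2
    have hm : MeasurableSet {ω | scrambledPrefix K (π ω) c j = fun _ => b} :=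
      measurableSet_setOfPred.2 (hπ.measurable_comp (K := K) c fun x => x j = fun _ => b)
    have h3 : ∫ ω, (if scrambledPrefix K (π ω) c j = fun _ => b then (1 : ℝ) else 0) ∂μ =
        μ.real {ω | scrambledPrefix K (π ω) c j = fun _ => b} := by
      rw [← integral_indicator_one hm]
      refine integral_congr_ae (ae_of_all _ fun ω => ?_)
      simp [Set.indicator_apply]
    rw [h3] at h2
    calc μ {ω | ∀ i, scrambledDigit (π ω) c j i = b}
        ≤ μ {ω | scrambledPrefix K (π ω) c j = fun _ => b} :=
          measure_mono fun ω hω => funext fun i => hω i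
      _ = ENNReal.ofReal (μ.real {ω | scrambledPrefix K (π ω) c j = fun _ => b}) :=
          (ENNReal.ofReal_toReal (measure_ne_top _ _)).symm
      _ ≤ _ := by rw [h2]; simp
  have h4 : Tendsto (fun K : ℕ => ENNReal.ofReal ((1 / 2 : ℝ) ^ K)) atTop (𝓝 0) := by
    rw [← ENNReal.ofReal_zero]
    exact (ENNReal.continuous_ofReal.tendsto 0).comp
      (tendsto_pow_atTop_nhds_zero_of_lt_one (by norm_num) (by norm_num))
  rw [ae_iff]
  push Not
  exact le_antisymm (ge_of_tendsto' h4 h1) zero_le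

theorem IsOwenScrambling.ae_mem_openCube (hπ : IsOwenScrambling μ π) (c : ℕ → Fin d → ℕ → ZMod 2) :
    ∀ᵐ ω ∂μ, ∀ n, scramble (π ω) (c n) ∈ openCube d := by
  have h1 : ∀ᵐ ω ∂μ, ∀ n j, ∀ b : ZMod 2, ∃ i, scrambledDigit (π ω) (c n) j i ≠ b := by
    rw [ae_all_iff]; intro n
    rw [ae_all_iff]; intro j
    rw [ae_all_iff]; intro b
    exact hπ.ae_exists_digit_ne (c n) j b
  filter_upwards [h1] with ω hω n j
  obtain ⟨i, hi⟩ := hω n j 0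
  obtain ⟨i', hi'⟩ := hω n j 1
  exact ⟨ofDigits_pos (c := scrambledDigit (π ω) (c n) j) hi,
    ofDigits_lt_one (c := scrambledDigit (π ω) (c n) j) hi'⟩

/-- The mean square error of the scrambled Sobol' points for a function with boundary growth. -/
theorem IsOwenScrambling.exists_eLpNorm_error_le (hπ : IsOwenScrambling μ π) (hd : 0 < d)
    (T : SobolData d) {φ : (Fin d → ℝ) → ℝ} {b : ℝ} {A : Fin d → ℝ} (hb : 0 ≤ b)
    (hA : ∀ i, 0 < A i ∧ A i < 1 / 2) (h : BoundaryGrowth φ b A) {ε : ℝ} (hε : 0 < ε) {N : ℕ}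
    (hN : 1 ≤ N) :
    ∃ I : ℝ, MemLp (fun ω => ∑ n ∈ Finset.range N, φ (scramble (π ω) (T.digit n)) - N * I) 2 μ ∧
      eLpNorm (fun ω => ∑ n ∈ Finset.range N, φ (scramble (π ω) (T.digit n)) - N * I) 2 μ ≤
      ENNReal.ofReal (b * growthConst A * sequenceConst d T.quality ε *
        (N : ℝ) ^ (ε + ⨆ i, A i)) := by
  set M : ℕ → ℝ := fun K =>
    (∑ g : Fin d → Fin K → ZMod 2, φ fun j => midpointOf (g j)) / (2 ^ K) ^ d with hM
  set R := √(b ^ 2 * ∏ j, boundaryConst (A j))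
  -- A subsequential limit of the bounded means serves as the centre of the error. It need not be
  -- identified with the integral of `φ`, since a variance does not depend on the centre.
  obtain ⟨I, -, θ, hθ, hI⟩ := tendsto_subseq_of_bounded (Metric.isBounded_Icc (-R) R)
    (x := M) fun K => abs_le.1 (h.abs_mean_le hb hA K)
  set X : ℕ → Ω → ℝ := fun K ω => ∑ n ∈ Finset.range N,
    φ (fun j => midpointOf (scrambledPrefix (θ K) (π ω) (T.digit n) j)) - N * M (θ K) with hX
  have hXmeas : ∀ K, AEStronglyMeasurable (X K) μ := by
    intro K
    refine AEStronglyMeasurable.sub ?_ aestronglyMeasurable_const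
    exact (memLp_finsetSum (p := 2) _ fun n _ => hπ.memLp_comp (K := θ K) (T.digit n)
      (fun x => φ fun j => midpointOf (x j)) 2).aestronglyMeasurable
  have hlim : ∀ᵐ ω ∂μ, Tendsto (fun K => X K ω) atTop
      (𝓝 (∑ n ∈ Finset.range N, φ (scramble (π ω) (T.digit n)) - N * I)) := by
    filter_upwards [hπ.ae_mem_openCube fun n => T.digit n] with ω hω
    refine (tendsto_finsetSum _ fun n _ => ?_).sub (hI.const_mul _)
    refine Tendsto.comp (g := fun K => φ fun j =>
      midpointOf (scrambledPrefix K (π ω) (T.digit n) j)) (h.tendsto hb (fun i => (hA i).1) (hω n)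
      (z := fun K j => midpointOf (scrambledPrefix K (π ω) (T.digit n) j))
      (fun K j => midpointOf_mem _) fun j => ?_) hθ.tendsto_atTop
    exact tendsto_midpointOf (scrambledDigit (π ω) (T.digit n) j)
  have hbound : eLpNorm (fun ω => ∑ n ∈ Finset.range N, φ (scramble (π ω) (T.digit n)) - N * I) 2 μ
      ≤ ENNReal.ofReal (b * growthConst A * sequenceConst d T.quality ε *
        (N : ℝ) ^ (ε + ⨆ i, A i)) := by
    -- Fatou's lemma. The scrambled points almost surely lie in the open cube, where `φ` is
    -- continuous along the approximating midpoints.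
    exact Lp.eLpNorm_le_of_ae_tendsto (Eventually.of_forall fun K =>
      hπ.eLpNorm_midpoint_error_le hd T hb hA h hε hN (θ K)) hXmeas hlim
  exact ⟨I, ⟨aestronglyMeasurable_of_tendsto_ae atTop hXmeas hlim,
    hbound.trans_lt ENNReal.ofReal_lt_top⟩, hbound⟩

end Error

end

section

variable {d K : ℕ}

/-! ### The star discrepancy of scrambled Sobol' points -/

theorem midpointOf_lt_midpointOf (x y : Fin K → ZMod 2) (i : Fin K)
    (h : ∀ i' < i, x i' = y i') (hx : x i = 0) (hy : y i = 1) : midpointOf x < midpointOf y := by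
  induction K with
  | zero => exact i.elim0
  | succ K ih =>
    rw [← Fin.cons_self_tail x, ← Fin.cons_self_tail y, midpointOf_cons, midpointOf_cons]
    cases i using Fin.cases with
    | zero =>
      rw [hx, hy, ZMod.val_zero, ZMod.val_one]
      have h1 := midpointOf_mem (Fin.tail x)
      have h2 := midpointOf_mem (Fin.tail y)
      push_cast
      linarith
    | succ i =>
      have h1 := ih (Fin.tail x) (Fin.tail y) i
        (fun i' hi' => h i'.succ (Fin.succ_lt_succ_iff.2 hi')) hx hy
      rw [h 0 (Fin.succ_pos i)]
      linarith

/-- The indicator function of the dyadic intervals with midpoint below `τ`. -/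
noncomputable def belowIndicator (τ : ℝ) (x : Fin K → ZMod 2) : ℝ :=
  if midpointOf x < τ then 1 else 0

/-- The one-dimensional Haar component of `belowIndicator`. -/
noncomputable def belowHaar (τ : ℝ) (k : ℕ) (x : Fin K → ZMod 2) : ℝ :=
  ∑ g, haarKernel K k g * belowIndicator τ (x + g)

theorem abs_belowHaar_le (τ : ℝ) {k : ℕ} (hk : k ≤ K) (x : Fin K → ZMod 2) :
    |belowHaar τ k x| ≤ 1 := by
  rw [← sum_abs_haarKernel K k hk]
  refine (Finset.abs_sum_le_sum_abs _ _).trans (Finset.sum_le_sum fun g _ => ?_)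
  rw [abs_mul]
  refine mul_le_of_le_one_right (abs_nonneg _) ?_
  unfold belowIndicator
  split_ifs <;> norm_num

/-- If the whole dyadic interval of level `k` around `x` lay on one side of `τ`, the indicator would
be constant on the support of the kernel, and the kernel has sum zero. -/
theorem exists_of_belowHaar_ne_zero {τ : ℝ} {k : ℕ} (hk : k < K) {x : Fin K → ZMod 2}
    (h : belowHaar τ (k + 1) x ≠ 0) :
    ∃ y z : Fin K → ZMod 2, (∀ i : Fin K, i.val < k → y i = x i) ∧
      (∀ i : Fin K, i.val < k → z i = x i) ∧ midpointOf y < τ ∧ τ ≤ midpointOf z := by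
  by_contra hcon
  push Not at hcon
  apply h
  obtain ⟨v, hv⟩ : ∃ v : ℝ, ∀ g : Fin K → ZMod 2, (∀ i : Fin K, i.val < k → g i = 0) →
      belowIndicator τ (x + g) = v := by
    by_cases hy : ∃ y : Fin K → ZMod 2, (∀ i : Fin K, i.val < k → y i = x i) ∧ midpointOf y < τ
    · obtain ⟨y, hy1, hy2⟩ := hy
      exact ⟨1, fun g hg => if_pos (hcon y (x + g) hy1 (fun i hi => by simp [hg i hi]) hy2)⟩
    · push Not at hy
      exact ⟨0, fun g hg => if_neg (not_lt.2 (hy (x + g) fun i hi => by simp [hg i hi]))⟩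
  have h1 : ∀ g : Fin K → ZMod 2, haarKernel K (k + 1) g * belowIndicator τ (x + g) =
      haarKernel K (k + 1) g * v := by
    intro g
    by_cases hg : ∀ i : Fin K, i.val < k → g i = 0
    · rw [hv g hg]
    · have h2 : |haarKernel K (k + 1) g| = 0 := by
        rw [abs_haarKernel K (k + 1) hk, Nat.add_sub_cancel, prefixKernel, if_neg hg]
      rw [abs_eq_zero.1 h2, zero_mul, zero_mul]
  unfold belowHaar
  rw [Finset.sum_congr rfl fun g _ => h1 g, ← Finset.sum_mul, sum_haarKernel_succ_eq_zero K k hk,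
    zero_mul]

/-- The Haar components of level `k + 1` are supported on one dyadic interval of level `k`. -/
theorem eq_of_belowHaar_ne_zero {τ : ℝ} {k : ℕ} (hk : k < K) {x x' : Fin K → ZMod 2}
    (h : belowHaar τ (k + 1) x ≠ 0) (h' : belowHaar τ (k + 1) x' ≠ 0) :
    ∀ i : Fin K, i.val < k → x i = x' i := by
  obtain ⟨y, z, hy, hz, hyτ, hzτ⟩ := exists_of_belowHaar_ne_zero hk h
  obtain ⟨y', z', hy', hz', hyτ', hzτ'⟩ := exists_of_belowHaar_ne_zero hk h'
  intro i
  -- At a first disagreement one interval lies entirely to the left of the other, so `τ` cannot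
  -- separate points within both.
  induction i using WellFoundedLT.induction with
  | _ i ih =>
    intro hi
    have hlt : ∀ i' < i, i'.val < k := fun i' hi' => lt_trans hi' hi
    by_contra hne
    have : ∀ b b' : ZMod 2, b ≠ b' → (b = 0 ∧ b' = 1) ∨ (b = 1 ∧ b' = 0) := by decide
    rcases this _ _ hne with ⟨h0, h1⟩ | ⟨h1, h0⟩
    · have := midpointOf_lt_midpointOf z y' i (fun i' hi' => by
        rw [hz i' (hlt i' hi'), hy' i' (hlt i' hi'), ih i' hi' (hlt i' hi')])
        (by rw [hz i hi, h0]) (by rw [hy' i hi, h1])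
      linarith
    · have := midpointOf_lt_midpointOf z' y i (fun i' hi' => by
        rw [hz' i' (hlt i' hi'), hy i' (hlt i' hi'), ih i' hi' (hlt i' hi')])
        (by rw [hz' i hi, h0]) (by rw [hy i hi, h1])
      linarith

theorem haarComp_prod_belowIndicator (τ : Fin d → ℝ) (k : Fin d → ℕ) (c : Fin d → Fin K → ZMod 2) :
    haarComp (fun c => ∏ j, belowIndicator (τ j) (c j)) k c = ∏ j, belowHaar (τ j) (k j) (c j) := by
  unfold haarComp belowHaar
  rw [Finset.prod_univ_sum, Fintype.piFinset_univ]
  exact Finset.sum_congr rfl fun g _ => by rw [← Finset.prod_mul_distrib]; rfl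

/-- Low levels cancel. At high levels each term is at most 1, and the nonzero ones lie in one box
fixed by the first `k j - 1` digits, which holds at most `2 ^ (quality + d)` points. No randomness
is involved. -/
theorem abs_sum_block_belowIndicator_le (T : SobolData d) (τ : Fin d → ℝ) (k : Fin d → ℕ)
    (hk : ∀ j, k j ≤ K) (hk0 : k ≠ 0) (m a : ℕ) (π : Fin d → List (ZMod 2) → Bool) :
    |∑ i ∈ Finset.range (2 ^ m), haarComp (fun c => ∏ j, belowIndicator (τ j) (c j)) k
      (scrambledPrefix K π (T.digit (2 ^ m * a + i)))| ≤ 2 ^ (T.quality + d) := by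
  by_cases hm : ∑ j, k j + T.quality ≤ m
  · rw [sum_block_haarComp_eq_zero T _ k hk hk0 m a hm, abs_zero]; positivity
  · set X : ℕ → ℝ := fun i => haarComp (fun c => ∏ j, belowIndicator (τ j) (c j)) k
      (scrambledPrefix K π (T.digit (2 ^ m * a + i))) with hX
    have hXprod : ∀ i, X i = ∏ j, belowHaar (τ j) (k j)
        (scrambledPrefix K π (T.digit (2 ^ m * a + i)) j) := fun i =>
      haarComp_prod_belowIndicator τ k _
    have hX1 : ∀ i, |X i| ≤ 1 := fun i => by
      rw [hXprod, Finset.abs_prod]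
      exact Finset.prod_le_one (fun _ _ => abs_nonneg _) fun j _ => abs_belowHaar_le _ (hk j) _
    by_cases hex : ∃ i0, X i0 ≠ 0
    · obtain ⟨i0, hi0⟩ := hex
      have hsub : (Finset.range (2 ^ m)).filter (fun i => X i ≠ 0) ⊆
          (Finset.range (2 ^ m)).filter fun i => ∀ j, ∀ l < k j - 1,
            T.digit (2 ^ m * a + i) j l = T.digit (2 ^ m * a + i0) j l := by
        refine Finset.monotone_filter_right _ fun i _ hi j => ?_
        by_cases hkj : k j = 0
        · simp [hkj]
        obtain ⟨l, hl⟩ := Nat.exists_eq_succ_of_ne_zero hkj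
        have hlK : l < K := by have := hk j; omega
        rw [hXprod, Finset.prod_ne_zero_iff] at hi hi0
        have h1 := hi j (Finset.mem_univ j)
        have h2 := hi0 j (Finset.mem_univ j)
        rw [hl] at h1 h2 ⊢
        refine eq_of_scrambledDigit_eq π fun i' hi' => ?_
        exact eq_of_belowHaar_ne_zero hlK h1 h2 ⟨i', by omega⟩ hi'
      have hcard := (Finset.card_le_card hsub).trans
        (T.card_block_le_of_lt k m a (by omega) (T.digit (2 ^ m * a + i0)))
      rw [← Finset.sum_filter_ne_zero]
      calc |∑ i ∈ (Finset.range (2 ^ m)).filter (fun i => X i ≠ 0), X i|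
          ≤ ∑ i ∈ (Finset.range (2 ^ m)).filter (fun i => X i ≠ 0), 1 :=
            (Finset.abs_sum_le_sum_abs _ _).trans (Finset.sum_le_sum fun i _ => hX1 i)
        _ ≤ _ := by
            rw [Finset.sum_const, nsmul_eq_mul, mul_one]; exact_mod_cast hcard
    · push Not at hex
      rw [Finset.sum_eq_zero fun i _ => hex i, abs_zero]; positivity

theorem mean_belowIndicator (K s : ℕ) :
    (∑ y : Fin K → ZMod 2, belowIndicator ((s : ℝ) / 2 ^ K) y) / 2 ^ K =
      (min s (2 ^ K) : ℕ) / 2 ^ K := by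
  unfold belowIndicator
  rw [sum_midpointOf K fun z => if z < (s : ℝ) / 2 ^ K then 1 else 0]
  congr 1
  have h1 : ∀ i : ℕ, ((i : ℝ) + 1 / 2) / 2 ^ K < s / 2 ^ K ↔ i < s := by
    intro i
    rw [div_lt_div_iff_of_pos_right (by positivity)]
    constructor
    · intro h
      have : (i : ℝ) < s := by linarith
      exact_mod_cast this
    · intro h
      have : (i : ℝ) + 1 ≤ s := by exact_mod_cast h
      linarith
  simp_rw [h1]
  rw [Finset.sum_boole]
  congr 1
  have : (Finset.range (2 ^ K)).filter (· < s) = Finset.range (min s (2 ^ K)) := by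
    ext i; simp [and_comm]
  rw [this, Finset.card_range]

/-- Discrepancy bound at the grid points. -/
theorem abs_grid_discrepancy_le (T : SobolData d) (N : ℕ) (s : Fin d → ℕ)
    (π : Fin d → List (ZMod 2) → Bool) :
    |∑ n ∈ Finset.range N, ∏ j, belowIndicator ((s j : ℝ) / 2 ^ K)
        (scrambledPrefix K π (T.digit n) j) -
      N * ∏ j, ((min (s j) (2 ^ K) : ℕ) : ℝ) / 2 ^ K| ≤
      N.size * (K + 1) ^ d * 2 ^ (T.quality + d) := by
  obtain ⟨S, hS, a, ha⟩ := exists_dyadic_blocks N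
  have h1 := sum_sub_mean_eq
    (fun c : Fin d → Fin K → ZMod 2 => ∏ j, belowIndicator ((s j : ℝ) / 2 ^ K) (c j)) ha
    fun n => scrambledPrefix K π (T.digit n)
  have h2 : (∑ g : Fin d → Fin K → ZMod 2, ∏ j, belowIndicator ((s j : ℝ) / 2 ^ K) (g j)) /
      (2 ^ K) ^ d = ∏ j, ((min (s j) (2 ^ K) : ℕ) : ℝ) / 2 ^ K := by
    simp_rw [← mean_belowIndicator]
    rw [Finset.prod_div_distrib, Finset.prod_univ_sum, Fintype.piFinset_univ]
    simp
  rw [h2] at h1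
  rw [h1]
  have hcard : (S.card : ℝ) ≤ N.size := by
    have := Finset.card_le_card hS
    rw [Finset.card_range] at this
    exact_mod_cast this
  have hcard2 : (((Fintype.piFinset fun _ : Fin d => Finset.range (K + 1)).erase 0).card : ℝ) ≤
      (K + 1) ^ d := by
    have := Finset.card_le_card
      (Finset.erase_subset 0 (Fintype.piFinset fun _ : Fin d => Finset.range (K + 1)))
    rw [Fintype.card_piFinset] at this
    simp only [Finset.card_range, Finset.prod_const, Finset.card_univ, Fintype.card_fin] at this
    exact_mod_cast this
  calc _ ≤ ∑ m ∈ S, ∑ k ∈ (Fintype.piFinset fun _ : Fin d => Finset.range (K + 1)).erase 0,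
        (2 : ℝ) ^ (T.quality + d) := by
        refine (Finset.abs_sum_le_sum_abs _ _).trans (Finset.sum_le_sum fun m _ => ?_)
        refine (Finset.abs_sum_le_sum_abs _ _).trans (Finset.sum_le_sum fun k hk => ?_)
        rw [Finset.mem_erase, Fintype.mem_piFinset] at hk
        exact abs_sum_block_belowIndicator_le T _ k
          (fun j => Nat.lt_succ_iff.1 (Finset.mem_range.1 (hk.2 j))) hk.1 m (a m) π
    _ = S.card * ((Fintype.piFinset fun _ : Fin d => Finset.range (K + 1)).erase 0).card *
        2 ^ (T.quality + d) := by
        rw [Finset.sum_const, Finset.sum_const, nsmul_eq_mul, nsmul_eq_mul, mul_assoc]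
    _ ≤ _ := by gcongr

theorem abs_prod_sub_prod_le_sum {ι : Type*} (s : Finset ι) (u v : ι → ℝ)
    (hu : ∀ i, 0 ≤ u i ∧ u i ≤ 1) (hv : ∀ i, 0 ≤ v i ∧ v i ≤ 1) :
    |∏ i ∈ s, u i - ∏ i ∈ s, v i| ≤ ∑ i ∈ s, |u i - v i| := by
  classical
  induction s using Finset.induction_on with
  | empty => simp
  | insert i s hi ih =>
    rw [Finset.prod_insert hi, Finset.prod_insert hi, Finset.sum_insert hi]
    have hp0 : 0 ≤ ∏ i ∈ s, u i := Finset.prod_nonneg fun i _ => (hu i).1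
    have hp1 : ∏ i ∈ s, u i ≤ 1 := Finset.prod_le_one (fun i _ => (hu i).1) fun i _ => (hu i).2
    calc |u i * ∏ i ∈ s, u i - v i * ∏ i ∈ s, v i|
        = |(u i - v i) * ∏ i ∈ s, u i + v i * (∏ i ∈ s, u i - ∏ i ∈ s, v i)| := by
          congr 1; ring
      _ ≤ |u i - v i| * ∏ i ∈ s, u i + v i * |∏ i ∈ s, u i - ∏ i ∈ s, v i| := by
          refine (abs_add_le _ _).trans (le_of_eq ?_)
          rw [abs_mul, abs_mul, abs_of_nonneg hp0, abs_of_nonneg (hv i).1]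
      _ ≤ |u i - v i| * 1 + 1 * |∏ i ∈ s, u i - ∏ i ∈ s, v i| :=
          add_le_add (mul_le_mul_of_nonneg_left hp1 (abs_nonneg _))
            (mul_le_mul_of_nonneg_right (hv i).2 (abs_nonneg _))
      _ ≤ _ := by linarith

theorem prod_belowIndicator (τ : Fin d → ℝ) (c : Fin d → Fin K → ZMod 2) :
    ∏ j, belowIndicator (τ j) (c j) = if ∀ j, midpointOf (c j) < τ j then 1 else 0 := by
  unfold belowIndicator
  split_ifs with h
  · exact Finset.prod_eq_one fun j _ => if_pos (h j)
  · push Not at h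
    obtain ⟨j, hj⟩ := h
    exact Finset.prod_eq_zero (Finset.mem_univ j) (if_neg (not_lt.2 hj))

/-- The constant in the bound of the star discrepancy. -/
noncomputable def discrepancyConst (d t : ℕ) (ε : ℝ) : ℝ :=
  (2 ^ (t + d) + 2 * d) * (sizeConst (ε / (d + 1)) + 1) ^ (d + 1)

/-- With `K` the binary length of `N`, the grid of mesh `2 ^ (-K)` is finer than `1/N`. The box is
squeezed between two grid boxes, and the change of volume costs at most `2 * d` points. -/
theorem abs_local_discrepancy_le (T : SobolData d) (N : ℕ) (π : Fin d → List (ZMod 2) → Bool)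
    (a : Fin d → ℝ) (ha : ∀ j, 0 ≤ a j ∧ a j ≤ 1) :
    |(∑ n ∈ Finset.range N, if ∀ j, scramble π (T.digit n) j < a j then (1 : ℝ) else 0) -
      N * ∏ j, a j| ≤ N.size * (N.size + 1) ^ d * 2 ^ (T.quality + d) + 2 * d := by
  set K := N.size with hK
  have hQ : (0 : ℝ) < 2 ^ K := by positivity
  have hNQ : (N : ℝ) ≤ 2 ^ K := by exact_mod_cast (Nat.lt_size_self N).le
  set t : Fin d → ℕ := fun j => ⌊a j * 2 ^ K⌋₊ with ht
  have ht1 : ∀ j, (t j : ℝ) ≤ a j * 2 ^ K := fun j => Nat.floor_le (mul_nonneg (ha j).1 hQ.le)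
  have ht2 : ∀ j, a j * 2 ^ K < t j + 1 := fun j => Nat.lt_floor_add_one _
  have hmid : ∀ n j, |scramble π (T.digit n) j - midpointOf (scrambledPrefix K π (T.digit n) j)| ≤
      1 / 2 / 2 ^ K := by
    intro n j
    refine (abs_ofDigits_sub_midpointOf_le (scrambledDigit π (T.digit n) j) K).trans (le_of_eq ?_)
    rw [pow_succ]; field_simp
  have hvol : ∀ s : Fin d → ℕ, (∀ j, |((min (s j) (2 ^ K) : ℕ) : ℝ) - a j * 2 ^ K| ≤ 2) →
      |N * ∏ j, ((min (s j) (2 ^ K) : ℕ) : ℝ) / 2 ^ K - N * ∏ j, a j| ≤ 2 * d := by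
    intro s hs
    have h1 := abs_prod_sub_prod_le_sum Finset.univ
      (fun j => ((min (s j) (2 ^ K) : ℕ) : ℝ) / 2 ^ K) a
      (fun j => ⟨by positivity, by
        rw [div_le_one hQ]; exact_mod_cast min_le_right _ _⟩) ha
    have h2 : ∑ j, |((min (s j) (2 ^ K) : ℕ) : ℝ) / 2 ^ K - a j| ≤ d * (2 / 2 ^ K) := by
      refine (Finset.sum_le_card_nsmul _ _ (2 / 2 ^ K) fun j _ => ?_).trans (le_of_eq (by simp))
      rw [show ((min (s j) (2 ^ K) : ℕ) : ℝ) / 2 ^ K - a j =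
        (((min (s j) (2 ^ K) : ℕ) : ℝ) - a j * 2 ^ K) / 2 ^ K by field_simp, abs_div,
        abs_of_pos hQ]
      exact div_le_div_of_nonneg_right (hs j) hQ.le
    rw [← mul_sub, abs_mul, abs_of_nonneg (Nat.cast_nonneg N)]
    calc (N : ℝ) * _ ≤ 2 ^ K * (d * (2 / 2 ^ K)) :=
          mul_le_mul hNQ (h1.trans h2) (abs_nonneg _) hQ.le
      _ = 2 * d := by field_simp
  -- A point is at most half a mesh away from its midpoint, so the offsets `+2` and `-1` from the
  -- rounded-down corner ensure the inclusions; both change the corner by at most two meshes.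
  have hup := abs_grid_discrepancy_le (K := K) T N (fun j => t j + 2) π
  have hlow := abs_grid_discrepancy_le (K := K) T N (fun j => t j - 1) π
  have hvup := hvol (fun j => t j + 2) fun j => by
    have e1 := ht1 j
    have e2 := ht2 j
    have e3 : a j * 2 ^ K ≤ 2 ^ K := mul_le_of_le_one_left hQ.le (ha j).2
    push_cast
    rw [abs_le]
    rcases min_choice ((t j : ℝ) + 2) (2 ^ K) with h | h
    · rw [h]; constructor <;> linarith
    · have := min_le_left ((t j : ℝ) + 2) (2 ^ K)
      rw [h] at this ⊢
      constructor <;> linarith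
  have hvlow := hvol (fun j => t j - 1) fun j => by
    have e1 := ht1 j
    have e2 := ht2 j
    have e3 : a j * 2 ^ K ≤ 2 ^ K := mul_le_of_le_one_left hQ.le (ha j).2
    have e4 : t j - 1 ≤ 2 ^ K := by
      have : (t j : ℝ) ≤ 2 ^ K := e1.trans e3
      have : t j ≤ 2 ^ K := by exact_mod_cast this
      omega
    rw [min_eq_left e4, abs_le]
    rcases Nat.eq_zero_or_pos (t j) with h | h
    · rw [h] at e2 ⊢
      have e5 := (ha j).1
      have : 0 ≤ a j * 2 ^ K := by positivity
      push_cast at e2 ⊢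
      constructor <;> linarith
    · rw [Nat.cast_sub h]
      push_cast
      constructor <;> linarith
  simp only [prod_belowIndicator] at hup hlow
  have hle1 : (∑ n ∈ Finset.range N, if ∀ j, scramble π (T.digit n) j < a j then (1 : ℝ) else 0) ≤
      ∑ n ∈ Finset.range N, if ∀ j, midpointOf (scrambledPrefix K π (T.digit n) j) <
        ((t j + 2 : ℕ) : ℝ) / 2 ^ K then (1 : ℝ) else 0 := by
    refine Finset.sum_le_sum fun n _ => ?_
    split_ifs with h1 h2 h2
    · exact le_rfl
    · exfalso
      apply h2
      intro j
      have e1 := (abs_le.1 (hmid n j)).1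
      have e2 := ht2 j
      have e3 := h1 j
      rw [lt_div_iff₀ hQ]
      have e4 : midpointOf (scrambledPrefix K π (T.digit n) j) < a j + 1 / 2 / 2 ^ K := by linarith
      have e5 := mul_lt_mul_of_pos_right e4 hQ
      rw [add_mul, div_mul_cancel₀ _ hQ.ne'] at e5
      push_cast
      linarith
    · norm_num
    · exact le_rfl
  have hle2 : (∑ n ∈ Finset.range N, if ∀ j, midpointOf (scrambledPrefix K π (T.digit n) j) <
        ((t j - 1 : ℕ) : ℝ) / 2 ^ K then (1 : ℝ) else 0) ≤
      ∑ n ∈ Finset.range N, if ∀ j, scramble π (T.digit n) j < a j then (1 : ℝ) else 0 := by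
    refine Finset.sum_le_sum fun n _ => ?_
    split_ifs with h1 h2 h2
    · exact le_rfl
    · exfalso
      apply h2
      intro j
      have e1 := (abs_le.1 (hmid n j)).2
      have e2 := ht1 j
      have e3 := h1 j
      rw [lt_div_iff₀ hQ] at e3
      have hpos : 0 < midpointOf (scrambledPrefix K π (T.digit n) j) * 2 ^ K :=
        mul_pos (midpointOf_mem _).1 hQ
      have htj : 1 ≤ t j := by
        by_contra h0
        have : t j - 1 = 0 := by omega
        rw [this, Nat.cast_zero] at e3
        linarith
      rw [Nat.cast_sub htj] at e3
      push_cast at e3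
      have e4 : scramble π (T.digit n) j ≤
          midpointOf (scrambledPrefix K π (T.digit n) j) + 1 / 2 / 2 ^ K := by linarith
      have e5 := mul_le_mul_of_nonneg_right e4 hQ.le
      rw [add_mul, div_mul_cancel₀ _ hQ.ne'] at e5
      refine lt_of_mul_lt_mul_right ?_ hQ.le
      linarith
    · norm_num
    · exact le_rfl
  rw [abs_le] at hup hlow hvup hvlow ⊢
  constructor <;> linarith [hup.1, hup.2, hlow.1, hlow.2, hvup.1, hvup.2, hvlow.1, hvlow.2]

/-- The star discrepancy of scrambled Sobol' points, for every scrambling. -/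
theorem starDiscrepancy_scramble_le (T : SobolData d) {ε : ℝ} (hε : 0 < ε) {N : ℕ} (hN : 1 ≤ N)
    (π : Fin d → List (ZMod 2) → Bool) :
    starDiscrepancy (fun n => scramble π (T.digit n)) N ≤
      discrepancyConst d T.quality ε / (N : ℝ) ^ (1 - ε) := by
  have hN0 : (0 : ℝ) < N := by exact_mod_cast hN
  have hne : Nonempty (Set.Icc (0 : Fin d → ℝ) 1) := ⟨⟨0, by simp⟩⟩
  refine ciSup_le fun a => ?_
  have ha : ∀ j, 0 ≤ a.1 j ∧ a.1 j ≤ 1 := fun j => ⟨a.2.1 j, a.2.2 j⟩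
  have h1 := abs_local_discrepancy_le T N π a.1 ha
  have hcount : (Nat.card {n : Fin N // ∀ j, 0 ≤ scramble π (T.digit n) j ∧
      scramble π (T.digit n) j < a.1 j} : ℝ) =
      ∑ n ∈ Finset.range N, if ∀ j, scramble π (T.digit n) j < a.1 j then (1 : ℝ) else 0 := by
    rw [Nat.card_eq_fintype_card, Fintype.card_subtype, Finset.sum_range, Finset.sum_boole]
    congr 2
    ext n
    simp only [Finset.mem_filter, Finset.mem_univ, true_and]
    exact forall_congr' fun j => and_iff_right (ofDigits_nonneg _)
  rw [hcount]
  set cnt := ∑ n ∈ Finset.range N, if ∀ j, scramble π (T.digit n) j < a.1 j then (1 : ℝ) else 0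
  rw [show cnt / N - ∏ j, a.1 j = (cnt - N * ∏ j, a.1 j) / N by field_simp, abs_div,
    abs_of_pos hN0, Real.rpow_sub hN0, Real.rpow_one, div_div_eq_mul_div]
  refine div_le_div_of_nonneg_right (h1.trans ?_) hN0.le
  have hd1 : (0 : ℝ) < (d : ℝ) + 1 := by positivity
  -- The bound carries `d + 1` logarithmic factors, each of which may cost `N ^ (ε / (d + 1))`.
  have hθ : 0 < ε / ((d : ℝ) + 1) := by positivity
  have h2 : (N.size : ℝ) + 1 ≤ (sizeConst (ε / (d + 1)) + 1) * (N : ℝ) ^ (ε / ((d : ℝ) + 1)) := by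
    have e1 := size_le_sizeConst_mul hθ hN
    have e2 : (1 : ℝ) ≤ (N : ℝ) ^ (ε / ((d : ℝ) + 1)) :=
      Real.one_le_rpow (by exact_mod_cast hN) hθ.le
    linarith
  have h3 : ((N.size : ℝ) + 1) ^ (d + 1) ≤
      (sizeConst (ε / (d + 1)) + 1) ^ (d + 1) * (N : ℝ) ^ ε := by
    refine (pow_le_pow_left₀ (by positivity) h2 (d + 1)).trans (le_of_eq ?_)
    rw [mul_pow, ← Real.rpow_natCast ((N : ℝ) ^ _), ← Real.rpow_mul hN0.le]
    congr 2
    push_cast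
    field_simp
  have h4 : (1 : ℝ) ≤ ((N.size : ℝ) + 1) ^ (d + 1) := one_le_pow₀ (by linarith [N.size.cast_nonneg (α := ℝ)])
  have h5 : (N.size : ℝ) * (N.size + 1) ^ d ≤ ((N.size : ℝ) + 1) ^ (d + 1) := by
    rw [pow_succ, mul_comm]
    exact mul_le_mul_of_nonneg_left (by linarith) (by positivity)
  calc (N.size : ℝ) * (N.size + 1) ^ d * 2 ^ (T.quality + d) + 2 * d
      ≤ ((N.size : ℝ) + 1) ^ (d + 1) * 2 ^ (T.quality + d) +
        ((N.size : ℝ) + 1) ^ (d + 1) * (2 * d) := by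
        refine add_le_add (mul_le_mul_of_nonneg_right h5 (by positivity)) ?_
        exact le_mul_of_one_le_left (by positivity) h4
    _ = (2 ^ (T.quality + d) + 2 * d) * ((N.size : ℝ) + 1) ^ (d + 1) := by ring
    _ ≤ (2 ^ (T.quality + d) + 2 * d) *
        ((sizeConst (ε / (d + 1)) + 1) ^ (d + 1) * (N : ℝ) ^ ε) :=
        mul_le_mul_of_nonneg_left h3 (by positivity)
    _ = _ := by rw [discrepancyConst]; ring

end

section

variable {d : ℕ}

/-! ### Taylor's formula -/

/-- Taylor's formula of first order with integral remainder, for an integrable second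
derivative. -/
theorem taylor_integral_remainder {S : Set ℝ} {f : ℝ → ℝ} (hS : IsOpen S) (hc : Convex ℝ S)
    (hf : DifferentiableOn ℝ f S) (hf' : DifferentiableOn ℝ (deriv f) S)
    (hf'' : ∀ a ∈ S, ∀ b ∈ S, IntervalIntegrable (deriv (deriv f)) volume a b)
    {p q : ℝ} (hp : p ∈ S) (hq : q ∈ S) :
    f q = f p + deriv f p * (q - p) +
      (q - p) ^ 2 * ∫ s in (0 : ℝ)..1, deriv (deriv f) (p + s * (q - p)) * (1 - s) := by
  by_cases hne : q - p = 0
  · have : q = p := sub_eq_zero.1 hne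
    subst this; simp
  · have hmem : ∀ s ∈ Set.uIcc (0 : ℝ) 1, p + s * (q - p) ∈ S := by
      intro s hs
      rw [Set.uIcc_of_le zero_le_one] at hs
      exact hc.add_smul_sub_mem hp hq hs
    have hline : ∀ s : ℝ, HasDerivAt (fun s => p + s * (q - p)) (q - p) s := fun s => by
      simpa using ((hasDerivAt_id s).mul_const (q - p)).const_add p
    -- This primitive is the first-order expansion around the moving point: it equals `f q` at `s =
    -- 1` and the Taylor polynomial at `s = 0`.
    have hderiv : ∀ s ∈ Set.uIcc (0 : ℝ) 1,
        HasDerivAt (fun s => f (p + s * (q - p)) + (1 - s) * (deriv f (p + s * (q - p)) * (q - p)))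
          ((q - p) ^ 2 * (deriv (deriv f) (p + s * (q - p)) * (1 - s))) s := by
      intro s hs
      have h1 := ((hf.differentiableAt (hS.mem_nhds (hmem s hs))).hasDerivAt).comp s (hline s)
      have h2 := ((hf'.differentiableAt (hS.mem_nhds (hmem s hs))).hasDerivAt).comp s (hline s)
      have h3 := ((hasDerivAt_id s).const_sub 1).mul (h2.mul_const (q - p))
      refine (h1.add h3).congr_deriv ?_
      simp only [id, Function.comp]
      ring
    have hint : IntervalIntegrable (fun s => deriv (deriv f) (p + s * (q - p))) volume 0 1 := by
      have h1 := ((hf'' p hp q hq).comp_add_left p).comp_mul_right (c := q - p)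
      rwa [sub_self, zero_div, div_self hne] at h1
    have hftc := intervalIntegral.integral_eq_sub_of_hasDerivAt hderiv
      ((hint.mul_continuousOn (by fun_prop)).const_mul _)
    rw [intervalIntegral.integral_const_mul] at hftc
    rw [hftc]
    simp

/-! ### The boundary growth condition for differences -/

theorem BoundaryGrowth.sub {φ ψ : (Fin d → ℝ) → ℝ} {b b' : ℝ} {A : Fin d → ℝ}
    (h : BoundaryGrowth φ b A) (h' : BoundaryGrowth ψ b' A) :
    BoundaryGrowth (fun y => φ y - ψ y) (b + b') A := by
  obtain ⟨D, hD, hb⟩ := h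
  obtain ⟨D', hD', hb'⟩ := h'
  refine ⟨fun u y => D u y - D' u y, ⟨fun y hy => by simp only [hD.1 y hy, hD'.1 y hy],
    fun u j hj y hy => (hD.2 u j hj y hy).sub (hD'.2 u j hj y hy)⟩, fun u y hy => ?_⟩
  rw [add_mul]
  exact (abs_sub _ _).trans (add_le_add (hb u y hy) (hb' u y hy))

/-! ### The variance of an average of scrambled points -/

section Variance

variable {Ω : Type*} [MeasurableSpace Ω] {μ : Measure Ω} [IsProbabilityMeasure μ]
  {π : Ω → Fin d → List (ZMod 2) → Bool}

/-- The variance of the average over scrambled Sobol' points of a sum of two functions with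
boundary growth. -/
theorem IsOwenScrambling.memLp_and_variance_le (hπ : IsOwenScrambling μ π) (hd : 0 < d)
    (T : SobolData d) {F φ ψ : (Fin d → ℝ) → ℝ} {b b' : ℝ} {A A' : Fin d → ℝ} (hb : 0 ≤ b)
    (hb' : 0 ≤ b') (hA : ∀ i, 0 < A i ∧ A i < 1 / 2) (hA' : ∀ i, 0 < A' i ∧ A' i < 1 / 2)
    (h : BoundaryGrowth φ b A) (h' : BoundaryGrowth ψ b' A')
    (hF : ∀ y ∈ openCube d, F y = φ y + ψ y) {ε : ℝ} (hε : 0 < ε) {N : ℕ} (hN : 1 ≤ N) :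
    MemLp (fun ω => (1 / (N : ℝ)) * ∑ n ∈ Finset.range N, F (scramble (π ω) (T.digit n))) 2 μ ∧
      variance (fun ω => (1 / (N : ℝ)) * ∑ n ∈ Finset.range N,
        F (scramble (π ω) (T.digit n))) μ ≤
      2 * (b * growthConst A * sequenceConst d T.quality ε) ^ 2 /
          (N : ℝ) ^ (2 - 2 * ε - 2 * ⨆ i, A i) +
        2 * (b' * growthConst A' * sequenceConst d T.quality ε) ^ 2 /
          (N : ℝ) ^ (2 - 2 * ε - 2 * ⨆ i, A' i) := by
  obtain ⟨I, hI, hIb⟩ := hπ.exists_eLpNorm_error_le hd T hb hA h hε hN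
  obtain ⟨I', hI', hIb'⟩ := hπ.exists_eLpNorm_error_le hd T hb' hA' h' hε hN
  have hN0 : (0 : ℝ) < N := by exact_mod_cast hN
  have hs := sequenceConst_pos (d := d) (t := T.quality) hε
  have hg := growthConst_pos hd hA
  have hg' := growthConst_pos hd hA'
  set Y : Ω → ℝ := fun ω => ∑ n ∈ Finset.range N, φ (scramble (π ω) (T.digit n)) - N * I with hY
  set Z : Ω → ℝ := fun ω => ∑ n ∈ Finset.range N, ψ (scramble (π ω) (T.digit n)) - N * I' with hZ
  set X : Ω → ℝ := fun ω =>
    (1 / (N : ℝ)) * ∑ n ∈ Finset.range N, F (scramble (π ω) (T.digit n)) with hX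
  set W : Ω → ℝ := fun ω => (1 / (N : ℝ)) * (Y ω + Z ω) with hW
  have hWL : MemLp W 2 μ := (hI.add hI').const_mul _
  have hae : (fun ω => W ω + (I + I')) =ᵐ[μ] X := by
    filter_upwards [hπ.ae_mem_openCube fun n => T.digit n] with ω hω
    simp only [hW, hY, hZ, hX]
    rw [Finset.sum_congr rfl fun n _ => hF _ (hω n), Finset.sum_add_distrib]
    field_simp; ring
  have hXL : MemLp X 2 μ := (hWL.add (memLp_const (I + I'))).ae_eq hae
  refine ⟨hXL, ?_⟩
  -- The unknown centres only shift the average, so its variance is at most the second moment of the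
  -- centred sum. The factors 2 come from `(Y + Z)² ≤ 2 (Y² + Z²)`.
  rw [← variance_congr hae, variance_add_const hWL.aestronglyMeasurable]
  refine (variance_le_expectation_sq hWL.aestronglyMeasurable).trans ?_
  have e1 := integral_sq_le_of_eLpNorm_le hI (by positivity) hIb
  have e2 := integral_sq_le_of_eLpNorm_le hI' (by positivity) hIb'
  have e3 : ∫ ω, (W ^ 2) ω ∂μ ≤ ∫ ω, 2 / (N : ℝ) ^ 2 * (Y ω ^ 2 + Z ω ^ 2) ∂μ := by
    refine integral_mono hWL.integrable_sq
      ((hI.integrable_sq.add hI'.integrable_sq).const_mul _) fun ω => ?_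
    simp only [hW, Pi.pow_apply]
    rw [mul_pow, one_div, inv_pow, div_eq_inv_mul, mul_assoc]
    refine mul_le_mul_of_nonneg_left ?_ (by positivity)
    nlinarith [sq_nonneg (Y ω - Z ω)]
  rw [integral_const_mul, integral_add hI.integrable_sq hI'.integrable_sq] at e3
  refine e3.trans ((mul_le_mul_of_nonneg_left (add_le_add e1 e2) (by positivity)).trans
    (le_of_eq ?_))
  have e4 : ∀ a : ℝ, ((N : ℝ) ^ (ε + a)) ^ 2 / (N : ℝ) ^ 2 = 1 / (N : ℝ) ^ (2 - 2 * ε - 2 * a) := by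
    intro a
    rw [← Real.rpow_natCast ((N : ℝ) ^ _), ← Real.rpow_mul hN0.le, ← Real.rpow_natCast (N : ℝ) 2,
      ← Real.rpow_sub hN0, one_div, ← Real.rpow_neg hN0.le]
    congr 1; push_cast; ring
  rw [mul_add, mul_pow _ ((N : ℝ) ^ _), mul_pow _ ((N : ℝ) ^ _), div_eq_mul_one_div _
    ((N : ℝ) ^ (2 - 2 * ε - 2 * ⨆ i, A i)), div_eq_mul_one_div _
    ((N : ℝ) ^ (2 - 2 * ε - 2 * ⨆ i, A' i)), ← e4, ← e4]
  ring

end Variance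

/-! ### The constants of the level differences -/

/-- This is the origin of `κ`. With `M` and `h` at the finer level, the two growth constants add up
to at most `(x + y) (1 + 2 ^ (-r) + 2 ^ e) b`, where `x` and `y` are the rates at that level. Then
`(x + y)² ≤ 2 (x² + y²)`, and the two factors 2 make up the square of the leading 2 of `κ`. -/
theorem two_mul_sq_level_constants_le {C E M h r e b : ℝ} (hC : 0 < C) (hE : 0 < E) (hM : 0 < M)
    (hh : 0 < h) :
    2 * ((C * M ^ r + E * h ^ e) * b + (C * (M / 2) ^ r + E * (2 * h) ^ e) * b) ^ 2 ≤
      (C ^ 2 / M ^ (-2 * r) + E ^ 2 * h ^ (2 * e)) * (2 * (1 + 2 ^ (-r) + 2 ^ e) * b) ^ 2 := by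
  have h1 : (M / 2) ^ r = M ^ r * 2 ^ (-r) := by
    rw [Real.div_rpow hM.le (by norm_num), Real.rpow_neg (by norm_num), div_eq_mul_inv]
  have h2 : (2 * h) ^ e = 2 ^ e * h ^ e := Real.mul_rpow (by norm_num) hh.le
  have h3 : C ^ 2 / M ^ (-2 * r) = (C * M ^ r) ^ 2 := by
    rw [neg_mul, Real.rpow_neg hM.le, div_inv_eq_mul, mul_pow, ← Real.rpow_natCast (M ^ r),
      ← Real.rpow_mul hM.le]
    congr 2; push_cast; ring
  have h4 : E ^ 2 * h ^ (2 * e) = (E * h ^ e) ^ 2 := by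
    rw [mul_pow, ← Real.rpow_natCast (h ^ e), ← Real.rpow_mul hh.le]
    congr 2; push_cast; ring
  rw [h1, h2, h3, h4]
  have hx : 0 < C * M ^ r := by positivity
  have hy : 0 < E * h ^ e := by positivity
  set x := C * M ^ r
  set y := E * h ^ e
  have hp : (0 : ℝ) < 2 ^ (-r) := by positivity
  have hq : (0 : ℝ) < 2 ^ e := by positivity
  set p : ℝ := 2 ^ (-r)
  set q : ℝ := 2 ^ e
  have e1 : (x + y) * b + (C * (M ^ r * p) + E * (q * h ^ e)) * b = (x * (1 + p) + y * (1 + q)) * b := by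
    simp only [x, y]; ring
  rw [e1]
  have e2 : x * (1 + p) + y * (1 + q) ≤ (x + y) * (1 + p + q) := by nlinarith
  calc 2 * ((x * (1 + p) + y * (1 + q)) * b) ^ 2
      = 2 * (x * (1 + p) + y * (1 + q)) ^ 2 * b ^ 2 := by ring
    _ ≤ 2 * ((x + y) * (1 + p + q)) ^ 2 * b ^ 2 := by gcongr
    _ = 2 * (x + y) ^ 2 * ((1 + p + q) * b) ^ 2 := by ring
    _ ≤ 2 * (2 * (x ^ 2 + y ^ 2)) * ((1 + p + q) * b) ^ 2 := by
        gcongr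
        nlinarith [sq_nonneg (x - y)]
    _ = _ := by ring

theorem one_le_sqrt_boundaryConst {a : ℝ} (h0 : 0 < a) (h1 : a < 1 / 2) :
    1 / a ≤ √(boundaryConst a) ∧ 1 ≤ √(boundaryConst a) := by
  have h2 : 0 < 1 - 2 * a := by linarith
  have h3 : 1 / a ≤ √(boundaryConst a) := by
    refine Real.le_sqrt_of_sq_le ?_
    rw [div_pow, one_pow, boundaryConst]
    refine div_le_div_of_nonneg_right ?_ (by positivity)
    have : 0 < 2 / (1 - 2 * a) := by positivity
    linarith
  exact ⟨h3, le_trans (by rw [le_div_iff₀ h0]; linarith) h3⟩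

/-- The factor of coordinate `i` is already at least `1 / A i`, and all the others are at least 1.
This forces the blow-up as the smallest exponent tends to zero. -/
theorem one_div_le_growthConst (hd : 0 < d) {A : Fin d → ℝ} (hA : ∀ i, 0 < A i ∧ A i < 1 / 2)
    (i : Fin d) : 1 / A i ≤ growthConst A := by
  have h1 := one_le_levelConst (d := d) (sub_pos.2 (iSup_lt_half hd hA).1)
  have h2 := one_le_sqrt_boundaryConst (hA i).1 (hA i).2
  have h3 : 1 ≤ ∏ j ∈ Finset.univ.erase i, √(boundaryConst (A j)) := by
    simpa using Finset.prod_le_prod (s := Finset.univ.erase i) (f := fun _ => (1 : ℝ))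
      (fun _ _ => zero_le_one) fun j _ => (one_le_sqrt_boundaryConst (hA j).1 (hA j).2).2
  have h4 : 1 / A i ≤ ∏ j, √(boundaryConst (A j)) := by
    rw [← Finset.mul_prod_erase _ _ (Finset.mem_univ i)]
    nlinarith
  have h5 : 0 < 1 / A i := one_div_pos.2 (hA i).1
  unfold growthConst
  nlinarith

open Classical in
/-- The constant `B_A`. -/
noncomputable def varianceConst (A : Fin d → ℝ) : ℝ :=
  -- The value 1 for inadmissible exponents only secures positivity everywhere.
  if ∀ i, 0 < A i ∧ A i < 1 / 2 then growthConst A else 1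

theorem varianceConst_eq {A : Fin d → ℝ} (hA : ∀ i, 0 < A i ∧ A i < 1 / 2) :
    varianceConst A = growthConst A := if_pos hA

theorem varianceConst_pos (hd : 0 < d) (A : Fin d → ℝ) : 0 < varianceConst A := by
  unfold varianceConst
  split_ifs with hA
  · exact growthConst_pos hd hA
  · exact one_pos

theorem exists_lt_varianceConst (hd : 0 < d) (κ : ℝ) : ∃ δ > 0, ∀ A : Fin d → ℝ,
    (∀ i, 0 < A i ∧ A i < 1 / 2) → (⨅ i, A i) < δ → κ < varianceConst A := by
  have : Nonempty (Fin d) := ⟨⟨0, hd⟩⟩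
  refine ⟨1 / (|κ| + 1), by positivity, fun A hA hlt => ?_⟩
  obtain ⟨i, hi⟩ := exists_eq_ciInf_of_finite (f := A)
  rw [varianceConst_eq hA]
  refine lt_of_lt_of_le ?_ (one_div_le_growthConst hd hA i)
  rw [← hi] at hlt
  have h1 := (lt_one_div (hA i).1 (by positivity)).1 hlt
  linarith [le_abs_self κ]

theorem discrepancyConst_pos {t : ℕ} {ε : ℝ} (hε : 0 < ε) : 0 < discrepancyConst d t ε := by
  have := sizeConst_pos (div_pos hε (by positivity : (0 : ℝ) < d + 1))
  unfold discrepancyConst; positivity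

/-- The factor `sizeConst (ε / 2)` exceeds `1 / (2 ^ (ε / 2) - 1)`, which blows up as `ε` decreases
to zero, and the other factors are at least 1. -/
theorem tendsto_sequenceConst (d t : ℕ) : Tendsto (sequenceConst d t) (𝓝[>] 0) atTop := by
  have h1 : Tendsto (fun ε : ℝ => (2 : ℝ) ^ (ε / 2) - 1) (𝓝[>] 0) (𝓝[>] 0) := by
    refine tendsto_nhdsWithin_iff.2 ⟨?_, ?_⟩
    · have h2 : ContinuousAt (fun ε : ℝ => (2 : ℝ) ^ (ε / 2) - 1) 0 := by
        refine ContinuousAt.sub (ContinuousAt.rpow continuousAt_const (by fun_prop)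
          (Or.inl (by norm_num))) continuousAt_const
      have h3 := h2.tendsto
      simp only [zero_div, Real.rpow_zero, sub_self] at h3
      exact h3.mono_left nhdsWithin_le_nhds
    · filter_upwards [self_mem_nhdsWithin] with ε hε
      exact sub_pos.2 (one_lt_two_rpow (half_pos hε))
  refine tendsto_atTop_mono' _ ?_ h1.inv_tendsto_nhdsGT_zero
  filter_upwards [self_mem_nhdsWithin] with ε hε
  have hε' : 0 < ε / 2 := half_pos hε
  have h3 := one_le_levelConst (d := d) hε'
  have h4 := sizeConst_pos hε'
  have h5 : (1 : ℝ) ≤ 2 ^ (2 * t + d) := one_le_pow₀ (by norm_num)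
  have h6 : ((2 : ℝ) ^ (ε / 2) - 1)⁻¹ ≤ sizeConst (ε / 2) := by
    rw [sizeConst, one_div]; linarith
  rw [Pi.inv_apply]
  refine h6.trans ?_
  rw [sequenceConst, mul_assoc]
  have h7 : sizeConst (ε / 2) ≤ sizeConst (ε / 2) * levelConst d (ε / 2) :=
    le_mul_of_one_le_right h4.le h3
  exact h7.trans (le_mul_of_one_le_left (h4.le.trans h7) h5)

theorem numInner_pred (M₀ : ℕ) {ℓ : ℕ} (hℓ : 1 ≤ ℓ) :
    (numInner M₀ (ℓ - 1) : ℝ) = (numInner M₀ ℓ : ℝ) / 2 := by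
  obtain ⟨k, rfl⟩ := Nat.exists_eq_add_of_le' hℓ
  rw [Nat.add_sub_cancel]
  unfold numInner
  push_cast
  rw [pow_succ]; ring

theorem meshSize_pred (h₀ : ℝ) {ℓ : ℕ} (hℓ : 1 ≤ ℓ) :
    meshSize h₀ (ℓ - 1) = 2 * meshSize h₀ ℓ := by
  obtain ⟨k, rfl⟩ := Nat.exists_eq_add_of_le' hℓ
  rw [Nat.add_sub_cancel]
  unfold meshSize
  rw [pow_succ]; field_simp

theorem variance_term_le {x c κ g B s C₁ D : ℝ} (hD : 0 < D) (hB : g = B) (hs0 : 0 ≤ s)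
    (hsC : s ≤ C₁) (h : 2 * x ^ 2 ≤ c * κ ^ 2) :
    2 * (x * g * s) ^ 2 / D ≤ c * κ ^ 2 * B ^ 2 * C₁ ^ 2 / D := by
  refine div_le_div_of_nonneg_right ?_ hD.le
  rw [hB]
  have h0 : 0 ≤ c * κ ^ 2 := le_trans (by positivity) h
  calc 2 * (x * B * s) ^ 2 = 2 * x ^ 2 * B ^ 2 * s ^ 2 := by ring
    _ ≤ c * κ ^ 2 * B ^ 2 * C₁ ^ 2 := by gcongr

end

end NestedQMC

/-! ### The variance of a level difference -/

theorem mainTheorem4 (d₁ : ℕ) (hd₁ : 0 < d₁) :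
    ∃ (B : (Fin d₁ → ℝ) → ℝ) (κI κII : ℝ → ℝ → ℝ),
      (∀ A, 0 < B A) ∧
      (∀ K : ℝ, ∃ δ > 0, ∀ A : Fin d₁ → ℝ, (∀ i, 0 < A i ∧ A i < 1 / 2) →
        (⨅ i, A i) < δ → K < B A) ∧
      (∀ ε η : ℝ, 0 < κI ε η ∧ 0 < κII ε η) ∧
      -- the outer Sobol' sequence and its constant `C_{ε,d₁}`
      ∀ U : SobolData d₁, ∃ C₁ : ℝ → ℝ,
        (∀ ε > 0, 0 < C₁ ε) ∧ Tendsto C₁ (𝓝[>] 0) atTop ∧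
        -- the random scramblings of the levels
        ∀ (Ω : Type*) [MeasurableSpace Ω] (μ : Measure Ω) [IsProbabilityMeasure μ]
          (π : ℕ → Ω → Fin d₁ → List (ZMod 2) → Bool), (∀ ℓ, IsOwenScrambling μ (π ℓ)) →
          (∀ ε > 0, ∀ ℓ N : ℕ, 1 ≤ N →
            ∫⁻ ω, ENNReal.ofReal
                (starDiscrepancy (fun n => scramble (π ℓ ω) (U.digit n)) N) ∂μ
              ≤ ENNReal.ofReal (C₁ ε / (N : ℝ) ^ (1 - ε))) ∧
          -- the inner Sobol' sequence, the integrands, and the parameters of the levels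
          ∀ (d₂ : ℕ) (T : SobolData d₂)
            (S : Set ℝ) (f : ℝ → ℝ)
            (g : (Fin d₁ → ℝ) → (Fin d₂ → ℝ) → ℝ)
            (gh : ℝ → (Fin d₁ → ℝ) → (Fin d₂ → ℝ) → ℝ)
            (L M₀ : ℕ) (h₀ : ℝ) (N : ℕ → ℕ),
            1 ≤ M₀ → 0 < h₀ → (∀ ℓ, 1 ≤ N ℓ) →
            -- `f` is twice differentiable on the open interval `S`, with integrable `f''`
            IsOpen S → Convex ℝ S →
            DifferentiableOn ℝ f S → DifferentiableOn ℝ (deriv f) S →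
            (∀ a ∈ S, ∀ b ∈ S, IntervalIntegrable (deriv (deriv f)) volume a b) →
            (∀ y ∈ openCube d₁, IntegrableOn (g y) (Set.Icc 0 1) volume) →
            (∀ y ∈ openCube d₁, innerIntegral g y ∈ S) →
            (∀ k < L, ∀ y ∈ openCube d₁, innerQMC gh T M₀ h₀ k y ∈ S) →
            -- the boundary growth conditions
            ∀ (ε C₂ η Cη bI bII : ℝ) (AI AII : Fin d₁ → ℝ),
              0 < ε → 0 < C₂ → 0 < η → 0 < Cη → 0 < bI → 0 < bII →
              (∀ i, 0 < AI i ∧ AI i < 1 / 2) → (∀ i, 0 < AII i ∧ AII i < 1 / 2) →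
              (∀ k < L, BoundaryGrowth (phiI f (innerIntegral g) (innerQMC gh T M₀ h₀ k))
                ((C₂ * (numInner M₀ k : ℝ) ^ (-1 + ε) + Cη * meshSize h₀ k ^ η) * bI) AI) →
              (∀ k < L, BoundaryGrowth (phiII f (innerIntegral g) (innerQMC gh T M₀ h₀ k))
                ((C₂ ^ 2 * (numInner M₀ k : ℝ) ^ (-2 + 2 * ε) +
                  Cη ^ 2 * meshSize h₀ k ^ (2 * η)) * bII) AII) →
              ∀ ℓ, 1 ≤ ℓ → ℓ < L →
                MemLp (fun ω => levelDifference f gh U T M₀ h₀ (N ℓ) ℓ (π ℓ ω)) 2 μ ∧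
                variance (fun ω => levelDifference f gh U T M₀ h₀ (N ℓ) ℓ (π ℓ ω)) μ ≤
                  (C₂ ^ 2 / (numInner M₀ ℓ : ℝ) ^ (2 - 2 * ε) +
                      Cη ^ 2 * meshSize h₀ ℓ ^ (2 * η)) *
                    (κI ε η * bI) ^ 2 * B AI ^ 2 * C₁ ε ^ 2 /
                      (N ℓ : ℝ) ^ (2 - 2 * ε - 2 * ⨆ i, AI i) +
                  (C₂ ^ 4 / (numInner M₀ ℓ : ℝ) ^ (4 - 4 * ε) +
                      Cη ^ 4 * meshSize h₀ ℓ ^ (4 * η)) *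
                    (κII ε η * bII) ^ 2 * B AII ^ 2 * C₁ ε ^ 2 /
                      (N ℓ : ℝ) ^ (2 - 2 * ε - 2 * ⨆ i, AII i) := by
  -- The `κ` are those of `two_mul_sq_level_constants_le` for the rates `(-1 + ε, η)` and `(-2 + 2ε,
  -- 2η)`. The constant of the outer sequence is a sum, so that it dominates both the variance
  -- constant and the discrepancy constant.
  refine ⟨varianceConst, fun ε η => 2 * (1 + 2 ^ (-(-1 + ε)) + 2 ^ η),
    fun ε η => 2 * (1 + 2 ^ (-(-2 + 2 * ε)) + 2 ^ (2 * η)), varianceConst_pos hd₁,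
    exists_lt_varianceConst hd₁, fun ε η => ⟨by positivity, by positivity⟩, fun U =>
    ⟨fun ε => sequenceConst d₁ U.quality ε + discrepancyConst d₁ U.quality ε,
      fun ε hε => add_pos (sequenceConst_pos hε) (discrepancyConst_pos hε), ?_, ?_⟩⟩
  · refine tendsto_atTop_mono' _ ?_ (tendsto_sequenceConst d₁ U.quality)
    filter_upwards [self_mem_nhdsWithin] with ε hε
    exact le_add_of_nonneg_right (discrepancyConst_pos hε).le
  · intro Ω _ μ _ π hπ
    refine ⟨fun ε hε ℓ N hN => ?_, ?_⟩
    · have hle : ∀ ω, ENNReal.ofReal (starDiscrepancy (fun n => scramble (π ℓ ω) (U.digit n)) N) ≤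
          ENNReal.ofReal ((sequenceConst d₁ U.quality ε + discrepancyConst d₁ U.quality ε) /
            (N : ℝ) ^ (1 - ε)) := fun ω => by
        refine ENNReal.ofReal_le_ofReal ((starDiscrepancy_scramble_le U hε hN (π ℓ ω)).trans ?_)
        refine div_le_div_of_nonneg_right ?_ (by positivity)
        exact le_add_of_nonneg_left (sequenceConst_pos hε).le
      refine (lintegral_mono hle).trans ?_
      simp
    · intro d₂ T S f g gh L M₀ h₀ N hM₀ hh₀ hN hS hconv hf hf' hf'' _ hgS hqS ε C₂ η Cη bI bII
        AI AII hε hC₂ hη hCη hbI hbII hAI hAII hI hII ℓ hℓ hℓL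
      have hM : (0 : ℝ) < numInner M₀ ℓ := by
        unfold numInner; push_cast
        have : (0 : ℝ) < M₀ := by exact_mod_cast hM₀
        positivity
      have hh : 0 < meshSize h₀ ℓ := by unfold meshSize; positivity
      have hNpos : (0 : ℝ) < N ℓ := by exact_mod_cast hN ℓ
      have hpred : ℓ - 1 < L := by omega
      -- Growth constants of consecutive levels add; the coarser one is then expressed through `M /
      -- 2` and `2 h` of level `ℓ`.
      have hgI := (hI ℓ hℓL).sub (hI (ℓ - 1) hpred)
      have hgII := (hII ℓ hℓL).sub (hII (ℓ - 1) hpred)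
      rw [numInner_pred M₀ hℓ, meshSize_pred h₀ hℓ] at hgI hgII
      have htaylor : ∀ k < L, ∀ y ∈ openCube d₁, f (innerQMC gh T M₀ h₀ k y) =
          f (innerIntegral g y) + phiI f (innerIntegral g) (innerQMC gh T M₀ h₀ k) y +
            phiII f (innerIntegral g) (innerQMC gh T M₀ h₀ k) y := fun k hk y hy =>
        taylor_integral_remainder hS hconv hf hf' hf'' (hgS y hy) (hqS k hk y hy)
      -- The term `f (ḡ)` is common to both levels and cancels, so no growth condition on it is
      -- needed.
      have hcore := (hπ ℓ).memLp_and_variance_le hd₁ U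
        (F := fun y => f (innerQMC gh T M₀ h₀ ℓ y) - f (innerQMC gh T M₀ h₀ (ℓ - 1) y))
        (by positivity) (by positivity) hAI hAII hgI hgII (fun y hy => by
          rw [htaylor ℓ hℓL y hy, htaylor (ℓ - 1) hpred y hy]; ring) hε (hN ℓ)
      have hdiff : (fun ω => levelDifference f gh U T M₀ h₀ (N ℓ) ℓ (π ℓ ω)) = fun ω =>
          (1 / (N ℓ : ℝ)) * ∑ n ∈ Finset.range (N ℓ),
            (f (innerQMC gh T M₀ h₀ ℓ (scramble (π ℓ ω) (U.digit n))) -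
              f (innerQMC gh T M₀ h₀ (ℓ - 1) (scramble (π ℓ ω) (U.digit n)))) := by
        funext ω
        rw [levelDifference, outerRQMC, outerRQMC, Finset.sum_sub_distrib, mul_sub]
      rw [hdiff]
      refine ⟨hcore.1, hcore.2.trans (add_le_add ?_ ?_)⟩
      · refine variance_term_le (by positivity) (varianceConst_eq hAI).symm
          (sequenceConst_pos hε).le (le_add_of_nonneg_right (discrepancyConst_pos hε).le) ?_
        have := two_mul_sq_level_constants_le (r := -1 + ε) (e := η) (b := bI) hC₂ hCη hM hh
        rwa [show -2 * (-1 + ε) = 2 - 2 * ε by ring] at this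
      · refine variance_term_le (by positivity) (varianceConst_eq hAII).symm
          (sequenceConst_pos hε).le (le_add_of_nonneg_right (discrepancyConst_pos hε).le) ?_
        have := two_mul_sq_level_constants_le (r := -2 + 2 * ε) (e := 2 * η) (b := bII)
          (pow_pos hC₂ 2) (pow_pos hCη 2) hM hh
        rwa [show -2 * (-2 + 2 * ε) = 4 - 4 * ε by ring, show 2 * (2 * η) = 4 * η by ring,
          ← pow_mul, ← pow_mul] at this
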